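/- A $3$-graph is a hypergraph $H=(V(H),E(H))$ on a finite vertex set all of whose edges have exactly three vertices. Let $P$ be the loose path of length three, that is, the $3$-graph with $7$ vertices $a,b,c,d,e,f,g$ and edges $\{a,b,c\},\{c,d,e\},\{e,f,g\}$, and let $M$ be the $3$-graph consisting of two disjoint edges. A $3$-graph is $P$-free if it has no sub-$3$-graph isomorphic to $P$. For $n\ge 6$ let $\mathrm{ex}_3(n;P|M)$ be the maximum number of edges in an $n$-vertex $P$-free $3$-graph which contains a copy of $M$, and let $\mathrm{Ex}_3(n;P|M)$ be the family, up to isomorphism, of all $n$-vertex $P$-free $3$-graphs which contain a copy of $M$ and have exactly $\mathrm{ex}_3(n;P|M)$ edges. Let $K^3_m$ be the complete $3$-graph on $m$ vertices (with no edges if $m\le 2$), let $\cup$ denote vertex-disjoint union, and for $n\ge 4$ let the comet $\mathrm{Co}(n)$ be the $n$-vertex $3$-graph formed by a copy of $K^3_4$ and a full star on $n-3$ vertices (all triples of these vertices that contain the center of the star) whose only common vertex is the center of the star. Then $$ \mathrm{ex}_3(n;P|M)=\begin{cases} 20+\binom{n-6}{3} & \text{and } \mathrm{Ex}_3(n;P|M)=\{K^3_6\cup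 K^3_{n-6}\} \text{ for } 6\le n\le 12,\\ 40 & \text{and } \mathrm{Ex}_3(n;P|M)=\{K^3_6\cup K^3_6\cup K^3_1,\ \mathrm{Co}(13)\} \text{ for } n=13,\\ 4+\binom{n-4}{2} & \text{and } \mathrm{Ex}_3(n;P|M)=\{\mathrm{Co}(n)\} \text{ for } n\ge 14. \end{cases} $$ -/

import Mathlib

/-- A `k`-uniform hypergraph (`k`-graph) with vertex set the whole type `V`: a finite set of edges,
each of which is a `k`-element set of vertices. -/
@[ext]
structure KGraph (k : ℕ) (V : Type*) where
  edges : Finset (Finset V)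
  sized : (edges : Set (Finset V)).Sized k

namespace KGraph

/-- `F ⊆ H` in the sense of Turán theory: `H` has a sub-hypergraph that is a copy of `F`. -/
def Contains {k : ℕ} {U V : Type*} (H : KGraph k V) (F : KGraph k U) : Prop :=
  ∃ f : U ↪ V, ∀ e ∈ F.edges, e.map f ∈ H.edges

/-- `H` is `F`-free. -/
def Free {k : ℕ} {U V : Type*} (H : KGraph k V) (F : KGraph k U) : Prop :=
  ¬ H.Contains F

/-- Isomorphism of `k`-graphs. -/
def Iso {k : ℕ} {U V : Type*} (F : KGraph k U) (H : KGraph k V) : Prop :=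
  ∃ f : U ≃ V, ∀ e : Finset U, e ∈ F.edges ↔ e.map f.toEmbedding ∈ H.edges

/-- The conditional Turán number `ex_k(n; F | G)`: the largest number of edges in an `n`-vertex
`F`-free `k`-graph that contains a copy of `G`. (The set of edge counts is bounded, there being
finitely many `k`-graphs on `Fin n`.) -/
noncomputable def condEx {k : ℕ} {U W : Type*} (n : ℕ) (F : KGraph k U) (G : KGraph k W) : ℕ :=
  sSup {m : ℕ | ∃ H : KGraph k (Fin n), H.Free F ∧ H.Contains G ∧ H.edges.card = m}

/-- The family `Ex_k(n; F | G)` of all `n`-vertex `k`-graphs that are `G`-extremal for `F`. -/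
def condExtremal {k : ℕ} {U W : Type*} (n : ℕ) (F : KGraph k U) (G : KGraph k W) :
    Set (KGraph k (Fin n)) :=
  {H | H.Free F ∧ H.Contains G ∧ H.edges.card = condEx n F G}

/-- The complete `k`-graph `K^k_n`. -/
def complete (k n : ℕ) : KGraph k (Fin n) where
  edges := Finset.powersetCard k Finset.univ
  sized := by
    intro e he
    exact (Finset.mem_powersetCard.1 (Finset.mem_coe.1 he)).2

/-- The vertex-disjoint union of two `k`-graphs. -/
def disjUnion {k : ℕ} {U V : Type*} [DecidableEq U] [DecidableEq V]
    (F : KGraph k U) (H : KGraph k V) : KGraph k (U ⊕ V) where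
  edges := F.edges.image (fun e => e.map Function.Embedding.inl) ∪
    H.edges.image (fun e => e.map Function.Embedding.inr)
  sized := by
    intro e he
    simp only [Finset.coe_union, Finset.coe_image, Set.mem_union, Set.mem_image,
      Finset.mem_coe] at he
    rcases he with ⟨d, hd, rfl⟩ | ⟨d, hd, rfl⟩
    · rw [Finset.card_map]; exact F.sized hd
    · rw [Finset.card_map]; exact H.sized hd

/-- The loose 3-uniform path `P` of length 3. -/
def pathP : KGraph 3 (Fin 7) where
  edges := {{0, 1, 2}, {2, 3, 4}, {4, 5, 6}}
  sized := by
    intro e he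
    simp only [Finset.coe_insert, Finset.coe_singleton, Set.mem_insert_iff,
      Set.mem_singleton_iff] at he
    rcases he with rfl | rfl | rfl <;> rfl

/-- The 3-graph `M` consisting of two disjoint edges. -/
def matchingM : KGraph 3 (Fin 6) where
  edges := {{0, 1, 2}, {3, 4, 5}}
  sized := by
    intro e he
    simp only [Finset.coe_insert, Finset.coe_singleton, Set.mem_insert_iff,
      Set.mem_singleton_iff] at he
    rcases he with rfl | rfl <;> rfl

/-- The comet `Co(n)`: a copy of `K^3_4` on the vertices `0, 1, 2, 3`, with center `0` and head
`{1, 2, 3}`, together with a full star with center `0` on the `n - 3` vertices outside the head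
(for `n ≥ 4`). -/
def comet (n : ℕ) : KGraph 3 (Fin n) where
  edges := (Finset.powersetCard 3 Finset.univ).filter fun e =>
    (∀ v ∈ e, v.val ≤ 3) ∨
      ((∃ v ∈ e, v.val = 0) ∧ ∀ v ∈ e, v.val ∉ Finset.Icc 1 3)
  sized := by
    intro e he
    exact (Finset.mem_powersetCard.1 (Finset.mem_filter.1 (Finset.mem_coe.1 he)).1).2

end KGraph

/-! Split the edge set into vertex-disjoint parts. In a `P`-free family, an edge that meets two
disjoint edges meets one of them in two vertices and the other in one, because 1 and 1 would give a
loose path. Hence a connected `P`-free family with two disjoint edges contains `abc`, `bcx`, `xyz`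
on six vertices, the core. Let `W` be the set of the `m` other vertices of the support.
Path-freeness leaves few shapes (`FreeConfig.edge_cases`): an edge lies in the core, or in `W` (an
inner edge), or is one of `bcw`, `xyw`, `xzw`, `yzw`, `aww'`, `xww'` with `w`, `w'` in `W`.

Suppose that some `aww'` or `xww'` is an edge. Then the core carries at most 7 edges, and twice the
number of edges is at most twice the core edges, plus twice the inner edges, plus the sum of
`outerWeight` over `W`. This weight is at most 4 at vertices on inner edges and at most `max 8 (p +
3)` at the `p` others; the inner edges are bounded by induction. The critical case has no inner edge
and some edge `xww'`: for `m ≥ 7` twice the size is at most `10 + m (m + 3) = 8 + (m + 2)(m + 1)`,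
twice the size of the comet on `m + 6` vertices, and equality forces a subfamily of a comet. If no
`aww'` or `xww'` is an edge, then either an inner edge is attached to the core, and exchanging the
core produces such an edge, or every edge has at most one outer vertex and the size is linear in
`m`. The outcome is `LinkConnected.connectedBound`.

Intersecting families are bounded by Erdős–Ko–Rado, and induction over the support gives
`card_le_edgeBound`. A disconnected family has at most `edgeBound p + edgeBound q` edges.
Numerically, two cliques, one of them on six vertices, win up to 12 vertices, tie with the comet at
13, and lose to it from 14 on. Equality in the disconnected case makes both parts complete. -/

open Finset

/-! ### Loose paths and the configuration `abc`, `bcx`, `xyz`. -/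

section Paths

variable {V : Type*} [DecidableEq V] {E : Finset (Finset V)}

/-- No edge meets each of two disjoint edges in exactly one vertex. For a `3`-uniform family this
says that there is no loose path of length three. -/
def LoosePathFree (E : Finset (Finset V)) : Prop :=
  ∀ e ∈ E, ∀ f ∈ E, ∀ g ∈ E, Disjoint e f → #(g ∩ e) = 1 → #(g ∩ f) = 1 → False

/-- The family cannot be split into two nonempty vertex-disjoint parts. -/
def LinkConnected (E : Finset (Finset V)) : Prop :=
  ∀ F ⊆ E, F.Nonempty → (E \ F).Nonempty → ∃ e ∈ F, ∃ f ∈ E \ F, ¬ Disjoint e f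

theorem LoosePathFree.mono {F : Finset (Finset V)} (hE : LoosePathFree E) (h : F ⊆ E) :
    LoosePathFree F :=
  fun e he f hf g hg => hE e (h he) f (h hf) g (h hg)

theorem LoosePathFree.not_path (hE : LoosePathFree E) {p q r s t u v : V}
    (hd : [p, q, r, s, t, u, v].Nodup) (h₁ : {p, q, r} ∈ E) (h₂ : {r, s, t} ∈ E)
    (h₃ : {t, u, v} ∈ E) : False := by
  simp only [List.nodup_cons, List.mem_cons, List.not_mem_nil, or_false, not_or] at hd
  refine hE _ h₁ _ h₃ _ h₂ ?_ ?_ ?_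
  · rw [Finset.disjoint_left]; intro i; simp only [mem_insert, mem_singleton]; grind
  · rw [Finset.card_eq_one]; refine ⟨r, ?_⟩
    ext i; simp only [mem_inter, mem_insert, mem_singleton]; grind
  · rw [Finset.card_eq_one]; refine ⟨t, ?_⟩
    ext i; simp only [mem_inter, mem_insert, mem_singleton]; grind

/-- Together with `triple_swap` this generates all six orders of a triple, which is how edges
written in different orders are matched below. -/
theorem triple_rotate (p q r : V) : ({p, q, r} : Finset V) = {q, r, p} := by
  ext i; simp only [mem_insert, mem_singleton]; tauto

theorem triple_swap (p q r : V) : ({p, q, r} : Finset V) = {q, p, r} := by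
  ext i; simp only [mem_insert, mem_singleton]; tauto

/-- Three edges `abc`, `bcx`, `xyz` on six vertices. -/
structure LinkConfig (E : Finset (Finset V)) (a b c x y z : V) : Prop where
  nodup : [a, b, c, x, y, z].Nodup
  abc : {a, b, c} ∈ E
  bcx : {b, c, x} ∈ E
  xyz : {x, y, z} ∈ E

namespace LinkConfig

variable {a b c x y z u v w w' w'' : V}

/-- The configuration is symmetric under exchanging `b` with `c` and `y` with `z`; the exclusions
below are therefore proved for one representative of each orbit. -/
theorem swap_bc (C : LinkConfig E a b c x y z) : LinkConfig E a c b x y z where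
  nodup := by have := C.nodup; grind
  abc := by grind [C.abc, triple_rotate, triple_swap]
  bcx := by grind [C.bcx, triple_rotate, triple_swap]
  xyz := C.xyz

theorem swap_yz (C : LinkConfig E a b c x y z) : LinkConfig E a b c x z y where
  nodup := by have := C.nodup; grind
  abc := C.abc
  bcx := C.bcx
  xyz := by grind [C.xyz, triple_rotate, triple_swap]

/-! The lemmas `notMem_t_of_s` say that the triple `t` is not an edge if the triple `s` is one; each
exhibits a loose path. The vertices `u`, `v`, `w`, `w'`, `w''` lie outside the configuration. -/

theorem notMem_bww (C : LinkConfig E a b c x y z)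
    (hE : LoosePathFree E) (hd : [a, b, c, x, y, z, w, w'].Nodup) :
    {b, w, w'} ∉ E := by
  intro h
  exact hE.not_path (p := w) (q := w') (r := b) (s := c) (t := x) (u := y) (v := z)
    (by simp only [List.nodup_cons, List.mem_cons, List.not_mem_nil, or_false, not_or] at hd ⊢
        grind)
    (by grind [C.abc, C.bcx, C.xyz, triple_rotate, triple_swap])
    (by grind [C.abc, C.bcx, C.xyz, triple_rotate, triple_swap])
    (by grind [C.abc, C.bcx, C.xyz, triple_rotate, triple_swap])

theorem notMem_yww (C : LinkConfig E a b c x y z)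
    (hE : LoosePathFree E) (hd : [a, b, c, x, y, z, w, w'].Nodup) :
    {y, w, w'} ∉ E := by
  intro h
  exact hE.not_path (p := w) (q := w') (r := y) (s := z) (t := x) (u := b) (v := c)
    (by simp only [List.nodup_cons, List.mem_cons, List.not_mem_nil, or_false, not_or] at hd ⊢
        grind)
    (by grind [C.abc, C.bcx, C.xyz, triple_rotate, triple_swap])
    (by grind [C.abc, C.bcx, C.xyz, triple_rotate, triple_swap])
    (by grind [C.abc, C.bcx, C.xyz, triple_rotate, triple_swap])

theorem notMem_axw (C : LinkConfig E a b c x y z)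
    (hE : LoosePathFree E) (hd : [a, b, c, x, y, z, w].Nodup) :
    {a, x, w} ∉ E := by
  intro h
  exact hE.not_path (p := b) (q := c) (r := a) (s := w) (t := x) (u := y) (v := z)
    (by simp only [List.nodup_cons, List.mem_cons, List.not_mem_nil, or_false, not_or] at hd ⊢
        grind)
    (by grind [C.abc, C.bcx, C.xyz, triple_rotate, triple_swap])
    (by grind [C.abc, C.bcx, C.xyz, triple_rotate, triple_swap])
    (by grind [C.abc, C.bcx, C.xyz, triple_rotate, triple_swap])

theorem notMem_ayw (C : LinkConfig E a b c x y z)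
    (hE : LoosePathFree E) (hd : [a, b, c, x, y, z, w].Nodup) :
    {a, y, w} ∉ E := by
  intro h
  exact hE.not_path (p := b) (q := c) (r := a) (s := w) (t := y) (u := x) (v := z)
    (by simp only [List.nodup_cons, List.mem_cons, List.not_mem_nil, or_false, not_or] at hd ⊢
        grind)
    (by grind [C.abc, C.bcx, C.xyz, triple_rotate, triple_swap])
    (by grind [C.abc, C.bcx, C.xyz, triple_rotate, triple_swap])
    (by grind [C.abc, C.bcx, C.xyz, triple_rotate, triple_swap])

theorem notMem_bxw (C : LinkConfig E a b c x y z)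
    (hE : LoosePathFree E) (hd : [a, b, c, x, y, z, w].Nodup) :
    {b, x, w} ∉ E := by
  intro h
  exact hE.not_path (p := a) (q := c) (r := b) (s := w) (t := x) (u := y) (v := z)
    (by simp only [List.nodup_cons, List.mem_cons, List.not_mem_nil, or_false, not_or] at hd ⊢
        grind)
    (by grind [C.abc, C.bcx, C.xyz, triple_rotate, triple_swap])
    (by grind [C.abc, C.bcx, C.xyz, triple_rotate, triple_swap])
    (by grind [C.abc, C.bcx, C.xyz, triple_rotate, triple_swap])

theorem notMem_byw (C : LinkConfig E a b c x y z)
    (hE : LoosePathFree E) (hd : [a, b, c, x, y, z, w].Nodup) :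
    {b, y, w} ∉ E := by
  intro h
  exact hE.not_path (p := a) (q := c) (r := b) (s := w) (t := y) (u := x) (v := z)
    (by simp only [List.nodup_cons, List.mem_cons, List.not_mem_nil, or_false, not_or] at hd ⊢
        grind)
    (by grind [C.abc, C.bcx, C.xyz, triple_rotate, triple_swap])
    (by grind [C.abc, C.bcx, C.xyz, triple_rotate, triple_swap])
    (by grind [C.abc, C.bcx, C.xyz, triple_rotate, triple_swap])

theorem notMem_abw (C : LinkConfig E a b c x y z)
    (hE : LoosePathFree E) (hd : [a, b, c, x, y, z, w].Nodup) :
    {a, b, w} ∉ E := by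
  intro h
  exact hE.not_path (p := a) (q := w) (r := b) (s := c) (t := x) (u := y) (v := z)
    (by simp only [List.nodup_cons, List.mem_cons, List.not_mem_nil, or_false, not_or] at hd ⊢
        grind)
    (by grind [C.abc, C.bcx, C.xyz, triple_rotate, triple_swap])
    (by grind [C.abc, C.bcx, C.xyz, triple_rotate, triple_swap])
    (by grind [C.abc, C.bcx, C.xyz, triple_rotate, triple_swap])

theorem notMem_xyw_of_aww (C : LinkConfig E a b c x y z)
    (hE : LoosePathFree E) (hd : [a, b, c, x, y, z, w, w'].Nodup) (h0 : {a, w, w'} ∈ E) :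
    {x, y, w} ∉ E := by
  intro h
  exact hE.not_path (p := a) (q := w') (r := w) (s := y) (t := x) (u := b) (v := c)
    (by simp only [List.nodup_cons, List.mem_cons, List.not_mem_nil, or_false, not_or] at hd ⊢
        grind)
    (by grind [C.abc, C.bcx, C.xyz, triple_rotate, triple_swap])
    (by grind [C.abc, C.bcx, C.xyz, triple_rotate, triple_swap])
    (by grind [C.abc, C.bcx, C.xyz, triple_rotate, triple_swap])

theorem notMem_xww_of_aww (C : LinkConfig E a b c x y z)
    (hE : LoosePathFree E) (hd : [a, b, c, x, y, z, w, w', w''].Nodup) (h0 : {a, w, w'} ∈ E) :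
    {x, w, w''} ∉ E := by
  intro h
  exact hE.not_path (p := a) (q := w') (r := w) (s := w'') (t := x) (u := b) (v := c)
    (by simp only [List.nodup_cons, List.mem_cons, List.not_mem_nil, or_false, not_or] at hd ⊢
        grind)
    (by grind [C.abc, C.bcx, C.xyz, triple_rotate, triple_swap])
    (by grind [C.abc, C.bcx, C.xyz, triple_rotate, triple_swap])
    (by grind [C.abc, C.bcx, C.xyz, triple_rotate, triple_swap])

theorem notMem_yzw_of_aww (C : LinkConfig E a b c x y z)
    (hE : LoosePathFree E) (hd : [a, b, c, x, y, z, w, w'].Nodup) (h0 : {a, w, w'} ∈ E) :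
    {y, z, w} ∉ E := by
  intro h
  exact hE.not_path (p := b) (q := c) (r := a) (s := w') (t := w) (u := y) (v := z)
    (by simp only [List.nodup_cons, List.mem_cons, List.not_mem_nil, or_false, not_or] at hd ⊢
        grind)
    (by grind [C.abc, C.bcx, C.xyz, triple_rotate, triple_swap])
    (by grind [C.abc, C.bcx, C.xyz, triple_rotate, triple_swap])
    (by grind [C.abc, C.bcx, C.xyz, triple_rotate, triple_swap])

theorem notMem_yzw_of_xww (C : LinkConfig E a b c x y z)
    (hE : LoosePathFree E) (hd : [a, b, c, x, y, z, w, w'].Nodup) (h0 : {x, w, w'} ∈ E) :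
    {y, z, w} ∉ E := by
  intro h
  exact hE.not_path (p := b) (q := c) (r := x) (s := w') (t := w) (u := y) (v := z)
    (by simp only [List.nodup_cons, List.mem_cons, List.not_mem_nil, or_false, not_or] at hd ⊢
        grind)
    (by grind [C.abc, C.bcx, C.xyz, triple_rotate, triple_swap])
    (by grind [C.abc, C.bcx, C.xyz, triple_rotate, triple_swap])
    (by grind [C.abc, C.bcx, C.xyz, triple_rotate, triple_swap])

theorem notMem_bcw_of_xww (C : LinkConfig E a b c x y z)
    (hE : LoosePathFree E) (hd : [a, b, c, x, y, z, w, w'].Nodup) (h0 : {x, w, w'} ∈ E) :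
    {b, c, w} ∉ E := by
  intro h
  exact hE.not_path (p := b) (q := c) (r := w) (s := w') (t := x) (u := y) (v := z)
    (by simp only [List.nodup_cons, List.mem_cons, List.not_mem_nil, or_false, not_or] at hd ⊢
        grind)
    (by grind [C.abc, C.bcx, C.xyz, triple_rotate, triple_swap])
    (by grind [C.abc, C.bcx, C.xyz, triple_rotate, triple_swap])
    (by grind [C.abc, C.bcx, C.xyz, triple_rotate, triple_swap])

theorem notMem_xyw_of_wuv (C : LinkConfig E a b c x y z)
    (hE : LoosePathFree E) (hd : [a, b, c, x, y, z, w, u, v].Nodup) (h0 : {w, u, v} ∈ E) :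
    {x, y, w} ∉ E := by
  intro h
  exact hE.not_path (p := u) (q := v) (r := w) (s := y) (t := x) (u := b) (v := c)
    (by simp only [List.nodup_cons, List.mem_cons, List.not_mem_nil, or_false, not_or] at hd ⊢
        grind)
    (by grind [C.abc, C.bcx, C.xyz, triple_rotate, triple_swap])
    (by grind [C.abc, C.bcx, C.xyz, triple_rotate, triple_swap])
    (by grind [C.abc, C.bcx, C.xyz, triple_rotate, triple_swap])

theorem notMem_xww_of_wuv (C : LinkConfig E a b c x y z)
    (hE : LoosePathFree E) (hd : [a, b, c, x, y, z, w, u, v, w'].Nodup) (h0 : {w, u, v} ∈ E) :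
    {x, w, w'} ∉ E := by
  intro h
  exact hE.not_path (p := u) (q := v) (r := w) (s := w') (t := x) (u := b) (v := c)
    (by simp only [List.nodup_cons, List.mem_cons, List.not_mem_nil, or_false, not_or] at hd ⊢
        grind)
    (by grind [C.abc, C.bcx, C.xyz, triple_rotate, triple_swap])
    (by grind [C.abc, C.bcx, C.xyz, triple_rotate, triple_swap])
    (by grind [C.abc, C.bcx, C.xyz, triple_rotate, triple_swap])

theorem notMem_aww_of_wuv (C : LinkConfig E a b c x y z)
    (hE : LoosePathFree E) (hd : [a, b, c, x, y, z, w, u, v, w'].Nodup) (h0 : {w, u, v} ∈ E) :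
    {a, w, w'} ∉ E := by
  intro h
  exact hE.not_path (p := u) (q := v) (r := w) (s := w') (t := a) (u := b) (v := c)
    (by simp only [List.nodup_cons, List.mem_cons, List.not_mem_nil, or_false, not_or] at hd ⊢
        grind)
    (by grind [C.abc, C.bcx, C.xyz, triple_rotate, triple_swap])
    (by grind [C.abc, C.bcx, C.xyz, triple_rotate, triple_swap])
    (by grind [C.abc, C.bcx, C.xyz, triple_rotate, triple_swap])

theorem notMem_axy_of_xww (C : LinkConfig E a b c x y z)
    (hE : LoosePathFree E) (hd : [a, b, c, x, y, z, w, w'].Nodup) (h0 : {x, w, w'} ∈ E) :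
    {a, x, y} ∉ E := by
  intro h
  exact hE.not_path (p := b) (q := c) (r := a) (s := y) (t := x) (u := w) (v := w')
    (by simp only [List.nodup_cons, List.mem_cons, List.not_mem_nil, or_false, not_or] at hd ⊢
        grind)
    (by grind [C.abc, C.bcx, C.xyz, triple_rotate, triple_swap])
    (by grind [C.abc, C.bcx, C.xyz, triple_rotate, triple_swap])
    (by grind [C.abc, C.bcx, C.xyz, triple_rotate, triple_swap])

theorem notMem_bxy_of_xww (C : LinkConfig E a b c x y z)
    (hE : LoosePathFree E) (hd : [a, b, c, x, y, z, w, w'].Nodup) (h0 : {x, w, w'} ∈ E) :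
    {b, x, y} ∉ E := by
  intro h
  exact hE.not_path (p := a) (q := c) (r := b) (s := y) (t := x) (u := w) (v := w')
    (by simp only [List.nodup_cons, List.mem_cons, List.not_mem_nil, or_false, not_or] at hd ⊢
        grind)
    (by grind [C.abc, C.bcx, C.xyz, triple_rotate, triple_swap])
    (by grind [C.abc, C.bcx, C.xyz, triple_rotate, triple_swap])
    (by grind [C.abc, C.bcx, C.xyz, triple_rotate, triple_swap])

theorem notMem_cxy_of_xww (C : LinkConfig E a b c x y z)
    (hE : LoosePathFree E) (hd : [a, b, c, x, y, z, w, w'].Nodup) (h0 : {x, w, w'} ∈ E) :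
    {c, x, y} ∉ E := by
  intro h
  exact hE.not_path (p := a) (q := b) (r := c) (s := y) (t := x) (u := w) (v := w')
    (by simp only [List.nodup_cons, List.mem_cons, List.not_mem_nil, or_false, not_or] at hd ⊢
        grind)
    (by grind [C.abc, C.bcx, C.xyz, triple_rotate, triple_swap])
    (by grind [C.abc, C.bcx, C.xyz, triple_rotate, triple_swap])
    (by grind [C.abc, C.bcx, C.xyz, triple_rotate, triple_swap])

theorem notMem_byz_of_xww (C : LinkConfig E a b c x y z)
    (hE : LoosePathFree E) (hd : [a, b, c, x, y, z, w, w'].Nodup) (h0 : {x, w, w'} ∈ E) :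
    {b, y, z} ∉ E := by
  intro h
  exact hE.not_path (p := y) (q := z) (r := b) (s := c) (t := x) (u := w) (v := w')
    (by simp only [List.nodup_cons, List.mem_cons, List.not_mem_nil, or_false, not_or] at hd ⊢
        grind)
    (by grind [C.abc, C.bcx, C.xyz, triple_rotate, triple_swap])
    (by grind [C.abc, C.bcx, C.xyz, triple_rotate, triple_swap])
    (by grind [C.abc, C.bcx, C.xyz, triple_rotate, triple_swap])

theorem notMem_aby_of_xww (C : LinkConfig E a b c x y z)
    (hE : LoosePathFree E) (hd : [a, b, c, x, y, z, w, w'].Nodup) (h0 : {x, w, w'} ∈ E) :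
    {a, b, y} ∉ E := by
  intro h
  exact hE.not_path (p := a) (q := b) (r := y) (s := z) (t := x) (u := w) (v := w')
    (by simp only [List.nodup_cons, List.mem_cons, List.not_mem_nil, or_false, not_or] at hd ⊢
        grind)
    (by grind [C.abc, C.bcx, C.xyz, triple_rotate, triple_swap])
    (by grind [C.abc, C.bcx, C.xyz, triple_rotate, triple_swap])
    (by grind [C.abc, C.bcx, C.xyz, triple_rotate, triple_swap])

theorem notMem_bcy_of_xww (C : LinkConfig E a b c x y z)
    (hE : LoosePathFree E) (hd : [a, b, c, x, y, z, w, w'].Nodup) (h0 : {x, w, w'} ∈ E) :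
    {b, c, y} ∉ E := by
  intro h
  exact hE.not_path (p := b) (q := c) (r := y) (s := z) (t := x) (u := w) (v := w')
    (by simp only [List.nodup_cons, List.mem_cons, List.not_mem_nil, or_false, not_or] at hd ⊢
        grind)
    (by grind [C.abc, C.bcx, C.xyz, triple_rotate, triple_swap])
    (by grind [C.abc, C.bcx, C.xyz, triple_rotate, triple_swap])
    (by grind [C.abc, C.bcx, C.xyz, triple_rotate, triple_swap])

theorem notMem_abx_of_ayz_of_xww (_C : LinkConfig E a b c x y z)
    (hE : LoosePathFree E) (hd : [a, b, c, x, y, z, w, w'].Nodup)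
    (h0 : {a, y, z} ∈ E) (h1 : {x, w, w'} ∈ E) :
    {a, b, x} ∉ E := by
  intro h
  exact hE.not_path (p := y) (q := z) (r := a) (s := b) (t := x) (u := w) (v := w')
    (by simp only [List.nodup_cons, List.mem_cons, List.not_mem_nil, or_false, not_or] at hd ⊢
        grind)
    (by grind [triple_rotate, triple_swap])
    (by grind [triple_rotate, triple_swap])
    (by grind [triple_rotate, triple_swap])

theorem notMem_abx_of_bcw (C : LinkConfig E a b c x y z)
    (hE : LoosePathFree E) (hd : [a, b, c, x, y, z, w].Nodup) (h0 : {b, c, w} ∈ E) :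
    {a, b, x} ∉ E := by
  intro h
  exact hE.not_path (p := c) (q := w) (r := b) (s := a) (t := x) (u := y) (v := z)
    (by simp only [List.nodup_cons, List.mem_cons, List.not_mem_nil, or_false, not_or] at hd ⊢
        grind)
    (by grind [C.abc, C.bcx, C.xyz, triple_rotate, triple_swap])
    (by grind [C.abc, C.bcx, C.xyz, triple_rotate, triple_swap])
    (by grind [C.abc, C.bcx, C.xyz, triple_rotate, triple_swap])

theorem notMem_aby_of_bcw (C : LinkConfig E a b c x y z)
    (hE : LoosePathFree E) (hd : [a, b, c, x, y, z, w].Nodup) (h0 : {b, c, w} ∈ E) :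
    {a, b, y} ∉ E := by
  intro h
  exact hE.not_path (p := c) (q := w) (r := b) (s := a) (t := y) (u := x) (v := z)
    (by simp only [List.nodup_cons, List.mem_cons, List.not_mem_nil, or_false, not_or] at hd ⊢
        grind)
    (by grind [C.abc, C.bcx, C.xyz, triple_rotate, triple_swap])
    (by grind [C.abc, C.bcx, C.xyz, triple_rotate, triple_swap])
    (by grind [C.abc, C.bcx, C.xyz, triple_rotate, triple_swap])

theorem notMem_axz_of_xyw (C : LinkConfig E a b c x y z)
    (hE : LoosePathFree E) (hd : [a, b, c, x, y, z, w].Nodup) (h0 : {x, y, w} ∈ E) :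
    {a, x, z} ∉ E := by
  intro h
  exact hE.not_path (p := b) (q := c) (r := a) (s := z) (t := x) (u := y) (v := w)
    (by simp only [List.nodup_cons, List.mem_cons, List.not_mem_nil, or_false, not_or] at hd ⊢
        grind)
    (by grind [C.abc, C.bcx, C.xyz, triple_rotate, triple_swap])
    (by grind [C.abc, C.bcx, C.xyz, triple_rotate, triple_swap])
    (by grind [C.abc, C.bcx, C.xyz, triple_rotate, triple_swap])

theorem notMem_ayz_of_xyw (C : LinkConfig E a b c x y z)
    (hE : LoosePathFree E) (hd : [a, b, c, x, y, z, w].Nodup) (h0 : {x, y, w} ∈ E) :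
    {a, y, z} ∉ E := by
  intro h
  exact hE.not_path (p := b) (q := c) (r := a) (s := z) (t := y) (u := x) (v := w)
    (by simp only [List.nodup_cons, List.mem_cons, List.not_mem_nil, or_false, not_or] at hd ⊢
        grind)
    (by grind [C.abc, C.bcx, C.xyz, triple_rotate, triple_swap])
    (by grind [C.abc, C.bcx, C.xyz, triple_rotate, triple_swap])
    (by grind [C.abc, C.bcx, C.xyz, triple_rotate, triple_swap])

theorem notMem_axy_of_yzw (C : LinkConfig E a b c x y z)
    (hE : LoosePathFree E) (hd : [a, b, c, x, y, z, w].Nodup) (h0 : {y, z, w} ∈ E) :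
    {a, x, y} ∉ E := by
  intro h
  exact hE.not_path (p := b) (q := c) (r := a) (s := x) (t := y) (u := z) (v := w)
    (by simp only [List.nodup_cons, List.mem_cons, List.not_mem_nil, or_false, not_or] at hd ⊢
        grind)
    (by grind [C.abc, C.bcx, C.xyz, triple_rotate, triple_swap])
    (by grind [C.abc, C.bcx, C.xyz, triple_rotate, triple_swap])
    (by grind [C.abc, C.bcx, C.xyz, triple_rotate, triple_swap])

theorem notMem_bxz_of_xyw (C : LinkConfig E a b c x y z)
    (hE : LoosePathFree E) (hd : [a, b, c, x, y, z, w].Nodup) (h0 : {x, y, w} ∈ E) :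
    {b, x, z} ∉ E := by
  intro h
  exact hE.not_path (p := a) (q := c) (r := b) (s := z) (t := x) (u := y) (v := w)
    (by simp only [List.nodup_cons, List.mem_cons, List.not_mem_nil, or_false, not_or] at hd ⊢
        grind)
    (by grind [C.abc, C.bcx, C.xyz, triple_rotate, triple_swap])
    (by grind [C.abc, C.bcx, C.xyz, triple_rotate, triple_swap])
    (by grind [C.abc, C.bcx, C.xyz, triple_rotate, triple_swap])

theorem notMem_byz_of_xyw (C : LinkConfig E a b c x y z)
    (hE : LoosePathFree E) (hd : [a, b, c, x, y, z, w].Nodup) (h0 : {x, y, w} ∈ E) :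
    {b, y, z} ∉ E := by
  intro h
  exact hE.not_path (p := a) (q := c) (r := b) (s := z) (t := y) (u := x) (v := w)
    (by simp only [List.nodup_cons, List.mem_cons, List.not_mem_nil, or_false, not_or] at hd ⊢
        grind)
    (by grind [C.abc, C.bcx, C.xyz, triple_rotate, triple_swap])
    (by grind [C.abc, C.bcx, C.xyz, triple_rotate, triple_swap])
    (by grind [C.abc, C.bcx, C.xyz, triple_rotate, triple_swap])

theorem notMem_bxy_of_yzw (C : LinkConfig E a b c x y z)
    (hE : LoosePathFree E) (hd : [a, b, c, x, y, z, w].Nodup) (h0 : {y, z, w} ∈ E) :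
    {b, x, y} ∉ E := by
  intro h
  exact hE.not_path (p := a) (q := c) (r := b) (s := x) (t := y) (u := z) (v := w)
    (by simp only [List.nodup_cons, List.mem_cons, List.not_mem_nil, or_false, not_or] at hd ⊢
        grind)
    (by grind [C.abc, C.bcx, C.xyz, triple_rotate, triple_swap])
    (by grind [C.abc, C.bcx, C.xyz, triple_rotate, triple_swap])
    (by grind [C.abc, C.bcx, C.xyz, triple_rotate, triple_swap])

theorem notMem_cxz_of_xyw (C : LinkConfig E a b c x y z)
    (hE : LoosePathFree E) (hd : [a, b, c, x, y, z, w].Nodup) (h0 : {x, y, w} ∈ E) :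
    {c, x, z} ∉ E := by
  intro h
  exact hE.not_path (p := a) (q := b) (r := c) (s := z) (t := x) (u := y) (v := w)
    (by simp only [List.nodup_cons, List.mem_cons, List.not_mem_nil, or_false, not_or] at hd ⊢
        grind)
    (by grind [C.abc, C.bcx, C.xyz, triple_rotate, triple_swap])
    (by grind [C.abc, C.bcx, C.xyz, triple_rotate, triple_swap])
    (by grind [C.abc, C.bcx, C.xyz, triple_rotate, triple_swap])

theorem notMem_cyz_of_xyw (C : LinkConfig E a b c x y z)
    (hE : LoosePathFree E) (hd : [a, b, c, x, y, z, w].Nodup) (h0 : {x, y, w} ∈ E) :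
    {c, y, z} ∉ E := by
  intro h
  exact hE.not_path (p := a) (q := b) (r := c) (s := z) (t := y) (u := x) (v := w)
    (by simp only [List.nodup_cons, List.mem_cons, List.not_mem_nil, or_false, not_or] at hd ⊢
        grind)
    (by grind [C.abc, C.bcx, C.xyz, triple_rotate, triple_swap])
    (by grind [C.abc, C.bcx, C.xyz, triple_rotate, triple_swap])
    (by grind [C.abc, C.bcx, C.xyz, triple_rotate, triple_swap])

theorem notMem_cxy_of_yzw (C : LinkConfig E a b c x y z)
    (hE : LoosePathFree E) (hd : [a, b, c, x, y, z, w].Nodup) (h0 : {y, z, w} ∈ E) :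
    {c, x, y} ∉ E := by
  intro h
  exact hE.not_path (p := a) (q := b) (r := c) (s := x) (t := y) (u := z) (v := w)
    (by simp only [List.nodup_cons, List.mem_cons, List.not_mem_nil, or_false, not_or] at hd ⊢
        grind)
    (by grind [C.abc, C.bcx, C.xyz, triple_rotate, triple_swap])
    (by grind [C.abc, C.bcx, C.xyz, triple_rotate, triple_swap])
    (by grind [C.abc, C.bcx, C.xyz, triple_rotate, triple_swap])

/-- If `a` lies on an edge with two outer vertices, the roles of `a` and `x` can be exchanged. -/
theorem swap_ax (C : LinkConfig E a b c x y z) (hd : [a, b, c, x, y, z, w, w'].Nodup)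
    (h : {a, w, w'} ∈ E) : LinkConfig E x b c a w w' where
  nodup := by
    simp only [List.nodup_cons, List.mem_cons, List.not_mem_nil, or_false, not_or] at hd ⊢; grind
  abc := by grind [C.bcx, triple_rotate, triple_swap]
  bcx := by grind [C.abc, triple_rotate, triple_swap]
  xyz := h

/-- Another point of the pair `bc` in place of `a`. -/
theorem replace_a (C : LinkConfig E a b c x y z) (hd : [a, b, c, x, y, z, w].Nodup)
    (h : {b, c, w} ∈ E) : LinkConfig E w b c x y z where
  nodup := by
    simp only [List.nodup_cons, List.mem_cons, List.not_mem_nil, or_false, not_or] at hd ⊢; grind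
  abc := by grind [triple_rotate, triple_swap]
  bcx := C.bcx
  xyz := C.xyz

/-- Passing to the pair `yz`. -/
theorem turn (C : LinkConfig E a b c x y z) (hd : [a, b, c, x, y, z, w].Nodup)
    (h : {y, z, w} ∈ E) : LinkConfig E w y z x b c where
  nodup := by
    simp only [List.nodup_cons, List.mem_cons, List.not_mem_nil, or_false, not_or] at hd ⊢; grind
  abc := by grind [triple_rotate, triple_swap]
  bcx := by grind [C.xyz, triple_rotate, triple_swap]
  xyz := by grind [C.bcx, triple_rotate, triple_swap]

end LinkConfig

end Paths

/-! ### Shapes of edges relative to the core, and the weighted count. -/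

section FreeConfigurations

variable {V : Type*} [DecidableEq V] {E : Finset (Finset V)}

/-- A configuration `abc`, `bcx`, `xyz` in a `3`-uniform family without loose paths of length three,
with all further vertices in `W`. -/
structure FreeConfig (E : Finset (Finset V)) (a b c x y z : V) (W : Finset V) : Prop
    extends LinkConfig E a b c x y z where
  free : LoosePathFree E
  sized : ∀ t ∈ E, #t = 3
  disj : ∀ w ∈ W, w ∉ ({a, b, c, x, y, z} : Finset V)
  cover : ∀ t ∈ E, t ⊆ {a, b, c, x, y, z} ∪ W

namespace FreeConfig

variable {a b c x y z u v w w' w'' : V} {W : Finset V}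

theorem swap_bc (C : FreeConfig E a b c x y z W) : FreeConfig E a c b x y z W where
  toLinkConfig := C.toLinkConfig.swap_bc
  free := C.free
  sized := C.sized
  disj := by have := C.disj; grind
  cover := by
    intro t ht i hi
    have := C.cover t ht hi
    simp only [mem_union, mem_insert, mem_singleton] at this ⊢
    tauto

theorem swap_yz (C : FreeConfig E a b c x y z W) : FreeConfig E a b c x z y W where
  toLinkConfig := C.toLinkConfig.swap_yz
  free := C.free
  sized := C.sized
  disj := by have := C.disj; grind
  cover := by
    intro t ht i hi
    have := C.cover t ht hi
    simp only [mem_union, mem_insert, mem_singleton] at this ⊢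
    tauto

theorem nodup_one (C : FreeConfig E a b c x y z W) (hw : w ∈ W) :
    [a, b, c, x, y, z, w].Nodup := by
  have h₁ := C.nodup
  have h₂ := C.disj w hw
  simp only [List.nodup_cons, List.mem_cons, List.not_mem_nil, or_false, not_or, mem_insert,
    mem_singleton] at h₁ h₂ ⊢
  grind

theorem nodup_two (C : FreeConfig E a b c x y z W) (hw : w ∈ W) (hw' : w' ∈ W) (h : w ≠ w') :
    [a, b, c, x, y, z, w, w'].Nodup := by
  have h₁ := C.nodup_one hw
  have h₂ := C.disj w' hw'
  simp only [List.nodup_cons, List.mem_cons, List.not_mem_nil, or_false, not_or, mem_insert,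
    mem_singleton] at h₁ h₂ ⊢
  grind

theorem nodup_three (C : FreeConfig E a b c x y z W) (hw : w ∈ W) (hw' : w' ∈ W) (hw'' : w'' ∈ W)
    (h : w ≠ w') (h' : w ≠ w'') (h'' : w' ≠ w'') :
    [a, b, c, x, y, z, w, w', w''].Nodup := by
  have h₁ := C.nodup_two hw hw' h
  have h₂ := C.disj w'' hw''
  simp only [List.nodup_cons, List.mem_cons, List.not_mem_nil, or_false, not_or, mem_insert,
    mem_singleton] at h₁ h₂ ⊢
  grind

theorem nodup_four (C : FreeConfig E a b c x y z W) (hw : w ∈ W) (hu : u ∈ W) (hv : v ∈ W)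
    (hw' : w' ∈ W) (h : [w, u, v, w'].Nodup) :
    [a, b, c, x, y, z, w, u, v, w'].Nodup := by
  have h₁ := C.nodup
  have h₂ := C.disj w hw
  have h₃ := C.disj u hu
  have h₄ := C.disj v hv
  have h₅ := C.disj w' hw'
  simp only [List.nodup_cons, List.mem_cons, List.not_mem_nil, or_false, not_or, mem_insert,
    mem_singleton] at h h₁ h₂ h₃ h₄ h₅ ⊢
  grind

/-- The possible shapes of an edge. -/
theorem edge_cases (C : FreeConfig E a b c x y z W) {t : Finset V} (ht : t ∈ E) :
    t ⊆ {a, b, c, x, y, z} ∨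
    (∃ w ∈ W, t = {b, c, w} ∨ t = {x, y, w} ∨ t = {x, z, w} ∨ t = {y, z, w}) ∨
    (∃ w ∈ W, ∃ w' ∈ W, w ≠ w' ∧ (t = {a, w, w'} ∨ t = {x, w, w'})) ∨ t ⊆ W := by
  -- Two core vertices and one outer vertex: eleven of the fifteen core pairs are excluded by a
  -- loose path, and `bc`, `xy`, `xz`, `yz` remain.
  have key1 : ∀ u ∈ ({a, b, c, x, y, z} : Finset V), ∀ v ∈ ({a, b, c, x, y, z} : Finset V),
      u ≠ v → ∀ w ∈ W, {u, v, w} ∈ E → ({u, v, w} : Finset V) = {b, c, w} ∨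
      ({u, v, w} : Finset V) = {x, y, w} ∨ ({u, v, w} : Finset V) = {x, z, w} ∨
      ({u, v, w} : Finset V) = {y, z, w} := by
    intro u hu v hv huv w hw h
    have hd := C.nodup_one hw
    have hd' := C.swap_bc.nodup_one hw
    have hd'' := C.swap_yz.nodup_one hw
    have hd''' := C.swap_bc.swap_yz.nodup_one hw
    have k1 := C.notMem_axw C.free hd
    have k2 := C.notMem_ayw C.free hd
    have k3 := C.swap_yz.notMem_ayw C.free hd''
    have k4 := C.notMem_bxw C.free hd
    have k5 := C.swap_bc.notMem_bxw C.free hd'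
    have k6 := C.notMem_byw C.free hd
    have k7 := C.swap_bc.notMem_byw C.free hd'
    have k8 := C.swap_yz.notMem_byw C.free hd''
    have k9 := C.swap_bc.swap_yz.notMem_byw C.free hd'''
    have k10 := C.notMem_abw C.free hd
    have k11 := C.swap_bc.notMem_abw C.free hd'
    clear hd hd' hd'' hd'''
    simp only [mem_insert, mem_singleton] at hu hv
    rcases hu with rfl | rfl | rfl | rfl | rfl | rfl <;>
    rcases hv with rfl | rfl | rfl | rfl | rfl | rfl <;>
    first
    | exact absurd rfl huv
    | exact Or.inl rfl
    | exact Or.inl (triple_swap _ _ _)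
    | exact Or.inr (Or.inl rfl)
    | exact Or.inr (Or.inl (triple_swap _ _ _))
    | exact Or.inr (Or.inr (Or.inl rfl))
    | exact Or.inr (Or.inr (Or.inl (triple_swap _ _ _)))
    | exact Or.inr (Or.inr (Or.inr rfl))
    | exact Or.inr (Or.inr (Or.inr (triple_swap _ _ _)))
    | (exfalso; first | (revert h; assumption) | (rw [triple_swap] at h; revert h; assumption))
  -- One core vertex and two outer vertices: `b`, `c`, `y`, `z` are excluded, so the core vertex is
  -- `a` or `x`.
  have key2 : ∀ u ∈ ({a, b, c, x, y, z} : Finset V), ∀ w ∈ W, ∀ w' ∈ W, w ≠ w' → {u, w, w'} ∈ E →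
      u = a ∨ u = x := by
    intro u hu w hw w' hw' hne h
    have k1 := C.notMem_bww C.free (C.nodup_two hw hw' hne)
    have k2 := C.swap_bc.notMem_bww C.free (C.swap_bc.nodup_two hw hw' hne)
    have k3 := C.notMem_yww C.free (C.nodup_two hw hw' hne)
    have k4 := C.swap_yz.notMem_yww C.free (C.swap_yz.nodup_two hw hw' hne)
    simp only [mem_insert, mem_singleton] at hu
    grind
  obtain ⟨p, q, r, hpq, hpr, hqr, rfl⟩ := Finset.card_eq_three.1 (C.sized t ht)
  have hc := C.cover _ ht
  have hp : p ∈ ({a, b, c, x, y, z} : Finset V) ∨ p ∈ W := mem_union.1 (hc (by simp))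
  have hq : q ∈ ({a, b, c, x, y, z} : Finset V) ∨ q ∈ W := mem_union.1 (hc (by simp))
  have hr : r ∈ ({a, b, c, x, y, z} : Finset V) ∨ r ∈ W := mem_union.1 (hc (by simp))
  have e1 := triple_rotate p q r
  have e2 := triple_rotate q r p
  rcases hp with hp | hp <;> rcases hq with hq | hq <;> rcases hr with hr | hr
  · left; intro i hi; simp only [mem_insert, mem_singleton] at hi
    rcases hi with rfl | rfl | rfl <;> assumption
  · exact Or.inr (Or.inl ⟨r, hr, key1 p hp q hq hpq r hr ht⟩)
  · rw [e1, e2] at ht ⊢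
    exact Or.inr (Or.inl ⟨q, hq, key1 r hr p hp hpr.symm q hq ht⟩)
  · refine Or.inr (Or.inr (Or.inl ⟨q, hq, r, hr, hqr, ?_⟩))
    rcases key2 p hp q hq r hr hqr ht with rfl | rfl <;> simp
  · rw [e1] at ht ⊢
    exact Or.inr (Or.inl ⟨p, hp, key1 q hq r hr hqr p hp ht⟩)
  · rw [e1] at ht ⊢
    refine Or.inr (Or.inr (Or.inl ⟨r, hr, p, hp, hpr.symm, ?_⟩))
    rcases key2 q hq r hr p hp hpr.symm ht with rfl | rfl <;> simp
  · rw [e1, e2] at ht ⊢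
    refine Or.inr (Or.inr (Or.inl ⟨p, hp, q, hq, hpq, ?_⟩))
    rcases key2 r hr p hp q hq hpq ht with rfl | rfl <;> simp
  · right; right; right; intro i hi; simp only [mem_insert, mem_singleton] at hi
    rcases hi with rfl | rfl | rfl <;> assumption

end FreeConfig

/-- The vertices `w' ∈ W` for which `u`, `w`, `w'` form an edge. -/
def coNbrs (E : Finset (Finset V)) (W : Finset V) (u w : V) : Finset V :=
  W.filter fun w' => w' ≠ w ∧ {u, w, w'} ∈ E

theorem mem_coNbrs {W : Finset V} {u w w' : V} :
    w' ∈ coNbrs E W u w ↔ w' ∈ W ∧ w' ≠ w ∧ {u, w, w'} ∈ E := by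
  simp [coNbrs]

/-- Double counting: a pair `ww'` completing `u` to an edge is seen from `w` and from `w'`. -/
theorem two_mul_card_pairs_le (E : Finset (Finset V)) (W : Finset V) (u : V) :
    2 * #((W.powersetCard 2).filter fun p => insert u p ∈ E) ≤ ∑ w ∈ W, #(coNbrs E W u w) := by
  set P := (W.powersetCard 2).filter fun p => insert u p ∈ E with hP
  have h1 : 2 * #P = ∑ p ∈ P, ∑ w ∈ W, if w ∈ p then 1 else 0 := by
    rw [mul_comm, ← smul_eq_mul, ← Finset.sum_const]
    refine Finset.sum_congr rfl fun p hp => ?_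
    have hp' := mem_powersetCard.1 (mem_filter.1 hp).1
    rw [← hp'.2, ← Finset.sum_filter, ← Finset.card_eq_sum_ones]
    congr 1
    ext i
    simp only [mem_filter]
    exact ⟨fun h => ⟨hp'.1 h, h⟩, fun h => h.2⟩
  rw [h1, Finset.sum_comm]
  refine Finset.sum_le_sum fun w _ => ?_
  rw [← Finset.sum_filter, ← Finset.card_eq_sum_ones]
  refine (Finset.card_le_card (t := (coNbrs E W u w).image fun w' => {w, w'}) ?_).trans
    Finset.card_image_le
  intro p hp
  obtain ⟨hp, hwp⟩ := mem_filter.1 hp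
  obtain ⟨hp, hup⟩ := mem_filter.1 hp
  obtain ⟨hpW, hp2⟩ := mem_powersetCard.1 hp
  obtain ⟨i, j, hij, rfl⟩ := Finset.card_eq_two.1 hp2
  have hi : i ∈ W := hpW (by simp)
  have hj : j ∈ W := hpW (by simp)
  simp only [mem_insert, mem_singleton] at hwp
  rcases hwp with rfl | rfl
  · exact mem_image.2 ⟨j, mem_coNbrs.2 ⟨hj, hij.symm, hup⟩, rfl⟩
  · refine mem_image.2 ⟨i, mem_coNbrs.2 ⟨hi, hij, ?_⟩, Finset.pair_comm _ _⟩
    rwa [Finset.pair_comm]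

/-- Twice the contribution of an outer vertex `w` to the number of edges. -/
def outerWeight (E : Finset (Finset V)) (a b c x y z : V) (W : Finset V) (w : V) : ℕ :=
  2 * ((if {b, c, w} ∈ E then 1 else 0) + (if {x, y, w} ∈ E then 1 else 0) +
    (if {x, z, w} ∈ E then 1 else 0) + (if {y, z, w} ∈ E then 1 else 0)) +
  #(coNbrs E W a w) + #(coNbrs E W x w)

namespace FreeConfig

variable {a b c x y z u v w w' w'' : V} {W : Finset V}

theorem card_le (C : FreeConfig E a b c x y z W) :
    #E ≤ #(E.filter (· ⊆ {a, b, c, x, y, z})) + #(E.filter (· ⊆ W)) +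
      (#(W.filter fun w => {b, c, w} ∈ E) + #(W.filter fun w => {x, y, w} ∈ E) +
      #(W.filter fun w => {x, z, w} ∈ E) + #(W.filter fun w => {y, z, w} ∈ E)) +
      (#((W.powersetCard 2).filter fun p => insert a p ∈ E) +
      #((W.powersetCard 2).filter fun p => insert x p ∈ E)) := by
  have hsub : E ⊆ ((E.filter (· ⊆ {a, b, c, x, y, z})) ∪ (E.filter (· ⊆ W))) ∪
      ((((W.filter fun w => {b, c, w} ∈ E).image fun w => {b, c, w}) ∪
      ((W.filter fun w => {x, y, w} ∈ E).image fun w => {x, y, w})) ∪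
      ((W.filter fun w => {x, z, w} ∈ E).image fun w => {x, z, w}) ∪
      ((W.filter fun w => {y, z, w} ∈ E).image fun w => {y, z, w})) ∪
      ((((W.powersetCard 2).filter fun p => insert a p ∈ E).image fun p => insert a p) ∪
      (((W.powersetCard 2).filter fun p => insert x p ∈ E).image fun p => insert x p)) := by
    intro t ht
    simp only [mem_union, mem_filter, mem_image, mem_powersetCard]
    rcases C.edge_cases ht with h | ⟨w, hw, rfl | rfl | rfl | rfl⟩ | ⟨w, hw, w', hw', hne, h⟩ | h
    · exact Or.inl (Or.inl (Or.inl ⟨ht, h⟩))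
    · exact Or.inl (Or.inr (Or.inl (Or.inl (Or.inl ⟨w, ⟨hw, ht⟩, rfl⟩))))
    · exact Or.inl (Or.inr (Or.inl (Or.inl (Or.inr ⟨w, ⟨hw, ht⟩, rfl⟩))))
    · exact Or.inl (Or.inr (Or.inl (Or.inr ⟨w, ⟨hw, ht⟩, rfl⟩)))
    · exact Or.inl (Or.inr (Or.inr ⟨w, ⟨hw, ht⟩, rfl⟩))
    · have hsub : ({w, w'} : Finset V) ⊆ W := by
        intro i hi; simp only [mem_insert, mem_singleton] at hi
        rcases hi with rfl | rfl <;> assumption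
      rcases h with rfl | rfl
      · exact Or.inr (Or.inl ⟨{w, w'}, ⟨⟨hsub, Finset.card_pair hne⟩, ht⟩, rfl⟩)
      · exact Or.inr (Or.inr ⟨{w, w'}, ⟨⟨hsub, Finset.card_pair hne⟩, ht⟩, rfl⟩)
    · exact Or.inl (Or.inl (Or.inr ⟨ht, h⟩))
  refine (Finset.card_le_card hsub).trans ((card_union_le _ _).trans ?_)
  refine add_le_add ((card_union_le _ _).trans (add_le_add (card_union_le _ _) ?_)) ?_
  · refine (card_union_le _ _).trans (add_le_add ?_ card_image_le)
    refine (card_union_le _ _).trans (add_le_add ?_ card_image_le)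
    exact (card_union_le _ _).trans (add_le_add card_image_le card_image_le)
  · exact (card_union_le _ _).trans (add_le_add card_image_le card_image_le)

/-- Doubling lets every crossing edge be charged to its outer vertices in whole units: two units to
a single outer vertex, one unit to each of two. The bound on the total then becomes a bound at each
vertex. -/
theorem two_mul_card_le (C : FreeConfig E a b c x y z W) :
    2 * #E ≤ 2 * #(E.filter (· ⊆ {a, b, c, x, y, z})) + 2 * #(E.filter (· ⊆ W)) +
      ∑ w ∈ W, outerWeight E a b c x y z W w := by
  have h := C.card_le
  have ha := two_mul_card_pairs_le E W a
  have hx := two_mul_card_pairs_le E W x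
  simp only [outerWeight, Finset.sum_add_distrib, ← Finset.mul_sum]
  simp only [← Finset.card_filter]
  omega

end FreeConfig

end FreeConfigurations

/-! ### Edges inside the core, and families whose edges have at most one outer vertex. -/

section CoreBounds

variable {V : Type*} [DecidableEq V] {E : Finset (Finset V)}

/-- The twenty triples contained in a set of six listed vertices. -/
theorem triple_cases {a b c x y z : V} (hd : [a, b, c, x, y, z].Nodup) {t : Finset V}
    (ht : t ⊆ {a, b, c, x, y, z}) (h3 : #t = 3) :
    t ∈ ({{a, b, c}, {x, y, z}, {b, c, x}, {b, c, y}, {b, c, z}} : Finset (Finset V)) ∨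
    t ∈ ({{a, b, x}, {a, b, y}, {a, b, z}, {a, c, x}, {a, c, y}, {a, c, z}} :
      Finset (Finset V)) ∨
    t ∈ ({{a, y, z}, {b, y, z}, {c, y, z}} : Finset (Finset V)) ∨
    t ∈ ({{a, x, y}, {b, x, y}, {c, x, y}} : Finset (Finset V)) ∨
    t ∈ ({{a, x, z}, {b, x, z}, {c, x, z}} : Finset (Finset V)) := by
  -- Labelling the six vertices by `Fin 6` turns the classification into a finite check.
  set φ : Fin 6 → V := ![a, b, c, x, y, z] with hφ
  have hinj : Function.Injective φ := by
    have : φ = [a, b, c, x, y, z].get := by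
      funext i; fin_cases i <;> rfl
    rw [this]; exact List.nodup_iff_injective_get.1 hd
  have himg : t = (univ.filter fun i => φ i ∈ t).image φ := by
    ext v
    simp only [mem_image, mem_filter, mem_univ, true_and]
    constructor
    · intro hv
      have := ht hv
      simp only [mem_insert, mem_singleton] at this
      rcases this with rfl | rfl | rfl | rfl | rfl | rfl
      · exact ⟨0, hv, rfl⟩
      · exact ⟨1, hv, rfl⟩
      · exact ⟨2, hv, rfl⟩
      · exact ⟨3, hv, rfl⟩
      · exact ⟨4, hv, rfl⟩
      · exact ⟨5, hv, rfl⟩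
    · rintro ⟨i, hi, rfl⟩; exact hi
  generalize (univ.filter fun i => φ i ∈ t) = s at himg
  subst himg
  rw [Finset.card_image_of_injective _ hinj] at h3
  have key : ∀ s : Finset (Fin 6), #s = 3 →
      (s = {0, 1, 2} ∨ s = {3, 4, 5} ∨ s = {1, 2, 3} ∨ s = {1, 2, 4} ∨ s = {1, 2, 5}) ∨
      (s = {0, 1, 3} ∨ s = {0, 1, 4} ∨ s = {0, 1, 5} ∨ s = {0, 2, 3} ∨ s = {0, 2, 4} ∨
        s = {0, 2, 5}) ∨
      (s = {0, 4, 5} ∨ s = {1, 4, 5} ∨ s = {2, 4, 5}) ∨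
      (s = {0, 3, 4} ∨ s = {1, 3, 4} ∨ s = {2, 3, 4}) ∨
      (s = {0, 3, 5} ∨ s = {1, 3, 5} ∨ s = {2, 3, 5}) := by decide
  simp only [mem_insert, mem_singleton]
  have e : ∀ i j k : Fin 6, ({i, j, k} : Finset (Fin 6)).image φ = {φ i, φ j, φ k} := by
    intro i j k; simp [Finset.image_insert]
  have := key s h3
  clear h3 key ht hd
  rcases this with (h | h | h | h | h) | (h | h | h | h | h | h) | (h | h | h) | (h | h | h) |
    (h | h | h) <;> rw [h, e]
  · exact Or.inl (Or.inl rfl)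
  · exact Or.inl (Or.inr (Or.inl rfl))
  · exact Or.inl (Or.inr (Or.inr (Or.inl rfl)))
  · exact Or.inl (Or.inr (Or.inr (Or.inr (Or.inl rfl))))
  · exact Or.inl (Or.inr (Or.inr (Or.inr (Or.inr rfl))))
  · exact Or.inr (Or.inl (Or.inl rfl))
  · exact Or.inr (Or.inl (Or.inr (Or.inl rfl)))
  · exact Or.inr (Or.inl (Or.inr (Or.inr (Or.inl rfl))))
  · exact Or.inr (Or.inl (Or.inr (Or.inr (Or.inr (Or.inl rfl)))))
  · exact Or.inr (Or.inl (Or.inr (Or.inr (Or.inr (Or.inr (Or.inl rfl))))))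
  · exact Or.inr (Or.inl (Or.inr (Or.inr (Or.inr (Or.inr (Or.inr rfl))))))
  · exact Or.inr (Or.inr (Or.inl (Or.inl rfl)))
  · exact Or.inr (Or.inr (Or.inl (Or.inr (Or.inl rfl))))
  · exact Or.inr (Or.inr (Or.inl (Or.inr (Or.inr rfl))))
  · exact Or.inr (Or.inr (Or.inr (Or.inl (Or.inl rfl))))
  · exact Or.inr (Or.inr (Or.inr (Or.inl (Or.inr (Or.inl rfl)))))
  · exact Or.inr (Or.inr (Or.inr (Or.inl (Or.inr (Or.inr rfl)))))
  · exact Or.inr (Or.inr (Or.inr (Or.inr (Or.inl rfl))))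
  · exact Or.inr (Or.inr (Or.inr (Or.inr (Or.inr (Or.inl rfl)))))
  · exact Or.inr (Or.inr (Or.inr (Or.inr (Or.inr (Or.inr rfl)))))

theorem card_inter_eq_zero_of_forall {A B : Finset (Finset V)} (h : ∀ t ∈ B, t ∉ A) :
    #(A ∩ B) = 0 := by
  rw [Finset.card_eq_zero, ← Finset.disjoint_iff_inter_eq_empty, Finset.disjoint_right]
  exact h

namespace FreeConfig

variable {a b c x y z u v w w' w'' : V} {W : Finset V}

/-- The groups are chosen by what destroys them: an edge `bcw` kills the group of six, an edge `xyw`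
kills the triples ending in `yz` and in `xz`, and similarly for `xzw` and `yzw`. The first five
triples are counted as if all were present. -/
theorem card_core_le (C : FreeConfig E a b c x y z W) :
    #(E.filter (· ⊆ {a, b, c, x, y, z})) ≤ 5 +
      #(E ∩ {{a, b, x}, {a, b, y}, {a, b, z}, {a, c, x}, {a, c, y}, {a, c, z}}) +
      #(E ∩ {{a, y, z}, {b, y, z}, {c, y, z}}) + #(E ∩ {{a, x, y}, {b, x, y}, {c, x, y}}) +
      #(E ∩ {{a, x, z}, {b, x, z}, {c, x, z}}) := by
  have hsub : E.filter (· ⊆ {a, b, c, x, y, z}) ⊆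
      {{a, b, c}, {x, y, z}, {b, c, x}, {b, c, y}, {b, c, z}} ∪
      (E ∩ {{a, b, x}, {a, b, y}, {a, b, z}, {a, c, x}, {a, c, y}, {a, c, z}}) ∪
      (E ∩ {{a, y, z}, {b, y, z}, {c, y, z}}) ∪ (E ∩ {{a, x, y}, {b, x, y}, {c, x, y}}) ∪
      (E ∩ {{a, x, z}, {b, x, z}, {c, x, z}}) := by
    intro t ht
    obtain ⟨htE, htQ⟩ := mem_filter.1 ht
    rcases triple_cases C.nodup htQ (C.sized t htE) with h | h | h | h | h
    · exact mem_union_left _ (mem_union_left _ (mem_union_left _ (mem_union_left _ h)))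
    · exact mem_union_left _ (mem_union_left _ (mem_union_left _
        (mem_union_right _ (mem_inter.2 ⟨htE, h⟩))))
    · exact mem_union_left _ (mem_union_left _ (mem_union_right _ (mem_inter.2 ⟨htE, h⟩)))
    · exact mem_union_left _ (mem_union_right _ (mem_inter.2 ⟨htE, h⟩))
    · exact mem_union_right _ (mem_inter.2 ⟨htE, h⟩)
  refine (card_le_card hsub).trans ((card_union_le _ _).trans (Nat.add_le_add_right ?_ _))
  refine (card_union_le _ _).trans (Nat.add_le_add_right ?_ _)
  refine (card_union_le _ _).trans (Nat.add_le_add_right ?_ _)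
  refine (card_union_le _ _).trans (Nat.add_le_add_right ?_ _)
  exact card_le_five

/-- The bound on the number of edges when every edge has at most one outer vertex. -/
theorem card_le_of_outer_le_one (C : FreeConfig E a b c x y z W)
    (hW : ∀ t ∈ E, ¬ t ⊆ {a, b, c, x, y, z} → ∃ w ∈ W,
      t = {b, c, w} ∨ t = {x, y, w} ∨ t = {x, z, w} ∨ t = {y, z, w})
    (hne : ∃ t ∈ E, ¬ t ⊆ {a, b, c, x, y, z}) :
    #E ≤ 14 + #W ∨ #E ≤ 11 + 3 * #W ∨ #E ≤ 5 + 4 * #W := by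
  have hin : ∀ u v : V, #(W.filter fun w => {u, v, w} ∈ E) = 0 ∨ ∃ w ∈ W, {u, v, w} ∈ E := by
    intro u v
    rcases (W.filter fun w => {u, v, w} ∈ E).eq_empty_or_nonempty with h | ⟨w, hw⟩
    · left; rw [h, card_empty]
    · exact Or.inr ⟨w, mem_filter.1 hw⟩
  have hle : ∀ u v : V, #(W.filter fun w => {u, v, w} ∈ E) ≤ #W := fun u v => card_filter_le _ _
  have h3 : ∀ p q r : Finset V, #(E ∩ {p, q, r}) ≤ 3 := fun p q r =>
    (card_le_card inter_subset_right).trans card_le_three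
  have h6 : #(E ∩ {{a, b, x}, {a, b, y}, {a, b, z}, {a, c, x}, {a, c, y}, {a, c, z}}) ≤ 6 :=
    (card_le_card inter_subset_right).trans card_le_six
  have hbc : (∃ w ∈ W, {b, c, w} ∈ E) →
      #(E ∩ {{a, b, x}, {a, b, y}, {a, b, z}, {a, c, x}, {a, c, y}, {a, c, z}}) = 0 := by
    rintro ⟨w, hw, h⟩
    have h' := h
    rw [triple_swap] at h'
    refine card_inter_eq_zero_of_forall ?_
    simp only [mem_insert, mem_singleton]
    rintro t (rfl | rfl | rfl | rfl | rfl | rfl)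
    · exact C.notMem_abx_of_bcw C.free (C.nodup_one hw) h
    · exact C.notMem_aby_of_bcw C.free (C.nodup_one hw) h
    · exact C.swap_yz.notMem_aby_of_bcw C.free (C.swap_yz.nodup_one hw) h
    · exact C.swap_bc.notMem_abx_of_bcw C.free (C.swap_bc.nodup_one hw) h'
    · exact C.swap_bc.notMem_aby_of_bcw C.free (C.swap_bc.nodup_one hw) h'
    · exact C.swap_bc.swap_yz.notMem_aby_of_bcw C.free (C.swap_bc.swap_yz.nodup_one hw) h'
  have hxy : (∃ w ∈ W, {x, y, w} ∈ E) →
      #(E ∩ {{a, y, z}, {b, y, z}, {c, y, z}}) = 0 ∧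
      #(E ∩ {{a, x, z}, {b, x, z}, {c, x, z}}) = 0 := by
    rintro ⟨w, hw, h⟩
    constructor
    all_goals
      refine card_inter_eq_zero_of_forall ?_
      simp only [mem_insert, mem_singleton]
      rintro t (rfl | rfl | rfl)
    · exact C.notMem_ayz_of_xyw C.free (C.nodup_one hw) h
    · exact C.notMem_byz_of_xyw C.free (C.nodup_one hw) h
    · exact C.notMem_cyz_of_xyw C.free (C.nodup_one hw) h
    · exact C.notMem_axz_of_xyw C.free (C.nodup_one hw) h
    · exact C.notMem_bxz_of_xyw C.free (C.nodup_one hw) h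
    · exact C.notMem_cxz_of_xyw C.free (C.nodup_one hw) h
  have hxz : (∃ w ∈ W, {x, z, w} ∈ E) →
      #(E ∩ {{a, y, z}, {b, y, z}, {c, y, z}}) = 0 ∧
      #(E ∩ {{a, x, y}, {b, x, y}, {c, x, y}}) = 0 := by
    rintro ⟨w, hw, h⟩
    constructor
    all_goals
      refine card_inter_eq_zero_of_forall ?_
      simp only [mem_insert, mem_singleton]
      rintro t (rfl | rfl | rfl)
    · rw [pair_comm]; exact C.swap_yz.notMem_ayz_of_xyw C.free (C.swap_yz.nodup_one hw) h
    · rw [pair_comm]; exact C.swap_yz.notMem_byz_of_xyw C.free (C.swap_yz.nodup_one hw) h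
    · rw [pair_comm]; exact C.swap_yz.notMem_cyz_of_xyw C.free (C.swap_yz.nodup_one hw) h
    · exact C.swap_yz.notMem_axz_of_xyw C.free (C.swap_yz.nodup_one hw) h
    · exact C.swap_yz.notMem_bxz_of_xyw C.free (C.swap_yz.nodup_one hw) h
    · exact C.swap_yz.notMem_cxz_of_xyw C.free (C.swap_yz.nodup_one hw) h
  have hyz : (∃ w ∈ W, {y, z, w} ∈ E) →
      #(E ∩ {{a, x, y}, {b, x, y}, {c, x, y}}) = 0 ∧
      #(E ∩ {{a, x, z}, {b, x, z}, {c, x, z}}) = 0 := by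
    rintro ⟨w, hw, h⟩
    have h' := h
    rw [triple_swap] at h'
    constructor
    all_goals
      refine card_inter_eq_zero_of_forall ?_
      simp only [mem_insert, mem_singleton]
      rintro t (rfl | rfl | rfl)
    · exact C.notMem_axy_of_yzw C.free (C.nodup_one hw) h
    · exact C.notMem_bxy_of_yzw C.free (C.nodup_one hw) h
    · exact C.notMem_cxy_of_yzw C.free (C.nodup_one hw) h
    · exact C.swap_yz.notMem_axy_of_yzw C.free (C.swap_yz.nodup_one hw) h'
    · exact C.swap_yz.notMem_bxy_of_yzw C.free (C.swap_yz.nodup_one hw) h'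
    · exact C.swap_yz.notMem_cxy_of_yzw C.free (C.swap_yz.nodup_one hw) h'
  have hbound : #E ≤ #(E.filter (· ⊆ {a, b, c, x, y, z})) +
      (#(W.filter fun w => {b, c, w} ∈ E) + #(W.filter fun w => {x, y, w} ∈ E) +
      #(W.filter fun w => {x, z, w} ∈ E) + #(W.filter fun w => {y, z, w} ∈ E)) := by
    have hsub : E ⊆ (E.filter (· ⊆ {a, b, c, x, y, z})) ∪
      ((((W.filter fun w => {b, c, w} ∈ E).image fun w => {b, c, w}) ∪
      ((W.filter fun w => {x, y, w} ∈ E).image fun w => {x, y, w})) ∪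
      ((W.filter fun w => {x, z, w} ∈ E).image fun w => {x, z, w}) ∪
      ((W.filter fun w => {y, z, w} ∈ E).image fun w => {y, z, w})) := by
      intro t ht
      simp only [mem_union, mem_filter, mem_image]
      by_cases h : t ⊆ {a, b, c, x, y, z}
      · exact Or.inl ⟨ht, h⟩
      · obtain ⟨w, hw, rfl | rfl | rfl | rfl⟩ := hW t ht h
        · exact Or.inr (Or.inl (Or.inl (Or.inl ⟨w, ⟨hw, ht⟩, rfl⟩)))
        · exact Or.inr (Or.inl (Or.inl (Or.inr ⟨w, ⟨hw, ht⟩, rfl⟩)))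
        · exact Or.inr (Or.inl (Or.inr ⟨w, ⟨hw, ht⟩, rfl⟩))
        · exact Or.inr (Or.inr ⟨w, ⟨hw, ht⟩, rfl⟩)
    refine (Finset.card_le_card hsub).trans ((card_union_le _ _).trans (add_le_add le_rfl ?_))
    refine (card_union_le _ _).trans (add_le_add ?_ card_image_le)
    refine (card_union_le _ _).trans (add_le_add ?_ card_image_le)
    exact (card_union_le _ _).trans (add_le_add card_image_le card_image_le)
  have hsome : (∃ w ∈ W, {b, c, w} ∈ E) ∨ (∃ w ∈ W, {x, y, w} ∈ E) ∨ (∃ w ∈ W, {x, z, w} ∈ E) ∨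
      (∃ w ∈ W, {y, z, w} ∈ E) := by
    obtain ⟨t, ht, h⟩ := hne
    obtain ⟨w, hw, rfl | rfl | rfl | rfl⟩ := hW t ht h
    · exact Or.inl ⟨w, hw, ht⟩
    · exact Or.inr (Or.inl ⟨w, hw, ht⟩)
    · exact Or.inr (Or.inr (Or.inl ⟨w, hw, ht⟩))
    · exact Or.inr (Or.inr (Or.inr ⟨w, hw, ht⟩))
  have hcore := C.card_core_le
  have i1 := hin b c
  have i2 := hin x y
  have i3 := hin x z
  have i4 := hin y z
  have l1 := hle b c
  have l2 := hle x y
  have l3 := hle x z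
  have l4 := hle y z
  have t1 := h3 {a, y, z} {b, y, z} {c, y, z}
  have t2 := h3 {a, x, y} {b, x, y} {c, x, y}
  have t3 := h3 {a, x, z} {b, x, z} {c, x, z}
  clear hin hle h3 hne hW
  -- Only which of the four outer shapes occur matters. One shape gives at most `14 + m`; several of
  -- `xy`, `xz`, `yz` without `bc` empty the three groups of three and give `11 + 3m`; with `bc` in
  -- addition the group of six is empty too, giving `5 + 4m`. The remaining case, `bc` with one
  -- other shape, gives `8 + 2m`, which is below one of these.
  generalize (∃ w ∈ W, {b, c, w} ∈ E) = p1 at *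
  generalize (∃ w ∈ W, {x, y, w} ∈ E) = p2 at *
  generalize (∃ w ∈ W, {x, z, w} ∈ E) = p3 at *
  generalize (∃ w ∈ W, {y, z, w} ∈ E) = p4 at *
  by_cases q1 : p1 <;> by_cases q2 : p2 <;> by_cases q3 : p3 <;> by_cases q4 : p4 <;>
    simp only [q1, q2, q3, q4, true_imp_iff, or_true, or_false, false_imp_iff] at * <;> omega

end FreeConfig

end CoreBounds

/-! ### The weight of an outer vertex, and the core next to an edge with two outer vertices. -/

section OuterWeights

variable {V : Type*} [DecidableEq V] {E : Finset (Finset V)}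

theorem exists_eq_triple {k : Finset V} (hk : #k = 3) {w : V} (hw : w ∈ k) :
    ∃ u v, k = {w, u, v} ∧ w ≠ u ∧ w ≠ v ∧ u ≠ v := by
  have h : #(k.erase w) = 2 := by rw [card_erase_of_mem hw, hk]
  obtain ⟨u, v, huv, he⟩ := card_eq_two.1 h
  have hu : u ∈ k.erase w := by simp [he]
  have hv : v ∈ k.erase w := by simp [he]
  refine ⟨u, v, ?_, (ne_of_mem_erase hu).symm, (ne_of_mem_erase hv).symm, huv⟩
  rw [← he, insert_erase hw]

/-- The vertices covered by the edges inside `W`. -/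
def innerSupport (E : Finset (Finset V)) (W : Finset V) : Finset V :=
  (E.filter (· ⊆ W)).biUnion id

theorem mem_innerSupport {W : Finset V} {w : V} :
    w ∈ innerSupport E W ↔ ∃ k ∈ E, k ⊆ W ∧ w ∈ k := by
  simp [innerSupport, and_assoc]

theorem innerSupport_subset (E : Finset (Finset V)) (W : Finset V) : innerSupport E W ⊆ W := by
  intro w hw
  obtain ⟨k, _, hkW, hwk⟩ := mem_innerSupport.1 hw
  exact hkW hwk

namespace FreeConfig

variable {a b c x y z u v w w' w'' : V} {W : Finset V}

/-- Each of the fourteen core triples not listed lies on a loose path that has `xww'` as its end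
edge. -/
theorem core_subset_of_xww (C : FreeConfig E a b c x y z W) (hw : w ∈ W) (hw' : w' ∈ W)
    (hne : w ≠ w') (h : {x, w, w'} ∈ E) :
    E.filter (· ⊆ {a, b, c, x, y, z}) ⊆
      insert {a, y, z} (({{a, b, c}, {x, y, z}, {b, c, x}} : Finset (Finset V)) ∪
        (E ∩ {{a, b, x}, {a, c, x}})) := by
  intro t ht
  obtain ⟨htE, htQ⟩ := mem_filter.1 ht
  have hd := C.nodup_two hw hw' hne
  have hd' := C.swap_bc.nodup_two hw hw' hne
  have hd'' := C.swap_yz.nodup_two hw hw' hne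
  have hd''' := C.swap_bc.swap_yz.nodup_two hw hw' hne
  simp only [mem_insert, mem_union, mem_inter, mem_singleton]
  have ht3 := triple_cases C.nodup htQ (C.sized t htE)
  simp only [mem_insert, mem_singleton] at ht3
  rcases ht3 with (h1 | h1 | h1 | h1 | h1) | (h1 | h1 | h1 | h1 | h1 | h1) | (h1 | h1 | h1) |
    (h1 | h1 | h1) | (h1 | h1 | h1)
  · exact Or.inr (Or.inl (Or.inl h1))
  · exact Or.inr (Or.inl (Or.inr (Or.inl h1)))
  · exact Or.inr (Or.inl (Or.inr (Or.inr h1)))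
  · exact absurd (h1 ▸ htE) (C.notMem_bcy_of_xww C.free hd h)
  · exact absurd (h1 ▸ htE) (C.swap_yz.notMem_bcy_of_xww C.free hd'' h)
  · exact Or.inr (Or.inr ⟨htE, Or.inl h1⟩)
  · exact absurd (h1 ▸ htE) (C.notMem_aby_of_xww C.free hd h)
  · exact absurd (h1 ▸ htE) (C.swap_yz.notMem_aby_of_xww C.free hd'' h)
  · exact Or.inr (Or.inr ⟨htE, Or.inr h1⟩)
  · exact absurd (h1 ▸ htE) (C.swap_bc.notMem_aby_of_xww C.free hd' h)
  · exact absurd (h1 ▸ htE) (C.swap_bc.swap_yz.notMem_aby_of_xww C.free hd''' h)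
  · exact Or.inl h1
  · exact absurd (h1 ▸ htE) (C.notMem_byz_of_xww C.free hd h)
  · exact absurd (h1 ▸ htE) (C.swap_bc.notMem_byz_of_xww C.free hd' h)
  · exact absurd (h1 ▸ htE) (C.notMem_axy_of_xww C.free hd h)
  · exact absurd (h1 ▸ htE) (C.notMem_bxy_of_xww C.free hd h)
  · exact absurd (h1 ▸ htE) (C.notMem_cxy_of_xww C.free hd h)
  · exact absurd (h1 ▸ htE) (C.swap_yz.notMem_axy_of_xww C.free hd'' h)
  · exact absurd (h1 ▸ htE) (C.swap_yz.notMem_bxy_of_xww C.free hd'' h)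
  · exact absurd (h1 ▸ htE) (C.swap_yz.notMem_cxy_of_xww C.free hd'' h)

/-- With `ayz` present, `abx` and `acx` would be the middle edge of a path from `ayz` to `xww'`. The
value 4 is one less than in `card_core_le_of_xww`, which is what makes the comet bound strict in
this case. -/
theorem card_core_le_of_xww_of_ayz (C : FreeConfig E a b c x y z W) (hw : w ∈ W) (hw' : w' ∈ W)
    (hne : w ≠ w') (h : {x, w, w'} ∈ E) (ha : {a, y, z} ∈ E) :
    #(E.filter (· ⊆ {a, b, c, x, y, z})) ≤ 4 := by
  have h0 : #(E ∩ {{a, b, x}, {a, c, x}}) = 0 := by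
    refine card_inter_eq_zero_of_forall ?_
    simp only [mem_insert, mem_singleton]
    rintro t (rfl | rfl)
    · exact C.notMem_abx_of_ayz_of_xww C.free (C.nodup_two hw hw' hne) ha h
    · exact C.swap_bc.notMem_abx_of_ayz_of_xww C.free (C.swap_bc.nodup_two hw hw' hne) ha h
  have := card_le_card (C.core_subset_of_xww hw hw' hne h)
  rw [card_eq_zero.1 h0, union_empty] at this
  exact this.trans card_le_four

theorem card_core_le_of_xww (C : FreeConfig E a b c x y z W) (hw : w ∈ W) (hw' : w' ∈ W)
    (hne : w ≠ w') (h : {x, w, w'} ∈ E) :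
    #(E.filter (· ⊆ {a, b, c, x, y, z})) ≤ 5 := by
  by_cases ha : {a, y, z} ∈ E
  · exact (C.card_core_le_of_xww_of_ayz hw hw' hne h ha).trans (by norm_num)
  · have hsub : E.filter (· ⊆ {a, b, c, x, y, z}) ⊆
        ({{a, b, c}, {x, y, z}, {b, c, x}} : Finset (Finset V)) ∪ {{a, b, x}, {a, c, x}} := by
      intro t ht
      have := C.core_subset_of_xww hw hw' hne h ht
      rcases mem_insert.1 this with rfl | h1
      · exact absurd (mem_filter.1 ht).1 ha
      · exact union_subset_union_right inter_subset_right h1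
    exact (card_le_card hsub).trans ((card_union_le _ _).trans
      (add_le_add card_le_three card_le_two))

/-- By `LinkConfig.swap_ax`, `x, b, c, a, w, w'` is again a configuration, and `y`, `z` are outer
vertices for it. Its exclusions leave five triples, together with `bcy`, `bcz` and `ayz`. -/
theorem card_core_le_of_aww (C : FreeConfig E a b c x y z W) (hw : w ∈ W) (hw' : w' ∈ W)
    (hne : w ≠ w') (h : {a, w, w'} ∈ E) :
    #(E.filter (· ⊆ {a, b, c, x, y, z})) ≤ 7 := by
  have hd := C.nodup_two hw hw' hne
  have D := C.toLinkConfig.swap_ax hd h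
  have hyz : [x, b, c, a, w, w', y, z].Nodup := by
    simp only [List.nodup_cons, List.mem_cons, List.not_mem_nil, or_false, not_or] at hd ⊢; grind
  have hzy : [x, b, c, a, w, w', z, y].Nodup := by
    simp only [List.nodup_cons, List.mem_cons, List.not_mem_nil, or_false, not_or] at hd ⊢; grind
  have hy : [x, b, c, a, w, w', y].Nodup := by
    simp only [List.nodup_cons, List.mem_cons, List.not_mem_nil, or_false, not_or] at hd ⊢; grind
  have hz : [x, b, c, a, w, w', z].Nodup := by
    simp only [List.nodup_cons, List.mem_cons, List.not_mem_nil, or_false, not_or] at hd ⊢; grind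
  have hyz' : [x, c, b, a, w, w', y, z].Nodup := by
    simp only [List.nodup_cons, List.mem_cons, List.not_mem_nil, or_false, not_or] at hd ⊢; grind
  have hy' : [x, c, b, a, w, w', y].Nodup := by
    simp only [List.nodup_cons, List.mem_cons, List.not_mem_nil, or_false, not_or] at hd ⊢; grind
  have hz' : [x, c, b, a, w, w', z].Nodup := by
    simp only [List.nodup_cons, List.mem_cons, List.not_mem_nil, or_false, not_or] at hd ⊢; grind
  have hsub : E.filter (· ⊆ {a, b, c, x, y, z}) ⊆
      ({{a, b, c}, {x, y, z}, {b, c, x}, {a, b, x}, {a, c, x}} : Finset (Finset V)) ∪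
        (E ∩ {{b, c, y}, {b, c, z}}) ∪ (E ∩ {{a, y, z}}) := by
    intro t ht
    obtain ⟨htE, htQ⟩ := mem_filter.1 ht
    simp only [mem_insert, mem_union, mem_inter, mem_singleton]
    have ht3 := triple_cases C.nodup htQ (C.sized t htE)
    simp only [mem_insert, mem_singleton] at ht3
    rcases ht3 with (h1 | h1 | h1 | h1 | h1) | (h1 | h1 | h1 | h1 | h1 | h1) | (h1 | h1 | h1) |
      (h1 | h1 | h1) | (h1 | h1 | h1)
    · exact Or.inl (Or.inl (Or.inl h1))
    · exact Or.inl (Or.inl (Or.inr (Or.inl h1)))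
    · exact Or.inl (Or.inl (Or.inr (Or.inr (Or.inl h1))))
    · exact Or.inl (Or.inr ⟨htE, Or.inl h1⟩)
    · exact Or.inl (Or.inr ⟨htE, Or.inr h1⟩)
    · exact Or.inl (Or.inl (Or.inr (Or.inr (Or.inr (Or.inl h1)))))
    · rw [triple_swap] at h1; exact absurd (h1 ▸ htE) (D.notMem_bxw C.free hy)
    · rw [triple_swap] at h1; exact absurd (h1 ▸ htE) (D.notMem_bxw C.free hz)
    · exact Or.inl (Or.inl (Or.inr (Or.inr (Or.inr (Or.inr h1)))))
    · rw [triple_swap] at h1; exact absurd (h1 ▸ htE) (D.swap_bc.notMem_bxw C.free hy')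
    · rw [triple_swap] at h1; exact absurd (h1 ▸ htE) (D.swap_bc.notMem_bxw C.free hz')
    · exact Or.inr ⟨htE, h1⟩
    · exact absurd (h1 ▸ htE) (D.notMem_bww C.free hyz)
    · exact absurd (h1 ▸ htE) (D.swap_bc.notMem_bww C.free hyz')
    · rw [triple_swap] at h1; exact absurd (h1 ▸ htE) (D.notMem_axw C.free hy)
    · rw [triple_swap] at h1; exact absurd (h1 ▸ htE) (D.notMem_abw C.free hy)
    · rw [triple_swap] at h1; exact absurd (h1 ▸ htE) (D.swap_bc.notMem_abw C.free hy')
    · rw [triple_swap] at h1; exact absurd (h1 ▸ htE) (D.notMem_axw C.free hz)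
    · rw [triple_swap] at h1; exact absurd (h1 ▸ htE) (D.notMem_abw C.free hz)
    · rw [triple_swap] at h1; exact absurd (h1 ▸ htE) (D.swap_bc.notMem_abw C.free hz')
  -- In the swapped configuration `ayz` has the role of `xww'`, so it excludes `bcy` and `bcz`.
  have h12 : #(E ∩ {{b, c, y}, {b, c, z}}) + #(E ∩ {{a, y, z}}) ≤ 2 := by
    by_cases ha : {a, y, z} ∈ E
    · have h0 : #(E ∩ {{b, c, y}, {b, c, z}}) = 0 := by
        refine card_inter_eq_zero_of_forall ?_
        simp only [mem_insert, mem_singleton]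
        rintro t (rfl | rfl)
        · exact D.notMem_bcw_of_xww C.free hyz ha
        · exact D.notMem_bcw_of_xww C.free hzy (by rwa [pair_comm])
      have h1 : #(E ∩ {{a, y, z}}) ≤ 1 :=
        (card_le_card inter_subset_right).trans (card_singleton _).le
      omega
    · have h0 : #(E ∩ {{a, y, z}}) = 0 := by
        refine card_inter_eq_zero_of_forall ?_
        simpa using ha
      have h1 : #(E ∩ {{b, c, y}, {b, c, z}}) ≤ 2 :=
        (card_le_card inter_subset_right).trans card_le_two
      omega
  have h5 : #({{a, b, c}, {x, y, z}, {b, c, x}, {a, b, x}, {a, c, x}} : Finset (Finset V)) ≤ 5 :=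
    card_le_five
  have := card_le_card hsub
  have u1 := card_union_le (({{a, b, c}, {x, y, z}, {b, c, x}, {a, b, x}, {a, c, x}} :
    Finset (Finset V)) ∪ (E ∩ {{b, c, y}, {b, c, z}})) (E ∩ {{a, y, z}})
  have u2 := card_union_le ({{a, b, c}, {x, y, z}, {b, c, x}, {a, b, x}, {a, c, x}} :
    Finset (Finset V)) (E ∩ {{b, c, y}, {b, c, z}})
  omega

/-- Co-neighbours of `w` lie on every inner edge through `w`. -/
theorem mem_of_mem_coNbrs (C : FreeConfig E a b c x y z W) (hu : u = a ∨ u = x) (hw : w ∈ W)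
    (h : w' ∈ coNbrs E W u w) {k : Finset V} (hk : k ∈ E) (hkW : k ⊆ W) (hwk : w ∈ k) :
    w' ∈ k := by
  by_contra hcon
  obtain ⟨hw', hne, hE⟩ := mem_coNbrs.1 h
  obtain ⟨p, q, rfl, hp, hq, hpq⟩ := exists_eq_triple (C.sized k hk) hwk
  simp only [mem_insert, mem_singleton, not_or] at hcon
  -- If `w'` is not on `k = wpq`, then `wpq`, `uww'` and one of `abc`, `bcx` form a loose path.
  have hd := C.nodup_four hw (hkW (by simp) : p ∈ W) (hkW (by simp) : q ∈ W) hw' (by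
    simp only [List.nodup_cons, List.mem_cons, List.not_mem_nil, or_false, not_or]
    grind)
  rcases hu with rfl | rfl
  · exact C.notMem_aww_of_wuv C.free hd hk hE
  · exact C.notMem_xww_of_wuv C.free hd hk hE

theorem mem_coNbrs_symm (h : w' ∈ coNbrs E W u w) (hw : w ∈ W) : w ∈ coNbrs E W u w' := by
  obtain ⟨_, hne, hE⟩ := mem_coNbrs.1 h
  exact mem_coNbrs.2 ⟨hw, hne.symm, by rwa [pair_comm]⟩

/-- A co-neighbour on an inner edge would, by the symmetry of co-neighbourhood, pull `w` onto the
same inner edge. -/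
theorem coNbrs_subset_sdiff (C : FreeConfig E a b c x y z W) (hu : u = a ∨ u = x)
    (hw : w ∈ W \ innerSupport E W) :
    coNbrs E W u w ⊆ (W \ innerSupport E W).erase w := by
  intro w' h
  obtain ⟨hwW, hwS⟩ := mem_sdiff.1 hw
  obtain ⟨hw', hne, hE⟩ := mem_coNbrs.1 h
  refine mem_erase.2 ⟨hne, mem_sdiff.2 ⟨hw', fun hS => hwS ?_⟩⟩
  obtain ⟨k, hk, hkW, hwk⟩ := mem_innerSupport.1 hS
  exact mem_innerSupport.2 ⟨k, hk, hkW, C.mem_of_mem_coNbrs hu hw' (mem_coNbrs_symm h hwW) hk hkW hwk⟩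

theorem notMem_of_coNbrs_x (C : FreeConfig E a b c x y z W) (hw : w ∈ W)
    (h : (coNbrs E W x w).Nonempty) : {b, c, w} ∉ E ∧ {y, z, w} ∉ E := by
  obtain ⟨w', h⟩ := h
  obtain ⟨hw', hne, hE⟩ := mem_coNbrs.1 h
  have hd := C.nodup_two hw hw' hne.symm
  exact ⟨C.notMem_bcw_of_xww C.free hd hE, C.notMem_yzw_of_xww C.free hd hE⟩

theorem notMem_of_coNbrs_a (C : FreeConfig E a b c x y z W) (hw : w ∈ W)
    (h : (coNbrs E W a w).Nonempty) : {x, y, w} ∉ E ∧ {x, z, w} ∉ E ∧ {y, z, w} ∉ E := by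
  obtain ⟨w', h⟩ := h
  obtain ⟨hw', hne, hE⟩ := mem_coNbrs.1 h
  have hd := C.nodup_two hw hw' hne.symm
  exact ⟨C.notMem_xyw_of_aww C.free hd hE,
    C.swap_yz.notMem_xyw_of_aww C.free (C.swap_yz.nodup_two hw hw' hne.symm) hE,
    C.notMem_yzw_of_aww C.free hd hE⟩

/-- For distinct `p`, `q`, the edges `awp`, `xwq` and `bcx` form a loose path. So every co-neighbour
over `a` equals every co-neighbour over `x`. -/
theorem card_coNbrs_le_one (C : FreeConfig E a b c x y z W) (hw : w ∈ W)
    (ha : (coNbrs E W a w).Nonempty) (hx : (coNbrs E W x w).Nonempty) :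
    #(coNbrs E W a w) ≤ 1 ∧ #(coNbrs E W x w) ≤ 1 := by
  have key : ∀ p ∈ coNbrs E W a w, ∀ q ∈ coNbrs E W x w, p = q := by
    intro p hp q hq
    by_contra hne
    obtain ⟨hpW, hpw, hpE⟩ := mem_coNbrs.1 hp
    obtain ⟨hqW, hqw, hqE⟩ := mem_coNbrs.1 hq
    exact C.notMem_xww_of_aww C.free (C.nodup_three hw hpW hqW hpw.symm hqw.symm hne) hpE hqE
  obtain ⟨p, hp⟩ := ha
  obtain ⟨q, hq⟩ := hx
  constructor
  · exact card_le_one.2 fun i hi j hj => (key i hi q hq).trans (key j hj q hq).symm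
  · exact card_le_one.2 fun i hi j hj => (key p hp i hi).symm.trans (key p hp j hj)

/-- An inner edge through `w` excludes `xyw` and `xzw` and contains all co-neighbours of `w`, so
there are at most two over each of `a` and `x`. The value 4 occurs either as `bcw` and `yzw` without
co-neighbours, or as `bcw` with two co-neighbours over `a`. -/
theorem outerWeight_le_of_mem (C : FreeConfig E a b c x y z W) (hw : w ∈ innerSupport E W) :
    outerWeight E a b c x y z W w ≤ 4 := by
  obtain ⟨k, hk, hkW, hwk⟩ := mem_innerSupport.1 hw
  have hwW := hkW hwk
  have hcard : ∀ u, u = a ∨ u = x → #(coNbrs E W u w) ≤ 2 := by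
    intro u hu
    have : coNbrs E W u w ⊆ k.erase w := fun i hi =>
      mem_erase.2 ⟨(mem_coNbrs.1 hi).2.1, C.mem_of_mem_coNbrs hu hwW hi hk hkW hwk⟩
    refine (card_le_card this).trans ?_
    rw [card_erase_of_mem hwk, C.sized k hk]
  have ha := hcard a (Or.inl rfl)
  have hx := hcard x (Or.inr rfl)
  obtain ⟨p, q, rfl, hp, hq, hpq⟩ := exists_eq_triple (C.sized k hk) hwk
  have hd := C.nodup_three hwW (hkW (by simp) : p ∈ W) (hkW (by simp) : q ∈ W) hp hq hpq
  have hd' := C.swap_yz.nodup_three hwW (hkW (by simp) : p ∈ W) (hkW (by simp) : q ∈ W) hp hq hpq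
  have e1 := C.notMem_xyw_of_wuv C.free hd hk
  have e2 := C.swap_yz.notMem_xyw_of_wuv C.free hd' hk
  unfold outerWeight
  rw [if_neg e1, if_neg e2]
  rcases (coNbrs E W x w).eq_empty_or_nonempty with hx0 | hx1
  · rcases (coNbrs E W a w).eq_empty_or_nonempty with ha0 | ha1
    · rw [hx0, ha0, card_empty]; split_ifs <;> omega
    · obtain ⟨-, -, e⟩ := C.notMem_of_coNbrs_a hwW ha1
      rw [hx0, card_empty, if_neg e]; split_ifs <;> omega
  · obtain ⟨e3, e4⟩ := C.notMem_of_coNbrs_x hwW hx1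
    rw [if_neg e3, if_neg e4]
    rcases (coNbrs E W a w).eq_empty_or_nonempty with ha0 | ha1
    · rw [ha0, card_empty]; omega
    · have := C.card_coNbrs_le_one hwW ha1 hx1; omega

/-- Let `p` be the number of vertices of `W` off the inner edges. Co-neighbours over `x` exclude
`bcw` and `yzw`, leaving `4 + (p - 1)`; co-neighbours over `a` leave only `bcw`, giving `2 + (p -
1)`; both kinds together give at most 2; none gives at most 8. The first alternative keeps the
structure needed for the equality case. -/
theorem outerWeight_cases (C : FreeConfig E a b c x y z W) (hw : w ∈ W \ innerSupport E W) :
    ((coNbrs E W x w).Nonempty ∧ coNbrs E W a w = ∅ ∧ {b, c, w} ∉ E ∧ {y, z, w} ∉ E ∧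
      outerWeight E a b c x y z W w ≤ #(W \ innerSupport E W) + 3) ∨
    outerWeight E a b c x y z W w ≤ max 8 (#(W \ innerSupport E W) + 1) := by
  have hwW := (mem_sdiff.1 hw).1
  have hcard : ∀ u, u = a ∨ u = x → #(coNbrs E W u w) + 1 ≤ #(W \ innerSupport E W) := by
    intro u hu
    have := card_le_card (C.coNbrs_subset_sdiff hu hw)
    rw [card_erase_of_mem hw] at this
    have hpos := card_pos.2 ⟨w, hw⟩
    omega
  have ha := hcard a (Or.inl rfl)
  have hx := hcard x (Or.inr rfl)
  unfold outerWeight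
  rcases (coNbrs E W x w).eq_empty_or_nonempty with hx0 | hx1
  · right
    rcases (coNbrs E W a w).eq_empty_or_nonempty with ha0 | ha1
    · rw [hx0, ha0, card_empty]; split_ifs <;> omega
    · obtain ⟨e1, e2, e3⟩ := C.notMem_of_coNbrs_a hwW ha1
      rw [hx0, card_empty, if_neg e1, if_neg e2, if_neg e3]; split_ifs <;> omega
  · obtain ⟨e3, e4⟩ := C.notMem_of_coNbrs_x hwW hx1
    rw [if_neg e3, if_neg e4]
    rcases (coNbrs E W a w).eq_empty_or_nonempty with ha0 | ha1
    · left
      refine ⟨hx1, ha0, e3, e4, ?_⟩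
      rw [ha0, card_empty]; split_ifs <;> omega
    · right
      obtain ⟨e1, e2, _⟩ := C.notMem_of_coNbrs_a hwW ha1
      rw [if_neg e1, if_neg e2]
      have := C.card_coNbrs_le_one hwW ha1 hx1; omega

theorem two_mul_card_le_add (C : FreeConfig E a b c x y z W) :
    2 * #E ≤ 2 * #(E.filter (· ⊆ {a, b, c, x, y, z})) + 2 * #(E.filter (· ⊆ W)) +
      4 * #(innerSupport E W) + ∑ w ∈ W \ innerSupport E W, outerWeight E a b c x y z W w := by
  have h := C.two_mul_card_le
  rw [← Finset.sum_sdiff (innerSupport_subset E W)] at h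
  have h2 : ∑ w ∈ innerSupport E W, outerWeight E a b c x y z W w ≤ #(innerSupport E W) * 4 := by
    rw [← smul_eq_mul]
    exact Finset.sum_le_card_nsmul _ _ _ fun w hw => C.outerWeight_le_of_mem hw
  omega

end FreeConfig

end OuterWeights

/-! ### Size of a family containing a given core. -/

section ConnectedBounds

variable {V : Type*} [DecidableEq V] {E : Finset (Finset V)}

/-- The maximal number of edges of a family without loose paths of length three whose support has
exactly `s` vertices is at most this number. -/
def edgeBound (s : ℕ) : ℕ := if s ≤ 6 then s.choose 3 else (s - 1).choose 2

theorem two_mul_choose_two (k : ℕ) : 2 * (k + 1).choose 2 = (k + 1) * k := by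
  have := Nat.div_mul_cancel (Nat.even_mul_pred_self (k + 1)).two_dvd
  rw [Nat.choose_two_right, mul_comm, this, Nat.add_sub_cancel]

/-- Every edge lies in the four-set `{a, b, c, x}` or contains `x` and avoids `a`, `b`, `c`. -/
def IsSubComet (E : Finset (Finset V)) : Prop :=
  ∃ a b c x : V, [a, b, c, x].Nodup ∧
    ∀ t ∈ E, t ⊆ {a, b, c, x} ∨ (x ∈ t ∧ a ∉ t ∧ b ∉ t ∧ c ∉ t)

/-- The bounds for connected families with two disjoint edges on `m + 6 ≥ 7` vertices. -/
structure ConnectedBound (E : Finset (Finset V)) (m : ℕ) : Prop where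
  seven : m = 1 → #E ≤ 15
  small : 1 ≤ m → m ≤ 6 → #E < 20 + m.choose 3
  large : 7 ≤ m → #E < 4 + (m + 2).choose 2 ∨ (#E ≤ 4 + (m + 2).choose 2 ∧ IsSubComet E)

theorem connectedBound_of_arith {m : ℕ}
    (h : (m = 1 → 2 * #E ≤ 31) ∧ (1 ≤ m → m ≤ 6 → 2 * #E < 40 + 2 * m.choose 3) ∧
      (7 ≤ m → 2 * #E < 8 + (m + 2) * (m + 1))) : ConnectedBound E m where
  seven h1 := by have := h.1 h1; omega
  small h1 h2 := by have := h.2.1 h1 h2; omega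
  large h1 := by
    have := h.2.2 h1
    have h2 : 2 * (m + 2).choose 2 = (m + 2) * (m + 1) := two_mul_choose_two (m + 1)
    left; omega

/-- Here `s` counts the vertices on inner edges, `p` the other outer vertices, and `e` is twice the
number of edges. The summand 14 is twice the core bound 7. At `s = 6`, `p = 1` the general estimate
gives 86, above the required 80, so that case enters through its own hypothesis. -/
theorem edgeBound_arith {p s e : ℕ} (hs : 1 ≤ s)
    (h : e ≤ 14 + 2 * edgeBound s + 4 * s + p * max 8 (p + 3))
    (h' : s = 6 → p = 1 → e ≤ 74) :
    (p + s = 1 → e ≤ 31) ∧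
    (1 ≤ p + s → p + s ≤ 6 → e < 40 + 2 * (p + s).choose 3) ∧
      (7 ≤ p + s → e < 8 + (p + s + 2) * (p + s + 1)) := by
  rcases le_or_gt (p + s) 8 with hle | hgt
  · have hp : p ≤ 7 := by omega
    have hs' : s ≤ 8 := by omega
    have key₁ : ∀ p ≤ 6, ∀ s ≤ 6, 1 ≤ s → p + s ≤ 6 →
        14 + 2 * edgeBound s + 4 * s + p * max 8 (p + 3) < 40 + 2 * (p + s).choose 3 := by decide
    have key₂ : ∀ p ≤ 7, ∀ s ≤ 8, 1 ≤ s ∧ 7 ≤ p + s ∧ p + s ≤ 8 ∧ ¬ (s = 6 ∧ p = 1) →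
        14 + 2 * edgeBound s + 4 * s + p * max 8 (p + 3) < 8 + (p + s + 2) * (p + s + 1) := by
      decide
    refine ⟨fun h1 => ?_, fun _ h6 => ?_, fun h7 => ?_⟩
    · obtain ⟨rfl, rfl⟩ : p = 0 ∧ s = 1 := by omega
      exact h.trans (by decide)
    · exact h.trans_lt (key₁ p (by omega) s (by omega) hs h6)
    · by_cases hx : s = 6 ∧ p = 1
      · have := h' hx.1 hx.2
        obtain ⟨rfl, rfl⟩ := hx
        omega
      · exact h.trans_lt (key₂ p hp s hs' ⟨hs, h7, hle, hx⟩)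
  · refine ⟨by omega, by omega, fun _ => h.trans_lt ?_⟩
    rcases le_or_gt s 6 with h6 | h6
    · have heb : edgeBound s ≤ 20 := by
        have : ∀ s ≤ 6, edgeBound s ≤ 20 := by decide
        exact this s h6
      rcases le_total 8 (p + 3) with h8 | h8
      · rw [max_eq_right h8]
        -- The term `2 * s * 5` is the cross term `2 * s * p` of the target at the least `p` of this
        -- branch.
        have hsub : ∀ s ≤ 6, 1 ≤ s → 14 + 2 * edgeBound s + 4 * s ≤ 10 + (s * s + 3 * s) + 2 * s * 5 := by
          decide
        have := hsub s h6 hs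
        nlinarith
      · rw [max_eq_left h8]
        have hp : p ≤ 5 := by omega
        have hsub : ∀ p ≤ 5, ∀ s ≤ 6, 8 < p + s →
          14 + 2 * edgeBound s + 4 * s + p * 8 < 8 + (p + s + 2) * (p + s + 1) := by decide
        exact hsub p hp s h6 hgt
    · have heb : 2 * edgeBound s = (s - 1) * (s - 2) := by
        obtain ⟨k, rfl⟩ : ∃ k, s = k + 2 := ⟨s - 2, by omega⟩
        rw [edgeBound, if_neg (by omega)]
        exact two_mul_choose_two k
      rw [heb]
      obtain ⟨k, rfl⟩ : ∃ k, s = k + 7 := ⟨s - 7, by omega⟩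
      have e1 : k + 7 - 1 = k + 6 := by omega
      have e2 : k + 7 - 2 = k + 5 := by omega
      rw [e1, e2]
      rcases le_total 8 (p + 3) with h8 | h8
      · rw [max_eq_right h8]; nlinarith
      · rw [max_eq_left h8]; nlinarith

namespace FreeConfig

variable {a b c x y z u v w w' w'' : V} {W : Finset V}

/-- If all inner edges through `w` contain `w'` and the inner support has six vertices, then six
triples are missing. -/
theorem card_inner_le_of_forall (hE : ∀ t ∈ E, #t = 3) (h6 : #(innerSupport E W) = 6)
    (hw : w ∈ innerSupport E W) (hne : w' ≠ w)
    (h : ∀ k ∈ E, k ⊆ W → w ∈ k → w' ∈ k) : #(E.filter (· ⊆ W)) ≤ 14 := by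
  set S := innerSupport E W with hS
  have hw' : w' ∈ S := by
    obtain ⟨k, hk, hkW, hwk⟩ := mem_innerSupport.1 hw
    exact mem_innerSupport.2 ⟨k, hk, hkW, h k hk hkW hwk⟩
  -- The triples of `S` through `w` that avoid `w'`: there are `C(4, 2) = 6` of them, out of 20.
  set K := (((S.erase w).erase w').powersetCard 2).image (insert w) with hK
  have hKcard : #K = 6 := by
    rw [hK, card_image_of_injOn, card_powersetCard, card_erase_of_mem (mem_erase.2 ⟨hne, hw'⟩),
      card_erase_of_mem hw, h6]
    · rfl
    · intro p hp q hq hpq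
      have hp' : w ∉ p := fun hh => by
        have := (mem_powersetCard.1 hp).1 hh
        simp at this
      have hq' : w ∉ q := fun hh => by
        have := (mem_powersetCard.1 hq).1 hh
        simp at this
      rw [← erase_insert hp', ← erase_insert hq']
      exact congrArg (fun s => s.erase w) hpq
  have hKsub : K ⊆ S.powersetCard 3 := by
    intro t ht
    obtain ⟨p, hp, rfl⟩ := mem_image.1 ht
    obtain ⟨hpS, hp2⟩ := mem_powersetCard.1 hp
    have hp' : w ∉ p := fun hh => by
      have := hpS hh
      simp at this
    refine mem_powersetCard.2 ⟨insert_subset hw (hpS.trans ((erase_subset _ _).trans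
      (erase_subset _ _))), ?_⟩
    rw [card_insert_of_notMem hp', hp2]
  have hsub : E.filter (· ⊆ W) ⊆ S.powersetCard 3 \ K := by
    intro t ht
    obtain ⟨htE, htW⟩ := mem_filter.1 ht
    refine mem_sdiff.2 ⟨mem_powersetCard.2
      ⟨fun i hi => mem_innerSupport.2 ⟨t, htE, htW, hi⟩, hE t htE⟩, fun hc => ?_⟩
    obtain ⟨p, hp, rfl⟩ := mem_image.1 hc
    have := h _ htE htW (mem_insert_self _ _)
    rcases mem_insert.1 this with h1 | h1
    · exact hne h1
    · have := (mem_powersetCard.1 hp).1 h1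
      simp at this
  have := card_le_card hsub
  rw [card_sdiff_of_subset hKsub, card_powersetCard, h6, hKcard] at this
  exact this

/-- Under these exclusions the surviving edges are the triples of `{a, b, c, x}`, together with
`xyz`, `xyw`, `xzw` and `xww'`. The latter pass through `x` and avoid the head `{a, b, c}`. -/
theorem isSubComet (C : FreeConfig E a b c x y z W) (hS : innerSupport E W = ∅)
    (hayz : {a, y, z} ∉ E) {w₀ w₁ : V} (h₀ : w₀ ∈ W) (h₁ : w₁ ∈ W) (h₀₁ : w₀ ≠ w₁)
    (hx : {x, w₀, w₁} ∈ E)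
    (h : ∀ w ∈ W, coNbrs E W a w = ∅ ∧ {b, c, w} ∉ E ∧ {y, z, w} ∉ E) : IsSubComet E := by
  have hd0 := C.nodup
  refine ⟨a, b, c, x, ?_, fun t ht => ?_⟩
  · simp only [List.nodup_cons, List.mem_cons, List.not_mem_nil, or_false, not_or] at hd0 ⊢; grind
  rcases C.edge_cases ht with h1 | ⟨w, hw, rfl | rfl | rfl | rfl⟩ |
    ⟨w, hw, w', hw', hne, rfl | rfl⟩ | h1
  · have := C.core_subset_of_xww h₀ h₁ h₀₁ hx (mem_filter.2 ⟨ht, h1⟩)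
    simp only [mem_insert, mem_union, mem_inter, mem_singleton] at this
    simp only [List.nodup_cons, List.mem_cons, List.not_mem_nil, or_false, not_or] at hd0
    rcases this with rfl | (rfl | rfl | rfl) | ⟨-, rfl | rfl⟩
    · exact absurd ht hayz
    · left; intro i; simp only [mem_insert, mem_singleton]; tauto
    · right; simp only [mem_insert, mem_singleton]; grind
    · left; intro i; simp only [mem_insert, mem_singleton]; tauto
    · left; intro i; simp only [mem_insert, mem_singleton]; tauto
    · left; intro i; simp only [mem_insert, mem_singleton]; tauto
  · exact absurd ht (h w hw).2.1
  · have hd := C.nodup_one hw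
    simp only [List.nodup_cons, List.mem_cons, List.not_mem_nil, or_false, not_or] at hd
    right; simp only [mem_insert, mem_singleton]; grind
  · have hd := C.nodup_one hw
    simp only [List.nodup_cons, List.mem_cons, List.not_mem_nil, or_false, not_or] at hd
    right; simp only [mem_insert, mem_singleton]; grind
  · exact absurd ht (h w hw).2.2
  · have : w' ∈ coNbrs E W a w := mem_coNbrs.2 ⟨hw', hne.symm, ht⟩
    rw [(h w hw).1] at this
    exact absurd this (notMem_empty _)
  · have hd := C.nodup_two hw hw' hne
    simp only [List.nodup_cons, List.mem_cons, List.not_mem_nil, or_false, not_or] at hd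
    right; simp only [mem_insert, mem_singleton]; grind
  · obtain ⟨i, hi⟩ := card_pos.1 (by rw [C.sized t ht]; norm_num : 0 < #t)
    have : i ∈ innerSupport E W := mem_innerSupport.2 ⟨t, ht, h1, hi⟩
    rw [hS] at this
    exact absurd this (notMem_empty _)

/-- The main count. Only the case without inner edges and with some edge `xww'` can reach the comet
bound; every other case is strictly below it. -/
theorem connectedBound_of_outer_pair (C : FreeConfig E a b c x y z W)
    (hIH : #(E.filter (· ⊆ W)) ≤ edgeBound #(innerSupport E W))
    (hu : u = a ∨ u = x) (hw : w ∈ W) (hw' : w' ∈ W) (hne : w ≠ w') (h : {u, w, w'} ∈ E) :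
    ConnectedBound E #W := by
  have hmain := C.two_mul_card_le_add
  have hcardW : #(W \ innerSupport E W) + #(innerSupport E W) = #W :=
    card_sdiff_add_card_eq_card (innerSupport_subset E W)
  have hQ : #(E.filter (· ⊆ {a, b, c, x, y, z})) ≤ 7 := by
    rcases hu with rfl | rfl
    · exact C.card_core_le_of_aww hw hw' hne h
    · exact (C.card_core_le_of_xww hw hw' hne h).trans (by norm_num)
  have hW2 : 2 ≤ #W := by
    have : ({w, w'} : Finset V) ⊆ W := by
      intro i hi; simp only [mem_insert, mem_singleton] at hi
      rcases hi with rfl | rfl <;> assumption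
    have := card_le_card this
    rwa [card_pair hne] at this
  rcases (innerSupport E W).eq_empty_or_nonempty with hS | hS
  · have h0 : #(E.filter (· ⊆ W)) = 0 := by
      have : edgeBound #(innerSupport E W) = 0 := by rw [hS, card_empty]; rfl
      omega
    have hall := fun w (hw : w ∈ W) => C.outerWeight_cases (w := w) (by rwa [hS, sdiff_empty])
    rw [h0, hS, card_empty, sdiff_empty] at hmain
    rw [hS, sdiff_empty] at hall
    set m := #W with hm
    by_cases hX : ∃ w ∈ W, (coNbrs E W x w).Nonempty
    · obtain ⟨w₀, hw₀, w₁, hw₁⟩ := hX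
      obtain ⟨hw₁W, hne₁, hE₁⟩ := mem_coNbrs.1 hw₁
      have hQ5 := C.card_core_le_of_xww hw₀ hw₁W hne₁.symm hE₁
      have hsum : ∑ w ∈ W, outerWeight E a b c x y z W w ≤ m * max 8 (m + 3) := by
        rw [← smul_eq_mul]
        refine Finset.sum_le_card_nsmul _ _ _ fun w hw => ?_
        rcases hall w hw with h1 | h1
        · exact h1.2.2.2.2.trans (le_max_right _ _)
        · exact h1.trans (max_le_max le_rfl (by omega))
      rcases le_or_gt m 6 with hm6 | hm7
      · apply connectedBound_of_arith
        refine ⟨by omega, fun _ _ => ?_, by omega⟩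
        have key : ∀ m ≤ 6, 2 ≤ m → 10 + m * max 8 (m + 3) < 40 + 2 * m.choose 3 := by decide
        have := key m hm6 hW2
        omega
      · have hmax : max 8 (m + 3) = m + 3 := max_eq_right (by omega)
        have hmax' : max 8 (m + 1) < m + 3 := by omega
        have hchoose := two_mul_choose_two (m + 1)
        rw [hmax] at hsum
        -- Five core edges and weight `m + 3` at every vertex give exactly twice the size of the
        -- comet on `m + 6` vertices.
        have hmm : m * (m + 3) + 2 = (m + 2) * (m + 1) := by ring
        refine ⟨by omega, by omega, fun _ => ?_⟩
        -- When this fails, either `ayz` costs a core edge or some vertex has weight below `m + 3`;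
        -- both make the bound strict.
        by_cases hgood : {a, y, z} ∉ E ∧
            ∀ w ∈ W, coNbrs E W a w = ∅ ∧ {b, c, w} ∉ E ∧ {y, z, w} ∉ E
        · right
          refine ⟨?_, C.isSubComet hS hgood.1 hw₀ hw₁W hne₁.symm hE₁ hgood.2⟩
          have : (m + 1 + 1) * (m + 1) = (m + 2) * (m + 1) := rfl
          have : (m + 1 + 1).choose 2 = (m + 2).choose 2 := rfl
          omega
        · left
          have e1 : (m + 1 + 1) * (m + 1) = (m + 2) * (m + 1) := rfl
          have e2 : (m + 1 + 1).choose 2 = (m + 2).choose 2 := rfl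
          by_cases hayz : {a, y, z} ∈ E
          · have := C.card_core_le_of_xww_of_ayz hw₀ hw₁W hne₁.symm hE₁ hayz
            omega
          · have : ∃ w ∈ W, outerWeight E a b c x y z W w < m + 3 := by
              by_contra hcon
              push Not at hcon
              refine hgood ⟨hayz, fun w hw => ?_⟩
              rcases hall w hw with h1 | h1
              · exact ⟨h1.2.1, h1.2.2.1, h1.2.2.2.1⟩
              · have := hcon w hw; omega
            have hlt : ∑ w ∈ W, outerWeight E a b c x y z W w < ∑ w ∈ W, (m + 3) := by
              refine Finset.sum_lt_sum (fun w hw => ?_) this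
              rcases hall w hw with h1 | h1
              · exact h1.2.2.2.2
              · omega
            rw [Finset.sum_const, smul_eq_mul, ← hm] at hlt
            omega
    · have hsum : ∑ w ∈ W, outerWeight E a b c x y z W w ≤ m * max 8 (m + 1) := by
        rw [← smul_eq_mul]
        refine Finset.sum_le_card_nsmul _ _ _ fun w hw => ?_
        rcases hall w hw with h1 | h1
        · exact absurd ⟨w, hw, h1.1⟩ hX
        · exact h1
      apply connectedBound_of_arith
      refine ⟨by omega, fun _ hm6 => ?_, fun hm7 => ?_⟩
      · have key : ∀ m ≤ 6, 2 ≤ m → 14 + m * max 8 (m + 1) < 40 + 2 * m.choose 3 := by decide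
        have := key m hm6 hW2
        omega
      · rcases le_total 8 (m + 1) with h8 | h8
        · rw [max_eq_right h8] at hsum; nlinarith
        · rw [max_eq_left h8] at hsum
          have : m = 7 := by omega
          rw [this] at hsum ⊢; omega
  · have hsum : ∑ w ∈ W \ innerSupport E W, outerWeight E a b c x y z W w ≤
        #(W \ innerSupport E W) * max 8 (#(W \ innerSupport E W) + 3) := by
      rw [← smul_eq_mul]
      refine Finset.sum_le_card_nsmul _ _ _ fun w hw => ?_
      rcases C.outerWeight_cases hw with h1 | h1
      · exact h1.2.2.2.2.trans (le_max_right _ _)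
      · exact h1.trans (max_le_max le_rfl (by omega))
    apply connectedBound_of_arith
    rw [← hcardW]
    -- In the exceptional case `s = 6`, `p = 1`, the single vertex off the inner edges has no
    -- co-neighbour, so `w` lies on inner edges. All of these contain `w'`, hence there are at most
    -- 14 of them, and twice the total is at most `14 + 28 + 24 + 8 = 74`.
    refine edgeBound_arith (card_pos.2 hS) (by omega) fun h6 h1 => ?_
    have h14 : #(E.filter (· ⊆ W)) ≤ 14 := by
      have hco : w' ∈ coNbrs E W u w := mem_coNbrs.2 ⟨hw', hne.symm, h⟩
      have hwS : w ∈ innerSupport E W := by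
        by_contra hcon
        have hwd := mem_sdiff.2 ⟨hw, hcon⟩
        have := card_le_card (C.coNbrs_subset_sdiff hu hwd)
        rw [card_erase_of_mem hwd, h1] at this
        have := card_pos.2 ⟨w', hco⟩
        omega
      exact card_inner_le_of_forall C.sized h6 hwS hne.symm fun k hk hkW hwk =>
        C.mem_of_mem_coNbrs hu hw hco hk hkW hwk
    rw [h1] at hsum
    rw [h6] at hmain
    simp only [show max 8 (1 + 3) = 8 from rfl] at hsum
    omega

/-- The three linear bounds stay below the cubic and quadratic targets; `14 + m` at `m = 1` is
exactly the value 15 allowed there. -/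
theorem connectedBound_of_outer_le_one (C : FreeConfig E a b c x y z W)
    (hW : ∀ t ∈ E, ¬ t ⊆ {a, b, c, x, y, z} → ∃ w ∈ W,
      t = {b, c, w} ∨ t = {x, y, w} ∨ t = {x, z, w} ∨ t = {y, z, w})
    (hne : ∃ t ∈ E, ¬ t ⊆ {a, b, c, x, y, z}) : ConnectedBound E #W := by
  have h := C.card_le_of_outer_le_one hW hne
  apply connectedBound_of_arith
  set m := #W
  refine ⟨by omega, fun h1 h6 => ?_, fun h7 => ?_⟩
  rotate_left
  · have h7m : 7 * m ≤ m * m := Nat.mul_le_mul_right m h7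
    have e : (m + 2) * (m + 1) = m * m + 3 * m + 2 := by ring
    omega
  have key : ∀ m ≤ 6, 1 ≤ m → 2 * (14 + m) < 40 + 2 * m.choose 3 ∧
    2 * (11 + 3 * m) < 40 + 2 * m.choose 3 ∧ 2 * (5 + 4 * m) < 40 + 2 * m.choose 3 := by decide
  have := key m h6 h1
  omega

end FreeConfig

end ConnectedBounds

/-! ### Finding a core in a connected family, and exchanging it. -/

section ConnectedFamilies

variable {V : Type*} [DecidableEq V] {E : Finset (Finset V)}

theorem exists_linkConfig_of_card (hs : ∀ t ∈ E, #t = 3) {e f g : Finset V} (he : e ∈ E)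
    (hf : f ∈ E) (hg : g ∈ E) (hef : Disjoint e f) (h2 : #(g ∩ e) = 2) (h1 : #(g ∩ f) = 1) :
    ∃ a b c x y z, LinkConfig E a b c x y z := by
  obtain ⟨b, c, hbc, hbc'⟩ := card_eq_two.1 h2
  obtain ⟨x, hx⟩ := card_eq_one.1 h1
  have hb : b ∈ g ∩ e := by simp [hbc']
  have hc : c ∈ g ∩ e := by simp [hbc']
  have hx' : x ∈ g ∩ f := by simp [hx]
  rw [mem_inter] at hb hc hx'
  have hdis : ∀ i ∈ e, i ∉ f := fun i hi hi' => disjoint_left.1 hef hi hi'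
  have hgeq : ({b, c, x} : Finset V) = g := by
    refine eq_of_subset_of_card_le ?_ ?_
    · intro i hi; simp only [mem_insert, mem_singleton] at hi
      rcases hi with rfl | rfl | rfl
      exacts [hb.1, hc.1, hx'.1]
    · rw [hs g hg, card_eq_three.2 ⟨b, c, x, hbc, fun h => hdis b hb.2 (h ▸ hx'.2),
        fun h => hdis c hc.2 (h ▸ hx'.2), rfl⟩]
  obtain ⟨p, q, rfl, hbp, hbq, hpq⟩ := exists_eq_triple (hs e he) hb.2
  obtain ⟨y, z, rfl, hxy, hxz, hyz⟩ := exists_eq_triple (hs f hf) hx'.2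
  subst hgeq
  have hc2 := hc.2
  simp only [mem_insert, mem_singleton] at hc2 hdis
  rcases hc2 with h | rfl | rfl
  · exact absurd h hbc.symm
  · refine ⟨q, b, c, x, y, z, ?_, ?_, hg, hf⟩
    · simp only [List.nodup_cons, List.mem_cons, List.not_mem_nil, or_false, not_or]; grind
    · rwa [triple_rotate]
  · refine ⟨p, b, c, x, y, z, ?_, ?_, hg, hf⟩
    · simp only [List.nodup_cons, List.mem_cons, List.not_mem_nil, or_false, not_or]; grind
    · rwa [triple_swap]

theorem LinkConnected.exists_linkConfig (hc : LinkConnected E) (hE : LoosePathFree E)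
    (hs : ∀ t ∈ E, #t = 3) {e f : Finset V} (he : e ∈ E) (hf : f ∈ E) (hef : Disjoint e f) :
    ∃ a b c x y z, LinkConfig E a b c x y z := by
  have hpos : ∀ s t : Finset V, ¬ Disjoint s t → 1 ≤ #(t ∩ s) := by
    intro s t h
    rw [disjoint_comm] at h
    exact card_pos.2 (not_disjoint_iff_nonempty_inter.1 h)
  -- Connectivity is applied to the edges meeting `e`. It yields an edge `h` meeting both `e` and an
  -- edge `g` disjoint from `e`; since `h` has three vertices and is not the middle of a loose path,
  -- the intersections have sizes 2 and 1.
  obtain ⟨h, hh, g, hg, hhg⟩ := hc (E.filter fun t => ¬ Disjoint e t) (filter_subset _ _)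
    ⟨e, mem_filter.2 ⟨he, fun hd => by
      rw [disjoint_self_iff_empty] at hd
      have := hs e he
      rw [hd, card_empty] at this
      omega⟩⟩ ⟨f, mem_sdiff.2 ⟨hf, fun hm => (mem_filter.1 hm).2 hef⟩⟩
  obtain ⟨hhE, heh⟩ := mem_filter.1 hh
  obtain ⟨hgE, hg'⟩ := mem_sdiff.1 hg
  have heg : Disjoint e g := by
    by_contra hcon
    exact hg' (mem_filter.2 ⟨hgE, hcon⟩)
  have h1 := hpos _ _ heh
  have h2 := hpos _ _ (fun hd => hhg (disjoint_comm.1 hd) : ¬ Disjoint g h)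
  have h3 : #(h ∩ e) + #(h ∩ g) ≤ 3 := by
    rw [← hs h hhE, ← card_union_of_disjoint
      (disjoint_of_subset_left inter_subset_right (disjoint_of_subset_right inter_subset_right heg))]
    exact card_le_card (union_subset inter_subset_left inter_subset_left)
  have h4 : ¬ (#(h ∩ e) = 1 ∧ #(h ∩ g) = 1) := fun i => hE e he g hgE h hhE heg i.1 i.2
  have : (#(h ∩ e) = 2 ∧ #(h ∩ g) = 1) ∨ (#(h ∩ g) = 2 ∧ #(h ∩ e) = 1) := by omega
  rcases this with ⟨i, j⟩ | ⟨i, j⟩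
  · exact exists_linkConfig_of_card hs he hgE hhE heg i j
  · exact exists_linkConfig_of_card hs hgE he hhE heg.symm i j

/-- The vertices covered by a family. -/
def support (E : Finset (Finset V)) : Finset V := E.biUnion id

theorem subset_support {t : Finset V} (ht : t ∈ E) : t ⊆ support E :=
  subset_biUnion_of_mem id ht

theorem mem_support {v : V} : v ∈ support E ↔ ∃ t ∈ E, v ∈ t := by simp [support]

namespace LinkConfig

variable {a b c x y z u v w w' w'' : V}

theorem card_core (C : LinkConfig E a b c x y z) : #({a, b, c, x, y, z} : Finset V) = 6 := by
  have := List.toFinset_card_of_nodup C.nodup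
  simpa using this

theorem core_subset_support (C : LinkConfig E a b c x y z) :
    ({a, b, c, x, y, z} : Finset V) ⊆ support E := by
  intro i hi
  have h1 := subset_support C.abc
  have h2 := subset_support C.xyz
  simp only [mem_insert, mem_singleton] at hi
  rcases hi with rfl | rfl | rfl | rfl | rfl | rfl
  · exact h1 (by simp)
  · exact h1 (by simp)
  · exact h1 (by simp)
  · exact h2 (by simp)
  · exact h2 (by simp)
  · exact h2 (by simp)

theorem freeConfig (C : LinkConfig E a b c x y z) (hE : LoosePathFree E) (hs : ∀ t ∈ E, #t = 3) :
    FreeConfig E a b c x y z (support E \ {a, b, c, x, y, z}) where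
  toLinkConfig := C
  free := hE
  sized := hs
  disj _ hw := (mem_sdiff.1 hw).2
  cover t ht := by
    rw [union_sdiff_of_subset C.core_subset_support]
    exact subset_support ht

theorem card_outer (C : LinkConfig E a b c x y z) {m : ℕ} (hm : #(support E) = m + 6) :
    #(support E \ {a, b, c, x, y, z}) = m := by
  rw [card_sdiff_of_subset C.core_subset_support, C.card_core, hm, Nat.add_sub_cancel]

/-- The inner edges avoid the six core vertices, so their support is smaller and the induction
hypothesis applies. -/
theorem card_inner_le (C : LinkConfig E a b c x y z) (hE : LoosePathFree E)
    (hs : ∀ t ∈ E, #t = 3) (IH : ∀ F : Finset (Finset V), LoosePathFree F → (∀ t ∈ F, #t = 3) →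
      #(support F) < #(support E) → #F ≤ edgeBound #(support F)) :
    #(E.filter (· ⊆ support E \ {a, b, c, x, y, z})) ≤
      edgeBound #(innerSupport E (support E \ {a, b, c, x, y, z})) := by
  refine IH _ (hE.mono (filter_subset _ _)) (fun t ht => hs t (mem_filter.1 ht).1) ?_
  have h1 : #(support E \ {a, b, c, x, y, z}) + 6 = #(support E) := by
    rw [← C.card_core]
    exact card_sdiff_add_card_eq_card C.core_subset_support
  have h2 := card_le_card (innerSupport_subset E (support E \ {a, b, c, x, y, z}))
  have : support (E.filter (· ⊆ support E \ {a, b, c, x, y, z})) =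
    innerSupport E (support E \ {a, b, c, x, y, z}) := rfl
  rw [this]
  omega

/-- Stated for an arbitrary configuration so that it can be used after the core has been exchanged;
the outer set is recomputed from the new core. -/
theorem connectedBound_of_awv (C : LinkConfig E a b c x y z) (hE : LoosePathFree E)
    (hs : ∀ t ∈ E, #t = 3) (IH : ∀ F : Finset (Finset V), LoosePathFree F → (∀ t ∈ F, #t = 3) →
      #(support F) < #(support E) → #F ≤ edgeBound #(support F))
    {m : ℕ} (hm : #(support E) = m + 6) (h : {a, w, v} ∈ E)
    (hd : [a, b, c, x, y, z, w, v].Nodup) : ConnectedBound E m := by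
  have hsup := subset_support h
  simp only [List.nodup_cons, List.mem_cons, List.not_mem_nil, or_false, not_or] at hd
  rw [← C.card_outer hm]
  refine (C.freeConfig hE hs).connectedBound_of_outer_pair (u := a) (w := w) (w' := v)
    (C.card_inner_le hE hs IH) (Or.inl rfl) ?_ ?_ (by grind) h
  · refine mem_sdiff.2 ⟨hsup (by simp), ?_⟩
    simp only [mem_insert, mem_singleton]; grind
  · refine mem_sdiff.2 ⟨hsup (by simp), ?_⟩
    simp only [mem_insert, mem_singleton]; grind

end LinkConfig

theorem LinkConnected.connectedBound (hc : LinkConnected E) (hE : LoosePathFree E)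
    (hs : ∀ t ∈ E, #t = 3) {e f : Finset V} (he : e ∈ E) (hf : f ∈ E) (hef : Disjoint e f)
    (IH : ∀ F : Finset (Finset V), LoosePathFree F → (∀ t ∈ F, #t = 3) →
      #(support F) < #(support E) → #F ≤ edgeBound #(support F))
    {m : ℕ} (hm : #(support E) = m + 6) (hm1 : 1 ≤ m) : ConnectedBound E m := by
  obtain ⟨a, b, c, x, y, z, C₀⟩ := hc.exists_linkConfig hE hs he hf hef
  have C := C₀.freeConfig hE hs
  have hW := C₀.card_outer hm
  have hin := C₀.card_inner_le hE hs IH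
  set W := support E \ {a, b, c, x, y, z} with hWdef
  by_cases h2 : ∃ u w w', (u = a ∨ u = x) ∧ w ∈ W ∧ w' ∈ W ∧ w ≠ w' ∧ {u, w, w'} ∈ E
  · obtain ⟨u, w, w', hu, hw, hw', hne, h⟩ := h2
    rw [← hW]
    exact C.connectedBound_of_outer_pair hin hu hw hw' hne h
  have h2' : ∀ w ∈ W, ∀ w' ∈ W, w ≠ w' → {a, w, w'} ∉ E ∧ {x, w, w'} ∉ E :=
    fun w hw w' hw' hne => ⟨fun h => h2 ⟨a, w, w', Or.inl rfl, hw, hw', hne, h⟩,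
      fun h => h2 ⟨x, w, w', Or.inr rfl, hw, hw', hne, h⟩⟩
  by_cases h3 : ∃ t ∈ E, t ⊆ W
  -- Connectivity provides an inner edge `k` and an edge `t` not inside `W` that meet. The common
  -- vertex is outer, so `t` is a crossing edge whose outer vertex lies on `k`.
  · obtain ⟨k, hk, t, ht, hkt⟩ := hc (E.filter (· ⊆ W)) (filter_subset _ _)
      (by obtain ⟨t, ht, h⟩ := h3; exact ⟨t, mem_filter.2 ⟨ht, h⟩⟩)
      ⟨{a, b, c}, mem_sdiff.2 ⟨C.abc, fun h => C.disj a ((mem_filter.1 h).2 (by simp)) (by simp)⟩⟩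
    obtain ⟨hkE, hkW⟩ := mem_filter.1 hk
    obtain ⟨htE, ht'⟩ := mem_sdiff.1 ht
    obtain ⟨i, hik, hit⟩ := not_disjoint_iff.1 hkt
    have hiQ := C.disj i (hkW hik)
    have key : ∀ w ∈ W, (∀ i ∈ t, i ∈ ({a, b, c, x, y, z} : Finset V) ∨ i = w) → w ∈ k :=
      fun w hw h => (h i hit).elim (fun h => absurd h hiQ) fun h => h ▸ hik
    have key2 : ∀ w ∈ k, ∃ p q, {w, p, q} ∈ E ∧ [a, b, c, x, y, z, w, p, q].Nodup := by
      intro w hw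
      obtain ⟨p, q, rfl, hp, hq, hpq⟩ := exists_eq_triple (hs k hkE) hw
      exact ⟨p, q, hkE, C.nodup_three (hkW (by simp)) (hkW (by simp)) (hkW (by simp)) hp hq hpq⟩
    rcases C.edge_cases htE with h | ⟨w, hw, rfl | rfl | rfl | rfl⟩ |
      ⟨w, hw, w', hw', hne, rfl | rfl⟩ | h
    · exact absurd (h hit) hiQ
    · have hwk := key w hw (by simp)
      obtain ⟨p, q, hpq, hd⟩ := key2 w hwk
      -- With `w` in place of `a`, the inner edge `wpq` becomes an edge of shape `aww'`.
      refine (C.replace_a (C.nodup_one hw) htE).connectedBound_of_awv hE hs IH hm hpq ?_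
      simp only [List.nodup_cons, List.mem_cons, List.not_mem_nil, or_false, not_or] at hd ⊢; grind
    · have hwk := key w hw (by simp)
      obtain ⟨p, q, hpq, hd⟩ := key2 w hwk
      exact absurd htE (C.notMem_xyw_of_wuv hE hd hpq)
    · have hwk := key w hw (by simp)
      obtain ⟨p, q, hpq, hd⟩ := key2 w hwk
      refine absurd htE (C.swap_yz.notMem_xyw_of_wuv hE ?_ hpq)
      simp only [List.nodup_cons, List.mem_cons, List.not_mem_nil, or_false, not_or] at hd ⊢; grind
    · have hwk := key w hw (by simp)
      obtain ⟨p, q, hpq, hd⟩ := key2 w hwk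
      -- In the core `w, y, z, x, b, c` the inner edge `wpq` again has shape `aww'`.
      refine (C.turn (C.nodup_one hw) htE).connectedBound_of_awv hE hs IH hm hpq ?_
      simp only [List.nodup_cons, List.mem_cons, List.not_mem_nil, or_false, not_or] at hd ⊢; grind
    · exact absurd htE (h2' w hw w' hw' hne).1
    · exact absurd htE (h2' w hw w' hw' hne).2
    · exact absurd (mem_filter.2 ⟨htE, h⟩) ht'
  · rw [← hW]
    refine C.connectedBound_of_outer_le_one (fun t ht htQ => ?_) ?_
    · rcases C.edge_cases ht with h | h | ⟨w, hw, w', hw', hne, rfl | rfl⟩ | h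
      · exact absurd h htQ
      · exact h
      · exact absurd ht (h2' w hw w' hw' hne).1
      · exact absurd ht (h2' w hw w' hw' hne).2
      · exact absurd ⟨t, ht, h⟩ h3
    · obtain ⟨w, hw⟩ := card_pos.1 (by omega : 0 < #W)
      obtain ⟨t, ht, hwt⟩ := mem_support.1 (mem_sdiff.1 hw).1
      exact ⟨t, ht, fun h => C.disj w hw (h hwt)⟩

end ConnectedFamilies

/-! ### The bound by the size of the support, and the split into parts. -/

section EdgeBounds

variable {V : Type*} [DecidableEq V] {E : Finset (Finset V)}

theorem exists_split_of_not_linkConnected (h : ¬ LinkConnected E) :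
    ∃ F ⊆ E, F.Nonempty ∧ (E \ F).Nonempty ∧ Disjoint (support F) (support (E \ F)) := by
  unfold LinkConnected at h
  push Not at h
  obtain ⟨F, hF, h1, h2, h3⟩ := h
  refine ⟨F, hF, h1, h2, disjoint_left.2 fun i hi hi' => ?_⟩
  obtain ⟨s, hs, his⟩ := mem_support.1 hi
  obtain ⟨t, ht, hit⟩ := mem_support.1 hi'
  exact disjoint_left.1 (h3 s hs t ht) his hit

theorem card_support_add (F : Finset (Finset V)) (hF : F ⊆ E)
    (h : Disjoint (support F) (support (E \ F))) :
    #(support F) + #(support (E \ F)) = #(support E) := by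
  rw [← card_union_of_disjoint h]
  congr 1
  ext i
  simp only [mem_union, mem_support, mem_sdiff]
  constructor
  · rintro (⟨t, ht, hi⟩ | ⟨t, ht, hi⟩)
    exacts [⟨t, hF ht, hi⟩, ⟨t, ht.1, hi⟩]
  · rintro ⟨t, ht, hi⟩
    by_cases htF : t ∈ F
    exacts [Or.inl ⟨t, htF, hi⟩, Or.inr ⟨t, ⟨ht, htF⟩, hi⟩]

theorem card_le_choose_support (hs : ∀ t ∈ E, #t = 3) : #E ≤ (#(support E)).choose 3 := by
  rw [← card_powersetCard]
  exact card_le_card fun t ht => mem_powersetCard.2 ⟨subset_support ht, hs t ht⟩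

theorem three_le_card_support (hs : ∀ t ∈ E, #t = 3) (h : E.Nonempty) : 3 ≤ #(support E) := by
  obtain ⟨t, ht⟩ := h
  rw [← hs t ht]
  exact card_le_card (subset_support ht)

/-- The Erdős–Ko–Rado bound on the support of an intersecting family of triples. -/
theorem card_le_of_intersecting (hs : ∀ t ∈ E, #t = 3) (h6 : 6 ≤ #(support E))
    (hint : ∀ s ∈ E, ∀ t ∈ E, ¬ Disjoint s t) : #E ≤ (#(support E) - 1).choose 2 := by
  set n := #(support E) with hn
  -- The support is relabelled by `Fin n`, so that Erdős–Ko–Rado gives a bound in the size of the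
  -- support and not of `V`.
  let ψ : Fin n ↪ V := (support E).equivFin.symm.toEmbedding.trans (Function.Embedding.subtype _)
  have hψ : ∀ v ∈ support E, ∃ i, ψ i = v := fun v hv =>
    ⟨(support E).equivFin ⟨v, hv⟩, by simp [ψ]⟩
  set A : Finset (Finset (Fin n)) := univ.filter fun u => u.map ψ ∈ E with hA
  have himg : E ⊆ A.image fun u => u.map ψ := by
    intro t ht
    refine mem_image.2 ⟨univ.filter fun i => ψ i ∈ t, ?_, ?_⟩
    all_goals
      have hmap : (univ.filter fun i => ψ i ∈ t).map ψ = t := by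
        ext v
        simp only [mem_map, mem_filter, mem_univ, true_and]
        constructor
        · rintro ⟨i, hi, rfl⟩; exact hi
        · intro hv
          obtain ⟨i, rfl⟩ := hψ v (subset_support ht hv)
          exact ⟨i, hv, rfl⟩
    · exact mem_filter.2 ⟨mem_univ _, by rwa [hmap]⟩
    · exact hmap
  refine ((card_le_card himg).trans card_image_le).trans ?_
  refine erdos_ko_rado (r := 3) ?_ ?_ (by omega)
  · intro s hs' t ht' hd
    exact hint _ (mem_filter.1 (mem_coe.1 hs')).2 _ (mem_filter.1 (mem_coe.1 ht')).2
      (disjoint_map ψ |>.2 hd)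
  · intro s hs'
    have := hs _ (mem_filter.1 (mem_coe.1 hs')).2
    rwa [card_map] at this

theorem two_mul_edgeBound {k : ℕ} (hk : 5 ≤ k) : 2 * edgeBound (k + 2) = (k + 1) * k := by
  rw [edgeBound, if_neg (by omega)]
  exact two_mul_choose_two k

/-- The closest competitor is `p = 3`: one edge next to `C(q - 1, 2)` others, against `4 + C(q - 1,
2)` for the comet. For larger `p` the growth of the binomial coefficient more than pays for the
small part. -/
theorem edgeBound_add_lt {p q : ℕ} (hp : 3 ≤ p) (hq : 3 ≤ q) (h : 14 ≤ p + q) :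
    edgeBound p + edgeBound q < 4 + (p + q - 4).choose 2 := by
  wlog hpq : p ≤ q generalizing p q
  · rw [add_comm p q, add_comm (edgeBound p)]
    exact this hq hp (by omega) (by omega)
  obtain ⟨k, rfl⟩ : ∃ k, q = k + 2 := ⟨q - 2, by omega⟩
  have e1 := two_mul_edgeBound (k := k) (by omega)
  have e2 := two_mul_choose_two (p + k - 3)
  have e3 : p + k - 3 + 1 = p + (k + 2) - 4 := by omega
  rw [e3] at e2
  suffices hmain : 2 * edgeBound p + (k + 1) * k < 8 + (p + (k + 2) - 4) * (p + k - 3) by omega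
  rcases le_or_gt p 6 with h6 | h7
  · have hb : 2 * edgeBound p ≤ 2 ∧ p = 3 ∨ 2 * edgeBound p ≤ 8 ∧ p = 4 ∨
        2 * edgeBound p ≤ 20 ∧ p = 5 ∨ 2 * edgeBound p ≤ 40 ∧ p = 6 := by
      have : ∀ p ≤ 6, 3 ≤ p → (2 * edgeBound p ≤ 2 ∧ p = 3 ∨ 2 * edgeBound p ≤ 8 ∧ p = 4 ∨
        2 * edgeBound p ≤ 20 ∧ p = 5 ∨ 2 * edgeBound p ≤ 40 ∧ p = 6) := by decide
      exact this p h6 hp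
    rcases hb with ⟨hb, rfl⟩ | ⟨hb, rfl⟩ | ⟨hb, rfl⟩ | ⟨hb, rfl⟩
    · rw [show 3 + (k + 2) - 4 = k + 1 by omega, show 3 + k - 3 = k by omega]; omega
    · rw [show 4 + (k + 2) - 4 = k + 2 by omega, show 4 + k - 3 = k + 1 by omega]; nlinarith
    · rw [show 5 + (k + 2) - 4 = k + 3 by omega, show 5 + k - 3 = k + 2 by omega]; nlinarith
    · rw [show 6 + (k + 2) - 4 = k + 4 by omega, show 6 + k - 3 = k + 3 by omega]; nlinarith
  · obtain ⟨j, rfl⟩ : ∃ j, p = j + 5 + 2 := ⟨p - 7, by omega⟩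
    obtain ⟨i, rfl⟩ : ∃ i, k = i + 5 := ⟨k - 5, by omega⟩
    rw [two_mul_edgeBound (by omega), show j + 5 + 2 + (i + 5 + 2) - 4 = j + i + 10 by omega,
      show j + 5 + 2 + (i + 5) - 3 = j + i + 9 by omega]
    nlinarith

theorem four_add_choose_le {m : ℕ} : 4 + (m + 2).choose 2 ≤ (m + 5).choose 2 := by
  have e1 : 2 * (m + 2).choose 2 = (m + 2) * (m + 1) := two_mul_choose_two (m + 1)
  have e2 : 2 * (m + 5).choose 2 = (m + 5) * (m + 4) := two_mul_choose_two (m + 4)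
  nlinarith

theorem edgeBound_add_le {p q : ℕ} (hp : 3 ≤ p) (hq : 3 ≤ q) (h : 7 ≤ p + q) :
    edgeBound p + edgeBound q ≤ edgeBound (p + q) := by
  rcases le_or_gt 14 (p + q) with h14 | h14
  · refine (edgeBound_add_lt hp hq h14).le.trans ?_
    have := four_add_choose_le (m := p + q - 6)
    rw [edgeBound, if_neg (by omega)]
    rwa [show p + q - 6 + 2 = p + q - 4 by omega, show p + q - 6 + 5 = p + q - 1 by omega] at this
  · have key : ∀ p ≤ 10, ∀ q ≤ 10, 3 ≤ p ∧ 3 ≤ q ∧ 7 ≤ p + q ∧ p + q < 14 →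
        edgeBound p + edgeBound q ≤ edgeBound (p + q) := by decide
    exact key p (by omega) q (by omega) ⟨hp, hq, h, h14⟩

/-- On seven vertices the generic bound allows 19 edges, more than `C(6, 2) = 15`; this is why
`ConnectedBound` carries the separate field `seven`. -/
theorem ConnectedBound.card_le {m : ℕ} (h : ConnectedBound E m) (hm : 1 ≤ m) :
    #E ≤ (m + 5).choose 2 := by
  rcases le_or_gt m 6 with h6 | h7
  · rcases hm.eq_or_lt with rfl | h1
    · exact h.seven rfl
    · have key : ∀ m ≤ 6, 2 ≤ m → 20 + m.choose 3 ≤ (m + 5).choose 2 := by decide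
      exact (h.small hm h6).le.trans (key m h6 h1)
  · refine le_trans ?_ four_add_choose_le
    rcases h.large h7 with h | h
    exacts [h.le, h.1]

/-- The bound for families without loose paths of length three in terms of the support. -/
theorem card_le_edgeBound (hE : LoosePathFree E) (hs : ∀ t ∈ E, #t = 3) :
    #E ≤ edgeBound #(support E) := by
  induction hn : #(support E) using Nat.strong_induction_on generalizing E with
  | _ n IH =>
    rcases le_or_gt n 6 with h6 | h7
    · rw [edgeBound, if_pos h6, ← hn]
      exact card_le_choose_support hs
    have hb : edgeBound n = (n - 1).choose 2 := by rw [edgeBound, if_neg (by omega)]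
    -- Connected: Erdős–Ko–Rado if all edges meet, otherwise the core count, whose inner edges use
    -- the induction hypothesis. Disconnected: induction on both parts and superadditivity of
    -- `edgeBound`.
    by_cases hc : LinkConnected E
    · rw [hb]
      by_cases hint : ∀ s ∈ E, ∀ t ∈ E, ¬ Disjoint s t
      · rw [← hn]
        exact card_le_of_intersecting hs (by omega) hint
      · push Not at hint
        obtain ⟨e, he, f, hf, hef⟩ := hint
        have := (hc.connectedBound hE hs he hf hef
          (fun F h1 h2 h3 => IH _ (hn ▸ h3) h1 h2 rfl) (m := n - 6) (by omega)
          (by omega)).card_le (by omega)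
        rwa [show n - 6 + 5 = n - 1 by omega] at this
    · obtain ⟨F, hF, h1, h2, h3⟩ := exists_split_of_not_linkConnected hc
      have hadd := card_support_add F hF h3
      have hsF : ∀ t ∈ F, #t = 3 := fun t ht => hs t (hF ht)
      have hsG : ∀ t ∈ E \ F, #t = 3 := fun t ht => hs t (mem_sdiff.1 ht).1
      have g1 := three_le_card_support hsF h1
      have g2 := three_le_card_support hsG h2
      have b1 := IH _ (by omega) (hE.mono hF) hsF rfl
      have b2 := IH _ (by omega) (hE.mono sdiff_subset) hsG rfl
      have b3 := edgeBound_add_le g1 g2 (by omega)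
      rw [hadd, hn] at b3
      have := card_sdiff_add_card_eq_card hF
      omega

/-- All triples inside `A` or inside `B`. -/
def IsTwoCliques (E : Finset (Finset V)) (A B : Finset V) : Prop :=
  ∀ t : Finset V, t ∈ E ↔ #t = 3 ∧ (t ⊆ A ∨ t ⊆ B)

theorem eq_powersetCard_of_card (hs : ∀ t ∈ E, #t = 3) (h : #E = (#(support E)).choose 3) :
    E = (support E).powersetCard 3 := by
  refine eq_of_subset_of_card_le
    (fun t ht => mem_powersetCard.2 ⟨subset_support ht, hs t ht⟩) ?_
  rw [card_powersetCard, h]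

/-- The trichotomy behind all three ranges of `n`: a family on six vertices, a connected family on
more, or two vertex-disjoint parts with their individual bounds. -/
theorem connected_or_split (hE : LoosePathFree E) (hs : ∀ t ∈ E, #t = 3) {e f : Finset V}
    (he : e ∈ E) (hf : f ∈ E) (hef : Disjoint e f) :
    (#(support E) = 6 ∧ #E ≤ 20) ∨
    (∃ m, 1 ≤ m ∧ #(support E) = m + 6 ∧ ConnectedBound E m) ∨
    ∃ F ⊆ E, Disjoint (support F) (support (E \ F)) ∧ 3 ≤ #(support F) ∧
      3 ≤ #(support (E \ F)) ∧ #F ≤ edgeBound #(support F) ∧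
      #(E \ F) ≤ edgeBound #(support (E \ F)) := by
  by_cases hc : LinkConnected E
  · have h6 : 6 ≤ #(support E) := by
      have : #(e ∪ f) = 6 := by rw [card_union_of_disjoint hef, hs e he, hs f hf]
      rw [← this]
      exact card_le_card (union_subset (subset_support he) (subset_support hf))
    rcases h6.eq_or_lt with h | h
    · have := card_le_choose_support hs
      rw [← h] at this
      exact Or.inl ⟨h.symm, this⟩
    · right; left
      exact ⟨#(support E) - 6, by omega, by omega, hc.connectedBound hE hs he hf hef
        (fun F h1 h2 _ => card_le_edgeBound h1 h2) (by omega) (by omega)⟩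
  · right; right
    obtain ⟨F, hF, h1, h2, h3⟩ := exists_split_of_not_linkConnected hc
    have hsF : ∀ t ∈ F, #t = 3 := fun t ht => hs t (hF ht)
    have hsG : ∀ t ∈ E \ F, #t = 3 := fun t ht => hs t (mem_sdiff.1 ht).1
    exact ⟨F, hF, h3, three_le_card_support hsF h1, three_le_card_support hsG h2,
      card_le_edgeBound (hE.mono hF) hsF, card_le_edgeBound (hE.mono sdiff_subset) hsG⟩

end EdgeBounds

/-! ### Cliques and comets: admissibility, size, and the equality cases. -/

section ExtremalFamilies

variable {V : Type*} [DecidableEq V] {E : Finset (Finset V)}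

/-- The comet with center `x` and head `D`. -/
def IsComet (E : Finset (Finset V)) (x : V) (D : Finset V) : Prop :=
  ∀ t : Finset V, t ∈ E ↔ #t = 3 ∧ (t ⊆ insert x D ∨ (x ∈ t ∧ Disjoint t D))

theorem IsTwoCliques.card_eq {A B : Finset V} (h : IsTwoCliques E A B) (hAB : Disjoint A B) :
    #E = (#A).choose 3 + (#B).choose 3 := by
  have hE : E = A.powersetCard 3 ∪ B.powersetCard 3 := by
    ext t
    rw [h t, mem_union, mem_powersetCard, mem_powersetCard]
    tauto
  rw [hE, card_union_of_disjoint, card_powersetCard, card_powersetCard]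
  refine disjoint_left.2 fun t hA hB => ?_
  rw [mem_powersetCard] at hA hB
  have h0 : t = ∅ := by
    rw [← disjoint_self_iff_empty]
    exact disjoint_of_subset_left hA.1 (disjoint_of_subset_right hB.1 hAB)
  rw [h0] at hA
  simp at hA

omit [DecidableEq V] in
theorem IsTwoCliques.symm {A B : Finset V} (h : IsTwoCliques E A B) : IsTwoCliques E B A := by
  intro t
  rw [h t, or_comm]

/-- The edges of a loose path would lie in one clique. Its two disjoint end edges fill the at most
six vertices, so the middle edge would have all three vertices in their union, yet it meets each of
them only once. -/
theorem IsTwoCliques.loosePathFree {A B : Finset V} (h : IsTwoCliques E A B) (hAB : Disjoint A B)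
    (hA : #A ≤ 6) (hB : #B ≤ 6) : LoosePathFree E := by
  have key : ∀ A B : Finset V, IsTwoCliques E A B → Disjoint A B → #A ≤ 6 → ∀ e ∈ E, ∀ f ∈ E,
      ∀ g ∈ E, Disjoint e f → #(g ∩ e) = 1 → #(g ∩ f) = 1 → g ⊆ A → False := by
    intro A B h hAB hA e he f hf g hg hef hge hgf hgA
    have meet : ∀ s ∈ E, #(g ∩ s) = 1 → s ⊆ A := by
      intro s hs h1
      refine (((h s).1 hs).2).resolve_right fun hsB => ?_
      have : g ∩ s = ∅ := disjoint_iff_inter_eq_empty.1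
        (disjoint_of_subset_left hgA (disjoint_of_subset_right hsB hAB))
      rw [this] at h1
      simp at h1
    have hu : #(e ∪ f) = 6 := by
      rw [card_union_of_disjoint hef, ((h e).1 he).1, ((h f).1 hf).1]
    have hUA : e ∪ f = A :=
      eq_of_subset_of_card_le (union_subset (meet e he hge) (meet f hf hgf)) (by omega)
    have h3 : #(g ∩ (e ∪ f)) ≤ 2 := by
      rw [inter_union_distrib_left]
      exact (card_union_le _ _).trans (by omega)
    rw [hUA, inter_eq_left.2 hgA, ((h g).1 hg).1] at h3
    omega
  intro e he f hf g hg hef hge hgf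
  rcases ((h g).1 hg).2 with hgA | hgB
  · exact key A B h hAB hA e he f hf g hg hef hge hgf hgA
  · exact key B A h.symm hAB.symm hB e he f hf g hg hef hge hgf hgB

theorem IsTwoCliques.exists_disjoint {A B : Finset V} (h : IsTwoCliques E A B) (hA : #A = 6) :
    ∃ e ∈ E, ∃ f ∈ E, Disjoint e f := by
  obtain ⟨e, heA, he⟩ := exists_subset_card_eq (show 3 ≤ #A by omega)
  refine ⟨e, (h e).2 ⟨he, Or.inl heA⟩, A \ e, (h _).2 ⟨?_, Or.inl sdiff_subset⟩, disjoint_sdiff⟩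
  rw [card_sdiff_of_subset heA, hA, he]

/-- Of two disjoint edges one misses the center and is therefore the head `D`. No edge meets `D` in
exactly one vertex: triples of the four-clique meet it in at least two, star edges in none. -/
theorem IsComet.loosePathFree {x : V} {D : Finset V} (h : IsComet E x D)
    (hD : #D = 3) : LoosePathFree E := by
  have head : ∀ s ∈ E, x ∉ s → s = D := by
    intro s hs hxs
    obtain ⟨h3, h1 | h1⟩ := (h s).1 hs
    · exact eq_of_subset_of_card_le ((subset_insert_iff_of_notMem hxs).1 h1) (by omega)
    · exact absurd h1.1 hxs
  have inter : ∀ g ∈ E, #(g ∩ D) ≠ 1 := by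
    intro g hg h1
    obtain ⟨h3, h2 | h2⟩ := (h g).1 hg
    · have : #(g \ D) ≤ 1 := by
        rw [← card_singleton x]
        refine card_le_card fun i hi => ?_
        rw [mem_sdiff] at hi
        have := h2 hi.1
        rw [mem_insert] at this
        exact mem_singleton.2 (this.resolve_right hi.2)
      have := card_sdiff_add_card_inter g D
      omega
    · rw [disjoint_iff_inter_eq_empty.1 h2.2] at h1
      simp at h1
  intro e he f hf g hg hef hge hgf
  by_cases hxe : x ∈ e
  · have hxf : x ∉ f := fun hxf => disjoint_left.1 hef hxe hxf
    rw [head f hf hxf] at hgf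
    exact inter g hg hgf
  · rw [head e he hxe] at hge
    exact inter g hg hge

theorem IsComet.card_eq [Fintype V] {x : V} {D : Finset V} (h : IsComet E x D) (hx : x ∉ D)
    (hD : #D = 3) : #E = 4 + (Fintype.card V - 4).choose 2 := by
  have hE : E = (insert x D).powersetCard 3 ∪
      ((insert x D)ᶜ.powersetCard 2).image (insert x) := by
    ext t
    rw [h t, mem_union, mem_powersetCard, mem_image]
    constructor
    · rintro ⟨h3, h1 | ⟨h1, h2⟩⟩
      · exact Or.inl ⟨h1, h3⟩
      · refine Or.inr ⟨t.erase x, mem_powersetCard.2 ⟨fun i hi => ?_, ?_⟩, insert_erase h1⟩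
        · rw [mem_compl, mem_insert, not_or]
          exact ⟨ne_of_mem_erase hi, disjoint_left.1 h2 (mem_of_mem_erase hi)⟩
        · rw [card_erase_of_mem h1, h3]
    · rintro (⟨h1, h3⟩ | ⟨p, hp, rfl⟩)
      · exact ⟨h3, Or.inl h1⟩
      · obtain ⟨hp1, hp2⟩ := mem_powersetCard.1 hp
        have hxp : x ∉ p := fun hxp => by
          have := hp1 hxp
          simp at this
        refine ⟨by rw [card_insert_of_notMem hxp, hp2], Or.inr ⟨mem_insert_self _ _, ?_⟩⟩
        refine disjoint_insert_left.2 ⟨hx, disjoint_left.2 fun i hi hiD => ?_⟩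
        have := hp1 hi
        simp [hiD] at this
  have hdis : Disjoint ((insert x D).powersetCard 3)
      (((insert x D)ᶜ.powersetCard 2).image (insert x)) := by
    refine disjoint_left.2 fun t h1 h2 => ?_
    obtain ⟨p, hp, rfl⟩ := mem_image.1 h2
    obtain ⟨hp1, hp2⟩ := mem_powersetCard.1 hp
    obtain ⟨i, hi⟩ := card_pos.1 (by omega : 0 < #p)
    exact (mem_compl.1 (hp1 hi)) ((mem_powersetCard.1 h1).1 (mem_insert_of_mem hi))
  rw [hE, card_union_of_disjoint hdis, card_powersetCard, card_image_of_injOn,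
    card_powersetCard, card_compl, card_insert_of_notMem hx, hD]
  · rfl
  · intro p hp q hq hpq
    have hp' : x ∉ p := fun hh => by
      have := (mem_powersetCard.1 hp).1 hh
      simp at this
    have hq' : x ∉ q := fun hh => by
      have := (mem_powersetCard.1 hq).1 hh
      simp at this
    rw [← erase_insert hp', ← erase_insert hq']
    exact congrArg (fun s => s.erase x) hpq

theorem IsComet.exists_disjoint [Fintype V] {x : V} {D : Finset V} (h : IsComet E x D)
    (hx : x ∉ D) (hD : #D = 3) (hV : 6 ≤ Fintype.card V) :
    ∃ e ∈ E, ∃ f ∈ E, Disjoint e f := by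
  obtain ⟨p, hp, hp2⟩ := exists_subset_card_eq (show 2 ≤ #(insert x D)ᶜ by
    rw [card_compl, card_insert_of_notMem hx, hD]; omega)
  have hxp : x ∉ p := fun hxp => by
    have := hp hxp
    simp at this
  have hdis : Disjoint (insert x p) D := by
    refine disjoint_insert_left.2 ⟨hx, disjoint_left.2 fun i hi hiD => ?_⟩
    have := hp hi
    simp [hiD] at this
  exact ⟨insert x p, (h _).2 ⟨by rw [card_insert_of_notMem hxp, hp2],
    Or.inr ⟨mem_insert_self _ _, hdis⟩⟩, D, (h _).2 ⟨hD, Or.inl (subset_insert _ _)⟩, hdis⟩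

/-- The full comet on `V` with the same center and head contains `E` and has no more edges than `E`,
so they coincide. -/
theorem IsSubComet.exists_isComet [Fintype V] (h : IsSubComet E) (hs : ∀ t ∈ E, #t = 3)
    (hE : 4 + (Fintype.card V - 4).choose 2 ≤ #E) :
    ∃ x D, x ∉ D ∧ #D = 3 ∧ IsComet E x D := by
  obtain ⟨a, b, c, x, hd, h⟩ := h
  simp only [List.nodup_cons, List.mem_cons, List.not_mem_nil, or_false, not_or] at hd
  have hx : x ∉ ({a, b, c} : Finset V) := by
    simp only [mem_insert, mem_singleton]; grind
  have hD : #({a, b, c} : Finset V) = 3 :=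
    card_eq_three.2 ⟨a, b, c, by grind, by grind, by grind, rfl⟩
  refine ⟨x, {a, b, c}, hx, hD, ?_⟩
  set F : Finset (Finset V) := univ.filter fun t =>
    #t = 3 ∧ (t ⊆ insert x {a, b, c} ∨ (x ∈ t ∧ Disjoint t {a, b, c})) with hF
  have hFc : IsComet F x {a, b, c} := fun t => by rw [hF, mem_filter]; simp
  have hsub : E ⊆ F := by
    intro t ht
    refine (hFc t).2 ⟨hs t ht, (h t ht).imp (fun h1 => h1.trans ?_) fun h1 => ⟨h1.1, ?_⟩⟩
    · rw [disjoint_right]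
      simp only [mem_insert, mem_singleton]
      rintro i (rfl | rfl | rfl)
      exacts [h1.2.1, h1.2.2.1, h1.2.2.2]
    · intro i; simp only [mem_insert, mem_singleton]; tauto
  rw [eq_of_subset_of_card_le hsub (by rw [hFc.card_eq hx hD]; exact hE)]
  exact hFc

theorem isTwoCliques_of_complete {F : Finset (Finset V)} (hF : F ⊆ E)
    (h1 : F = (support F).powersetCard 3) (h2 : E \ F = (support (E \ F)).powersetCard 3) :
    IsTwoCliques E (support F) (support (E \ F)) := by
  intro t
  have e1 : t ∈ F ↔ t ⊆ support F ∧ #t = 3 := by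
    conv_lhs => rw [h1]
    exact mem_powersetCard
  have e2 : t ∈ E \ F ↔ t ⊆ support (E \ F) ∧ #t = 3 := by
    conv_lhs => rw [h2]
    exact mem_powersetCard
  have e3 : t ∈ E ↔ t ∈ F ∨ t ∈ E \ F := by
    rw [← mem_union, union_sdiff_of_subset hF]
  rw [e3, e1, e2]
  tauto

variable [Fintype V]

theorem card_support_le (E : Finset (Finset V)) : #(support E) ≤ Fintype.card V :=
  card_le_univ _

-- A connected family on more than six vertices is strictly below the bound, so equality comes from
-- a complete six-vertex family or from two complete parts whose supports fill `V`.
set_option synthInstance.maxSize 1000 in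
theorem card_le_of_card_le_twelve (hE : LoosePathFree E) (hs : ∀ t ∈ E, #t = 3)
    (hM : ∃ e ∈ E, ∃ f ∈ E, Disjoint e f) (h12 : Fintype.card V ≤ 12) :
    #E ≤ 20 + (Fintype.card V - 6).choose 3 ∧
    (#E = 20 + (Fintype.card V - 6).choose 3 → ∃ A B, Disjoint A B ∧ #A = 6 ∧
      #B = Fintype.card V - 6 ∧ IsTwoCliques E A B) := by
  obtain ⟨e, he, f, hf, hef⟩ := hM
  have hsup := card_support_le E
  set n := Fintype.card V with hn
  rcases connected_or_split hE hs he hf hef with ⟨h6, h20⟩ | ⟨m, hm1, hm, hb⟩ |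
    ⟨F, hF, hdis, hp, hq, hbp, hbq⟩
  · refine ⟨by omega, fun heq => ⟨support E, (support E)ᶜ, disjoint_compl_right, h6, ?_, ?_⟩⟩
    · rw [card_compl, h6]
    -- Equality with only 20 edges forces `n - 6 < 3`, so the second clique is the edgeless set of
    -- remaining vertices.
    · have h0 : (n - 6).choose 3 = 0 := by omega
      have hn8 : n - 6 < 3 := Nat.choose_eq_zero_iff.1 h0
      have hEc : E = (support E).powersetCard 3 :=
        eq_powersetCard_of_card hs (by rw [h6]; exact (by omega : #E = 20))
      intro t
      have e1 : t ∈ E ↔ t ⊆ support E ∧ #t = 3 := by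
        conv_lhs => rw [hEc]
        exact mem_powersetCard
      rw [e1]
      constructor
      · exact fun h => ⟨h.2, Or.inl h.1⟩
      · rintro ⟨h3, h | h⟩
        · exact ⟨h, h3⟩
        · have := card_le_card h
          rw [card_compl, h6] at this
          omega
  · have h1 := hb.small hm1 (by omega)
    have h2 : m.choose 3 ≤ (n - 6).choose 3 := Nat.choose_le_choose 3 (by omega)
    omega
  · have hadd := card_support_add F hF hdis
    have hcard := card_sdiff_add_card_eq_card hF
    have key₁ : ∀ n ≤ 12, ∀ p ≤ 9, ∀ q ≤ 9, 3 ≤ p ∧ 3 ≤ q ∧ p + q ≤ n →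
        edgeBound p + edgeBound q ≤ 20 + (n - 6).choose 3 := by decide
    have key₂ : ∀ n ≤ 12, ∀ p ≤ 9, ∀ q ≤ 9, (3 ≤ p ∧ 3 ≤ q ∧ p + q ≤ n) ∧
        20 + (n - 6).choose 3 ≤ edgeBound p + edgeBound q →
        (p = 6 ∨ q = 6) ∧ p + q = n := by decide
    have hpq : 3 ≤ #(support F) ∧ 3 ≤ #(support (E \ F)) ∧
        #(support F) + #(support (E \ F)) ≤ n := ⟨hp, hq, by omega⟩
    have k1 := key₁ n h12 #(support F) (by omega) #(support (E \ F)) (by omega) hpq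
    have k2 := fun h => key₂ n h12 #(support F) (by omega) #(support (E \ F)) (by omega) ⟨hpq, h⟩
    refine ⟨by omega, fun heq => ?_⟩
    have k3 : #(support F) = 6 ∧ #(support (E \ F)) = n - 6 ∨
        #(support (E \ F)) = 6 ∧ #(support F) = n - 6 := by
      have := k2 (by omega)
      omega
    have hp6 : #(support F) ≤ 6 := by omega
    have hq6 : #(support (E \ F)) ≤ 6 := by omega
    have hbF : #F = edgeBound #(support F) := by omega
    have hbG : #(E \ F) = edgeBound #(support (E \ F)) := by omega
    rw [edgeBound, if_pos hp6] at hbF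
    rw [edgeBound, if_pos hq6] at hbG
    have hT := isTwoCliques_of_complete hF
      (eq_powersetCard_of_card (fun t ht => hs t (hF ht)) hbF)
      (eq_powersetCard_of_card (fun t ht => hs t (mem_sdiff.1 ht).1) hbG)
    rcases k3 with ⟨h1, h2⟩ | ⟨h1, h2⟩
    · exact ⟨_, _, hdis, h1, h2, hT⟩
    · exact ⟨_, _, hdis.symm, h1, h2, hT.symm⟩

theorem edgeBound_add_le_forty {p q : ℕ} (hp : 3 ≤ p) (hq : 3 ≤ q) (h : p + q ≤ 13) :
    edgeBound p + edgeBound q ≤ 40 ∧ (40 ≤ edgeBound p + edgeBound q → p = 6 ∧ q = 6) := by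
  have key : ∀ p ≤ 10, ∀ q ≤ 10, 3 ≤ p ∧ 3 ≤ q ∧ p + q ≤ 13 →
      edgeBound p + edgeBound q ≤ 40 ∧ (40 ≤ edgeBound p + edgeBound q → p = 6 ∧ q = 6) := by
    decide
  exact key p (by omega) q (by omega) ⟨hp, hq, h⟩

/-- The tie: disconnected families reach `40 = 20 + 20` only with two parts of six vertices, which
leaves one vertex uncovered; connected ones reach `40 = 4 + C(9, 2)` only on all 13 vertices, as a
comet. -/
theorem card_le_of_card_eq_thirteen (hE : LoosePathFree E) (hs : ∀ t ∈ E, #t = 3)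
    (hM : ∃ e ∈ E, ∃ f ∈ E, Disjoint e f) (h13 : Fintype.card V = 13) :
    #E ≤ 40 ∧ (#E = 40 → (∃ A B, Disjoint A B ∧ #A = 6 ∧ #B = 6 ∧ IsTwoCliques E A B) ∨
      ∃ x D, x ∉ D ∧ #D = 3 ∧ IsComet E x D) := by
  obtain ⟨e, he, f, hf, hef⟩ := hM
  have hsup := card_support_le E
  rcases connected_or_split hE hs he hf hef with ⟨h6, h20⟩ | ⟨m, hm1, hm, hb⟩ |
    ⟨F, hF, hdis, hp, hq, hbp, hbq⟩
  · omega
  · rcases le_or_gt m 6 with h6 | h7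
    · have h1 := hb.small hm1 h6
      have h2 : m.choose 3 ≤ Nat.choose 6 3 := Nat.choose_le_choose 3 h6
      have h3 : Nat.choose 6 3 = 20 := rfl
      omega
    · obtain rfl : m = 7 := by omega
      have h3 : Nat.choose (7 + 2) 2 = 36 := rfl
      rcases hb.large le_rfl with h1 | ⟨h1, h2⟩
      · omega
      · refine ⟨by omega, fun heq => Or.inr (h2.exists_isComet hs ?_)⟩
        rw [h13, heq]
        exact le_of_eq rfl
  · have hadd := card_support_add F hF hdis
    have hcard := card_sdiff_add_card_eq_card hF
    obtain ⟨k1, k2⟩ := edgeBound_add_le_forty hp hq (by omega)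
    refine ⟨by omega, fun heq => Or.inl ?_⟩
    obtain ⟨h1, h2⟩ := k2 (by omega)
    have hbF : #F = edgeBound #(support F) := by omega
    have hbG : #(E \ F) = edgeBound #(support (E \ F)) := by omega
    rw [edgeBound, if_pos (by omega)] at hbF hbG
    exact ⟨_, _, hdis, h1, h2, isTwoCliques_of_complete hF
      (eq_powersetCard_of_card (fun t ht => hs t (hF ht)) hbF)
      (eq_powersetCard_of_card (fun t ht => hs t (mem_sdiff.1 ht).1) hbG)⟩

/-- The bound is now at least `4 + C(10, 2) = 49`, so disconnected families on at most 13 vertices,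
which have at most 40 edges, drop out; those on 14 or more fall to `edgeBound_add_lt`. -/
theorem card_le_of_fourteen_le_card (hE : LoosePathFree E) (hs : ∀ t ∈ E, #t = 3)
    (hM : ∃ e ∈ E, ∃ f ∈ E, Disjoint e f) (h14 : 14 ≤ Fintype.card V) :
    #E ≤ 4 + (Fintype.card V - 4).choose 2 ∧ (#E = 4 + (Fintype.card V - 4).choose 2 →
      ∃ x D, x ∉ D ∧ #D = 3 ∧ IsComet E x D) := by
  obtain ⟨e, he, f, hf, hef⟩ := hM
  have hsup := card_support_le E
  have h45 : Nat.choose 10 2 ≤ (Fintype.card V - 4).choose 2 := Nat.choose_le_choose 2 (by omega)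
  have h45' : Nat.choose 10 2 = 45 := rfl
  rcases connected_or_split hE hs he hf hef with ⟨h6, h20⟩ | ⟨m, hm1, hm, hb⟩ |
    ⟨F, hF, hdis, hp, hq, hbp, hbq⟩
  · omega
  · rcases le_or_gt m 6 with h6 | h7
    · have h1 := hb.small hm1 h6
      have h2 : m.choose 3 ≤ Nat.choose 6 3 := Nat.choose_le_choose 3 h6
      have h3 : Nat.choose 6 3 = 20 := rfl
      omega
    · have h3 : (m + 2).choose 2 ≤ (Fintype.card V - 4).choose 2 :=
        Nat.choose_le_choose 2 (by omega)
      rcases hb.large h7 with h1 | ⟨h1, h2⟩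
      · omega
      · exact ⟨by omega, fun heq => h2.exists_isComet hs heq.ge⟩
  · have hadd := card_support_add F hF hdis
    have hcard := card_sdiff_add_card_eq_card hF
    rcases le_or_gt 14 (#(support F) + #(support (E \ F))) with h1 | h1
    · have h2 := edgeBound_add_lt hp hq h1
      have h3 : (#(support F) + #(support (E \ F)) - 4).choose 2 ≤
          (Fintype.card V - 4).choose 2 := Nat.choose_le_choose 2 (by omega)
      omega
    · have := (edgeBound_add_le_forty hp hq (by omega)).1
      omega

end ExtremalFamilies

/-! ### Isomorphism through vertex colorings. -/

section Colorings

theorem exists_equiv_of_card_fiber_eq {V U κ : Type*} [Fintype V] [Fintype U] [DecidableEq κ]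
    (c : V → κ) (c' : U → κ) (h : ∀ i, #(univ.filter fun v => c v = i) =
      #(univ.filter fun u => c' u = i)) : ∃ e : V ≃ U, ∀ v, c' (e v) = c v := by
  have hcard : ∀ i, Nonempty ({v // c v = i} ≃ {u // c' u = i}) := fun i =>
    ⟨Fintype.equivOfCardEq (by rw [Fintype.card_subtype, Fintype.card_subtype, h i])⟩
  refine ⟨(Equiv.sigmaFiberEquiv c).symm.trans
    ((Equiv.sigmaCongrRight fun i => (hcard i).some).trans (Equiv.sigmaFiberEquiv c')), fun v => ?_⟩
  exact ((hcard (c v)).some ⟨v, rfl⟩).2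

/-- Whether a triple is an edge depends only on the set of colors of its vertices. -/
def ColorDefined {V κ : Type*} [DecidableEq κ] (E : Finset (Finset V)) (c : V → κ)
    (P : Finset κ → Prop) : Prop :=
  ∀ t : Finset V, t ∈ E ↔ #t = 3 ∧ P (t.image c)

namespace KGraph

/-- A color-preserving bijection exists as soon as the color classes have equal sizes, and it
preserves edges because they are determined by colors. -/
theorem iso_of_colorDefined {V U κ : Type*} [Fintype V] [Fintype U] [DecidableEq κ]
    {H : KGraph 3 V} {K : KGraph 3 U} {c : V → κ} {c' : U → κ} {P : Finset κ → Prop}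
    (hH : ColorDefined H.edges c P) (hK : ColorDefined K.edges c' P)
    (h : ∀ i, #(univ.filter fun v => c v = i) = #(univ.filter fun u => c' u = i)) : H.Iso K := by
  obtain ⟨e, he⟩ := exists_equiv_of_card_fiber_eq c c' h
  refine ⟨e, fun t => ?_⟩
  classical
  rw [hH t, hK (t.map e.toEmbedding), card_map, Finset.map_eq_image, Finset.image_image]
  have : c' ∘ e.toEmbedding = c := funext he
  rw [this]

theorem Iso.colorDefined {V U κ : Type*} [Fintype V] [Fintype U] [DecidableEq κ]
    {H : KGraph 3 V} {K : KGraph 3 U} {c' : U → κ} {P : Finset κ → Prop}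
    (hi : H.Iso K) (hK : ColorDefined K.edges c' P) :
    ∃ c : V → κ, ColorDefined H.edges c P ∧
      ∀ i, #(univ.filter fun v => c v = i) = #(univ.filter fun u => c' u = i) := by
  obtain ⟨e, he⟩ := hi
  refine ⟨c' ∘ e, fun t => ?_, fun i => ?_⟩
  · classical
    rw [he t, hK (t.map e.toEmbedding), card_map, Finset.map_eq_image, Finset.image_image]
    rfl
  · rw [← card_map e.toEmbedding]
    congr 1
    ext u
    simp only [mem_map_equiv, mem_filter, mem_univ, true_and, Function.comp, Equiv.apply_symm_apply]

/-- A copy of `P` is the same as two disjoint edges and a third meeting each in one vertex; the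
third vertex of the middle edge lies on neither. -/
theorem free_pathP_iff {V : Type*} [DecidableEq V] (H : KGraph 3 V) :
    H.Free pathP ↔ LoosePathFree H.edges := by
  constructor
  · intro h e he f hf g hg hef hge hgf
    obtain ⟨r, hr⟩ := card_eq_one.1 hge
    obtain ⟨t, ht⟩ := card_eq_one.1 hgf
    have hre : r ∈ g ∩ e := by rw [hr]; exact mem_singleton_self r
    have htf : t ∈ g ∩ f := by rw [ht]; exact mem_singleton_self t
    have hre' : ∀ i ∈ g, i ∈ e → i = r := fun i h1 h2 =>
      mem_singleton.1 (hr ▸ mem_inter.2 ⟨h1, h2⟩)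
    have htf' : ∀ i ∈ g, i ∈ f → i = t := fun i h1 h2 =>
      mem_singleton.1 (ht ▸ mem_inter.2 ⟨h1, h2⟩)
    have hdis : ∀ i ∈ e, i ∉ f := fun i hi hi' => disjoint_left.1 hef hi hi'
    rw [mem_inter] at hre htf
    obtain ⟨p, q, rfl, hrp, hrq, hpq⟩ := exists_eq_triple (H.sized he) hre.2
    obtain ⟨u, v, rfl, htu, htv, huv⟩ := exists_eq_triple (H.sized hf) htf.2
    have hg3 : #(g.erase r) = 2 := by rw [card_erase_of_mem hre.1, H.sized hg]
    have hrt : r ≠ t := fun h => hdis r hre.2 (h ▸ htf.2)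
    have htg : t ∈ g.erase r := mem_erase.2 ⟨hrt.symm, htf.1⟩
    obtain ⟨s, hs⟩ := card_eq_one.1 (show #((g.erase r).erase t) = 1 by
      rw [card_erase_of_mem htg, hg3])
    have hsg : s ∈ (g.erase r).erase t := by rw [hs]; exact mem_singleton_self s
    have hgeq : g = {r, s, t} := by
      rw [← insert_erase hre.1, ← insert_erase htg, hs, pair_comm]
    have hst := ne_of_mem_erase hsg
    have hsr := ne_of_mem_erase (mem_of_mem_erase hsg)
    have hse := hre' s (mem_of_mem_erase (mem_of_mem_erase hsg))
    have hsf := htf' s (mem_of_mem_erase (mem_of_mem_erase hsg))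
    subst hgeq
    simp only [mem_insert, mem_singleton] at hdis hse hsf
    have hd : [p, q, r, s, t, u, v].Nodup := by
      simp only [List.nodup_cons, List.mem_cons, List.not_mem_nil, or_false, not_or]
      grind
    refine h ⟨⟨[p, q, r, s, t, u, v].get, List.nodup_iff_injective_get.1 hd⟩, ?_⟩
    simp only [pathP, mem_insert, mem_singleton]
    rintro w (rfl | rfl | rfl)
    · simpa [Finset.map_insert] using (by rwa [← triple_rotate] : {p, q, r} ∈ H.edges)
    · simpa [Finset.map_insert] using hg
    · simpa [Finset.map_insert] using hf
  · rintro h ⟨f, hf⟩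
    have h0 := hf {0, 1, 2} (by simp [pathP])
    have h1 := hf {2, 3, 4} (by simp [pathP])
    have h2 := hf {4, 5, 6} (by simp [pathP])
    refine h _ h0 _ h2 _ h1 ?_ ?_ ?_
    · rw [disjoint_map]; decide
    · rw [← map_inter, card_map]; decide
    · rw [← map_inter, card_map]; decide

theorem contains_matchingM_iff {V : Type*} [DecidableEq V] (H : KGraph 3 V) :
    H.Contains matchingM ↔ ∃ e ∈ H.edges, ∃ f ∈ H.edges, Disjoint e f := by
  constructor
  · rintro ⟨f, hf⟩
    refine ⟨_, hf {0, 1, 2} (by simp [matchingM]), _, hf {3, 4, 5} (by simp [matchingM]), ?_⟩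
    rw [disjoint_map]; decide
  · rintro ⟨e, he, f, hf, hef⟩
    obtain ⟨p, q, r, hpq, hpr, hqr, rfl⟩ := card_eq_three.1 (H.sized he)
    obtain ⟨u, v, w, huv, huw, hvw, rfl⟩ := card_eq_three.1 (H.sized hf)
    have hdis : ∀ i ∈ ({p, q, r} : Finset V), i ∉ ({u, v, w} : Finset V) :=
      fun i hi hi' => disjoint_left.1 hef hi hi'
    simp only [mem_insert, mem_singleton] at hdis
    have hd : [p, q, r, u, v, w].Nodup := by
      simp only [List.nodup_cons, List.mem_cons, List.not_mem_nil, or_false, not_or]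
      grind
    refine ⟨⟨[p, q, r, u, v, w].get, List.nodup_iff_injective_get.1 hd⟩, ?_⟩
    simp only [matchingM, mem_insert, mem_singleton]
    rintro t (rfl | rfl)
    · simpa [Finset.map_insert] using he
    · simpa [Finset.map_insert] using hf

theorem condEx_eq {k n N : ℕ} {U W : Type*} {F : KGraph k U} {G : KGraph k W}
    (hle : ∀ H : KGraph k (Fin n), H.Free F → H.Contains G → #H.edges ≤ N)
    (H : KGraph k (Fin n)) (hF : H.Free F) (hG : H.Contains G) (hN : #H.edges = N) :
    condEx n F G = N := by
  refine IsGreatest.csSup_eq ⟨⟨H, hF, hG, hN⟩, ?_⟩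
  rintro m ⟨H, hF, hG, rfl⟩
  exact hle H hF hG

end KGraph

/-- The color sets of the edges of two disjoint cliques with colors `0` and `1`. -/
def CliqueColors (s : Finset (Fin 3)) : Prop := s ⊆ {0} ∨ s ⊆ {1}

/-- The color sets of the edges of a comet whose center has color `0` and whose head has
color `1`. -/
def CometColors (s : Finset (Fin 3)) : Prop := s ⊆ {0, 1} ∨ (0 ∈ s ∧ 1 ∉ s)

variable {V : Type*} [Fintype V] [DecidableEq V] {E : Finset (Finset V)}

omit [DecidableEq V] in
theorem ColorDefined.isTwoCliques {c : V → Fin 3} (h : ColorDefined E c CliqueColors) :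
    IsTwoCliques E (univ.filter fun v => c v = 0) (univ.filter fun v => c v = 1) := by
  intro t
  rw [h t, CliqueColors]
  simp only [forall_mem_image, mem_singleton, subset_iff, mem_filter, mem_univ, true_and]

theorem IsTwoCliques.colorDefined {A B : Finset V} (h : IsTwoCliques E A B) (hAB : Disjoint A B) :
    ∃ c : V → Fin 3, ColorDefined E c CliqueColors ∧ #(univ.filter fun v => c v = 0) = #A ∧
      #(univ.filter fun v => c v = 1) = #B := by
  have hc0 : ∀ v, (if v ∈ A then (0 : Fin 3) else if v ∈ B then 1 else 2) = 0 ↔ v ∈ A := by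
    intro v; split_ifs <;> simp_all
  have hc1 : ∀ v, (if v ∈ A then (0 : Fin 3) else if v ∈ B then 1 else 2) = 1 ↔ v ∈ B := by
    intro v
    have : v ∈ A → v ∉ B := fun h1 h2 => disjoint_left.1 hAB h1 h2
    split_ifs <;> simp_all
  refine ⟨fun v => if v ∈ A then 0 else if v ∈ B then 1 else 2, fun t => ?_, ?_, ?_⟩
  · rw [h t, CliqueColors]
    simp only [forall_mem_image, mem_singleton, subset_iff, hc0, hc1]
  · congr 1; ext v; simp only [mem_filter, mem_univ, true_and, hc0]
  · congr 1; ext v; simp only [mem_filter, mem_univ, true_and, hc1]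

theorem ColorDefined.isComet {c : V → Fin 3} (h : ColorDefined E c CometColors)
    (h0 : #(univ.filter fun v => c v = 0) = 1) (h1 : #(univ.filter fun v => c v = 1) = 3) :
    ∃ x D, x ∉ D ∧ #D = 3 ∧ IsComet E x D := by
  obtain ⟨x, hx⟩ := card_eq_one.1 h0
  have hx' : ∀ v, c v = 0 ↔ v = x := by
    intro v
    simpa using congrArg (v ∈ ·) hx
  refine ⟨x, univ.filter fun v => c v = 1, ?_, h1, fun t => ?_⟩
  · simp [(hx' x).2 rfl]
  · rw [h t, CometColors]
    simp only [subset_iff, forall_mem_image]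
    simp only [mem_insert, mem_singleton, mem_filter, mem_univ,
      true_and, mem_image, hx', disjoint_left, exists_eq_right, not_exists, not_and]

theorem IsComet.colorDefined {x : V} {D : Finset V} (h : IsComet E x D) (hx : x ∉ D) :
    ∃ c : V → Fin 3, ColorDefined E c CometColors ∧ #(univ.filter fun v => c v = 0) = 1 ∧
      #(univ.filter fun v => c v = 1) = #D := by
  have hc0 : ∀ v, (if v = x then (0 : Fin 3) else if v ∈ D then 1 else 2) = 0 ↔ v = x := by
    intro v; split_ifs <;> simp_all
  have hc1 : ∀ v, (if v = x then (0 : Fin 3) else if v ∈ D then 1 else 2) = 1 ↔ v ∈ D := by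
    intro v
    split_ifs <;> simp_all
  refine ⟨fun v => if v = x then 0 else if v ∈ D then 1 else 2, fun t => ?_, ?_, ?_⟩
  · rw [h t, CometColors]
    simp only [subset_iff, forall_mem_image]
    simp only [mem_insert, mem_singleton, hc0, hc1, mem_image,
      disjoint_left, exists_eq_right, not_exists, not_and]
  · rw [card_eq_one]; exact ⟨x, by ext v; simp only [mem_filter, mem_univ, true_and, hc0, mem_singleton]⟩
  · congr 1; ext v; simp only [mem_filter, mem_univ, true_and, hc1]

omit [DecidableEq V] in
-- Color 2 marks the leftover vertices, so its class size follows from the total.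
theorem card_fiber_eq_of_two {U : Type*} [Fintype U] {c : V → Fin 3} {c' : U → Fin 3}
    (hVU : Fintype.card V = Fintype.card U)
    (h0 : #(univ.filter fun v => c v = 0) = #(univ.filter fun u => c' u = 0))
    (h1 : #(univ.filter fun v => c v = 1) = #(univ.filter fun u => c' u = 1)) (i : Fin 3) :
    #(univ.filter fun v => c v = i) = #(univ.filter fun u => c' u = i) := by
  have e := card_eq_sum_card_fiberwise (s := (univ : Finset V)) (t := univ) (f := c) (by simp)
  have e' := card_eq_sum_card_fiberwise (s := (univ : Finset U)) (t := univ) (f := c') (by simp)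
  rw [Fin.sum_univ_three, card_univ] at e e'
  fin_cases i
  · exact h0
  · exact h1
  · show #(univ.filter fun v => c v = 2) = #(univ.filter fun u => c' u = 2)
    omega

end Colorings

/-! ### The extremal hypergraphs up to isomorphism, and the theorem. -/

section Isomorphisms

namespace KGraph

/-- Value and extremal family follow together from an upper bound whose equality case is `Q`, the
fact that `Q` implies admissibility and equality, and one example. -/
theorem condEx_and_condExtremal {k n N : ℕ} {U W : Type*} {F : KGraph k U} {G : KGraph k W}
    {Q : KGraph k (Fin n) → Prop}
    (hle : ∀ H : KGraph k (Fin n), H.Free F → H.Contains G →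
      #H.edges ≤ N ∧ (#H.edges = N → Q H))
    (hQ : ∀ H : KGraph k (Fin n), Q H → H.Free F ∧ H.Contains G ∧ #H.edges = N)
    (hex : ∃ H : KGraph k (Fin n), Q H) :
    condEx n F G = N ∧ ∀ H : KGraph k (Fin n), H ∈ condExtremal n F G ↔ Q H := by
  obtain ⟨H₀, h₀⟩ := hex
  obtain ⟨hF, hG, hN⟩ := hQ H₀ h₀
  have hN' : condEx n F G = N := condEx_eq (fun H h1 h2 => (hle H h1 h2).1) H₀ hF hG hN
  refine ⟨hN', fun H => ⟨fun ⟨h1, h2, h3⟩ => (hle H h1 h2).2 (h3.trans hN'), fun h => ?_⟩⟩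
  obtain ⟨h1, h2, h3⟩ := hQ H h
  exact ⟨h1, h2, h3.trans hN'.symm⟩

theorem exists_iso {U : Type*} [Fintype U] (K : KGraph 3 U) {n : ℕ} (h : Fintype.card U = n) :
    ∃ H : KGraph 3 (Fin n), H.Iso K := by
  classical
  have e : U ≃ Fin n := Fintype.equivFinOfCardEq h
  refine ⟨⟨univ.filter fun t => t.map e.symm.toEmbedding ∈ K.edges, fun t ht => ?_⟩, e.symm,
    fun t => by simp⟩
  rw [← card_map e.symm.toEmbedding]
  exact K.sized (mem_filter.1 (mem_coe.1 ht)).2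

theorem mem_disjUnion {U V : Type*} [DecidableEq U] [DecidableEq V] (F : KGraph 3 U)
    (H : KGraph 3 V) (t : Finset (U ⊕ V)) : t ∈ (F.disjUnion H).edges ↔
      (t.toLeft ∈ F.edges ∧ t.toRight = ∅) ∨ (t.toRight ∈ H.edges ∧ t.toLeft = ∅) := by
  simp only [disjUnion, mem_union, mem_image]
  refine or_congr ⟨?_, fun h => ⟨t.toLeft, h.1, ?_⟩⟩ ⟨?_, fun h => ⟨t.toRight, h.1, ?_⟩⟩
  · rintro ⟨d, hd, rfl⟩
    have h1 : (d.map Function.Embedding.inl : Finset (U ⊕ V)).toLeft = d := by ext; simp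
    have h2 : (d.map Function.Embedding.inl : Finset (U ⊕ V)).toRight = ∅ := by ext; simp
    rw [h1, h2]; exact ⟨hd, rfl⟩
  · have := t.toLeft_disjSum_toRight
    rwa [h.2, disjSum_empty] at this
  · rintro ⟨d, hd, rfl⟩
    have h1 : (d.map Function.Embedding.inr : Finset (U ⊕ V)).toRight = d := by ext; simp
    have h2 : (d.map Function.Embedding.inr : Finset (U ⊕ V)).toLeft = ∅ := by ext; simp
    rw [h1, h2]; exact ⟨hd, rfl⟩
  · have := t.toLeft_disjSum_toRight
    rwa [h.2, empty_disjSum] at this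

theorem mem_complete {m : ℕ} (t : Finset (Fin m)) : t ∈ (complete 3 m).edges ↔ #t = 3 := by
  simp [complete, mem_powersetCard]

theorem toLeft_eq_empty_iff {U V : Type*} (t : Finset (U ⊕ V)) :
    t.toLeft = ∅ ↔ ∀ u, Sum.inl u ∉ t := by
  rw [eq_empty_iff_forall_notMem]; simp

theorem toRight_eq_empty_iff {U V : Type*} (t : Finset (U ⊕ V)) :
    t.toRight = ∅ ↔ ∀ v, Sum.inr v ∉ t := by
  rw [eq_empty_iff_forall_notMem]; simp

theorem colorDefined_two_complete (k m : ℕ) :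
    ColorDefined ((complete 3 k).disjUnion (complete 3 m)).edges
      (Sum.elim (fun _ => (0 : Fin 3)) fun _ => 1) CliqueColors := by
  intro t
  rw [mem_disjUnion, mem_complete, mem_complete, CliqueColors]
  have hc : #t.toLeft + #t.toRight = #t := card_toLeft_add_card_toRight
  have e1 : t.image (Sum.elim (fun _ => (0 : Fin 3)) fun _ => 1) ⊆ {0} ↔ t.toRight = ∅ := by
    rw [toRight_eq_empty_iff]
    simp only [subset_iff, forall_mem_image]
    simp
  have e2 : t.image (Sum.elim (fun _ => (0 : Fin 3)) fun _ => 1) ⊆ {1} ↔ t.toLeft = ∅ := by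
    rw [toLeft_eq_empty_iff]
    simp only [subset_iff, forall_mem_image]
    simp
  rw [e1, e2]
  rw [← card_eq_zero, ← card_eq_zero]
  omega

/-- The isolated vertex receives color 2, which no edge of the two cliques uses. -/
theorem colorDefined_disjUnion_complete_one {U : Type*} [DecidableEq U] {K : KGraph 3 U}
    {c : U → Fin 3} (hK : ColorDefined K.edges c CliqueColors) :
    ColorDefined (K.disjUnion (complete 3 1)).edges (Sum.elim c fun _ => 2) CliqueColors := by
  intro t
  rw [mem_disjUnion, mem_complete, hK]
  have hc : #t.toLeft + #t.toRight = #t := card_toLeft_add_card_toRight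
  have hr : #t.toRight ≤ 1 := (card_le_univ _).trans (by simp)
  have e : ∀ i : Fin 3, i ≠ 2 → (t.image (Sum.elim c fun _ => 2) ⊆ {i} ↔
      t.toLeft.image c ⊆ {i} ∧ t.toRight = ∅) := by
    intro i hi
    rw [toRight_eq_empty_iff]
    simp only [subset_iff, forall_mem_image]
    simp [hi.symm]
  rw [CliqueColors, CliqueColors, e 0 (by decide), e 1 (by decide)]
  constructor
  · rintro (⟨⟨h1, h2⟩, h3⟩ | ⟨h1, -⟩)
    · have : #t.toRight = 0 := by rw [h3, card_empty]
      exact ⟨by omega, h2.imp (fun h => ⟨h, h3⟩) fun h => ⟨h, h3⟩⟩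
    · omega
  · rintro ⟨h1, h2⟩
    have h3 : t.toRight = ∅ := h2.elim (fun h => h.2) fun h => h.2
    have : #t.toRight = 0 := by rw [h3, card_empty]
    exact Or.inl ⟨⟨by omega, h2.imp (fun h => h.1) fun h => h.1⟩, h3⟩

theorem isComet_comet {n : ℕ} (hn : 4 ≤ n) :
    IsComet (comet n).edges (⟨0, by omega⟩ : Fin n)
      {⟨1, by omega⟩, ⟨2, by omega⟩, ⟨3, by omega⟩} := by
  intro t
  simp only [comet, mem_filter, mem_powersetCard, subset_univ, true_and]
  refine and_congr_right fun _ => or_congr ?_ (and_congr ?_ ?_)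
  · refine forall₂_congr fun v _ => ?_
    simp only [mem_insert, mem_singleton, Fin.ext_iff]
    omega
  · constructor
    · rintro ⟨v, hv, h0⟩
      have : v = ⟨0, by omega⟩ := Fin.ext h0
      exact this ▸ hv
    · exact fun h => ⟨_, h, rfl⟩
  · rw [disjoint_left]
    refine forall₂_congr fun v _ => not_congr ?_
    simp only [mem_insert, mem_singleton, Fin.ext_iff, Finset.mem_Icc]
    omega

theorem iso_of_isComet {V U : Type*} [Fintype V] [DecidableEq V] [Fintype U]
    [DecidableEq U] {H : KGraph 3 V} {K : KGraph 3 U} {x : V} {D : Finset V} {y : U} {D' : Finset U}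
    (hH : IsComet H.edges x D) (hx : x ∉ D) (hK : IsComet K.edges y D') (hy : y ∉ D')
    (hD : #D = #D') (hVU : Fintype.card V = Fintype.card U) : H.Iso K := by
  obtain ⟨c, h1, h2, h3⟩ := hH.colorDefined hx
  obtain ⟨c', h1', h2', h3'⟩ := hK.colorDefined hy
  exact iso_of_colorDefined h1 h1' (card_fiber_eq_of_two hVU (h2.trans h2'.symm)
    (by rw [h3, h3', hD]))

theorem iso_comet_iff {n : ℕ} (hn : 4 ≤ n) (H : KGraph 3 (Fin n)) :
    H.Iso (comet n) ↔ ∃ x D, x ∉ D ∧ #D = 3 ∧ IsComet H.edges x D := by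
  have hx : (⟨0, by omega⟩ : Fin n) ∉
      ({⟨1, by omega⟩, ⟨2, by omega⟩, ⟨3, by omega⟩} : Finset (Fin n)) := by
    simp
  have hD : #({⟨1, by omega⟩, ⟨2, by omega⟩, ⟨3, by omega⟩} : Finset (Fin n)) = 3 :=
    card_eq_three.2 ⟨_, _, _, by simp, by simp, by simp, rfl⟩
  constructor
  · intro h
    obtain ⟨c', h1, h2, h3⟩ := (isComet_comet hn).colorDefined hx
    obtain ⟨c, hc, hcard⟩ := h.colorDefined h1
    exact hc.isComet ((hcard 0).trans h2) ((hcard 1).trans (h3.trans hD))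
  · rintro ⟨x, D, hxD, hD3, h⟩
    exact iso_of_isComet h hxD (isComet_comet hn) hx (hD3.trans hD.symm) rfl

theorem iso_cliques_iff {n : ℕ} {U : Type*} [Fintype U] {K : KGraph 3 U} {c' : U → Fin 3}
    (hK : ColorDefined K.edges c' CliqueColors) (hU : Fintype.card U = n) (H : KGraph 3 (Fin n)) :
    H.Iso K ↔ ∃ A B, Disjoint A B ∧ #A = #(univ.filter fun u => c' u = 0) ∧
      #B = #(univ.filter fun u => c' u = 1) ∧ IsTwoCliques H.edges A B := by
  constructor
  · intro h
    obtain ⟨c, hc, hcard⟩ := h.colorDefined hK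
    refine ⟨_, _, ?_, hcard 0, hcard 1, hc.isTwoCliques⟩
    refine disjoint_left.2 fun v h0 h1 => ?_
    rw [mem_filter] at h0 h1
    exact absurd (h0.2.symm.trans h1.2) (by decide)
  · rintro ⟨A, B, hAB, hA, hB, h⟩
    obtain ⟨c, h1, h2, h3⟩ := h.colorDefined hAB
    exact iso_of_colorDefined h1 hK (card_fiber_eq_of_two (by rw [Fintype.card_fin, hU])
      (h2.trans hA) (h3.trans hB))

theorem iso_two_complete_iff {n : ℕ} (hn : 6 ≤ n) (H : KGraph 3 (Fin n)) :
    H.Iso ((complete 3 6).disjUnion (complete 3 (n - 6))) ↔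
      ∃ A B, Disjoint A B ∧ #A = 6 ∧ #B = n - 6 ∧ IsTwoCliques H.edges A B := by
  rw [iso_cliques_iff (colorDefined_two_complete 6 (n - 6)) (by simp; omega)]
  have h0 : #(univ.filter fun u : Fin 6 ⊕ Fin (n - 6) =>
      Sum.elim (fun _ => (0 : Fin 3)) (fun _ => 1) u = 0) = 6 := by
    rw [card_filter, Fintype.sum_sum_type]; simp
  have h1 : #(univ.filter fun u : Fin 6 ⊕ Fin (n - 6) =>
      Sum.elim (fun _ => (0 : Fin 3)) (fun _ => 1) u = 1) = n - 6 := by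
    rw [card_filter, Fintype.sum_sum_type]; simp
  rw [h0, h1]

theorem iso_two_complete_six_iff (H : KGraph 3 (Fin 13)) :
    H.Iso (((complete 3 6).disjUnion (complete 3 6)).disjUnion (complete 3 1)) ↔
      ∃ A B, Disjoint A B ∧ #A = 6 ∧ #B = 6 ∧ IsTwoCliques H.edges A B := by
  rw [iso_cliques_iff (colorDefined_disjUnion_complete_one (colorDefined_two_complete 6 6))
    (by simp)]
  rfl

theorem isTwoCliques_spec {n k : ℕ} (hk : k ≤ 6) {H : KGraph 3 (Fin n)}
    (h : ∃ A B, Disjoint A B ∧ #A = 6 ∧ #B = k ∧ IsTwoCliques H.edges A B) :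
    H.Free pathP ∧ H.Contains matchingM ∧ #H.edges = 20 + k.choose 3 := by
  obtain ⟨A, B, hAB, hA, hB, h⟩ := h
  refine ⟨(free_pathP_iff H).2 (h.loosePathFree hAB hA.le (hB.trans_le hk)),
    (contains_matchingM_iff H).2 (h.exists_disjoint hA), ?_⟩
  rw [h.card_eq hAB, hA, hB]
  rfl

theorem isComet_spec {n : ℕ} (hn : 6 ≤ n) {H : KGraph 3 (Fin n)}
    (h : ∃ x D, x ∉ D ∧ #D = 3 ∧ IsComet H.edges x D) :
    H.Free pathP ∧ H.Contains matchingM ∧ #H.edges = 4 + (n - 4).choose 2 := by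
  obtain ⟨x, D, hx, hD, h⟩ := h
  refine ⟨(free_pathP_iff H).2 (h.loosePathFree hD),
    (contains_matchingM_iff H).2 (h.exists_disjoint hx hD (by rwa [Fintype.card_fin])), ?_⟩
  rw [h.card_eq hx hD, Fintype.card_fin]

end KGraph

end Isomorphisms

theorem theorem5 :
    (∀ n : ℕ, 6 ≤ n → n ≤ 12 →
      KGraph.condEx n KGraph.pathP KGraph.matchingM = 20 + (n - 6).choose 3 ∧
      ∀ H : KGraph 3 (Fin n),
        H ∈ KGraph.condExtremal n KGraph.pathP KGraph.matchingM ↔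
          H.Iso ((KGraph.complete 3 6).disjUnion (KGraph.complete 3 (n - 6)))) ∧
    (KGraph.condEx 13 KGraph.pathP KGraph.matchingM = 40 ∧
      ∀ H : KGraph 3 (Fin 13),
        H ∈ KGraph.condExtremal 13 KGraph.pathP KGraph.matchingM ↔
          H.Iso (((KGraph.complete 3 6).disjUnion (KGraph.complete 3 6)).disjUnion
              (KGraph.complete 3 1)) ∨
            H.Iso (KGraph.comet 13)) ∧
    (∀ n : ℕ, 14 ≤ n →
      KGraph.condEx n KGraph.pathP KGraph.matchingM = 4 + (n - 4).choose 2 ∧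
      ∀ H : KGraph 3 (Fin n),
        H ∈ KGraph.condExtremal n KGraph.pathP KGraph.matchingM ↔
          H.Iso (KGraph.comet n)) := by
  refine ⟨fun n h6 h12 => ?_, ?_, fun n h14 => ?_⟩
  -- In each range `Q` is isomorphism to the named hypergraphs; existence transports such a
  -- hypergraph to `Fin n`, and the isomorphism criteria turn `Q` into two cliques or a comet.
  · refine KGraph.condEx_and_condExtremal (fun H hF hM => ?_) (fun H hH => ?_)
      (KGraph.exists_iso _ (by simp; omega))
    · have := card_le_of_card_le_twelve ((KGraph.free_pathP_iff H).1 hF) (fun t ht => H.sized ht)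
        ((KGraph.contains_matchingM_iff H).1 hM) (by rwa [Fintype.card_fin])
      rw [Fintype.card_fin] at this
      exact ⟨this.1, fun h => (KGraph.iso_two_complete_iff h6 H).2 (this.2 h)⟩
    · exact KGraph.isTwoCliques_spec (by omega) ((KGraph.iso_two_complete_iff h6 H).1 hH)
  · refine KGraph.condEx_and_condExtremal (fun H hF hM => ?_) (fun H hH => ?_)
      ((KGraph.exists_iso (KGraph.comet 13) (by simp)).imp fun _ => Or.inr)
    · rw [KGraph.iso_two_complete_six_iff, KGraph.iso_comet_iff (by norm_num)]
      exact card_le_of_card_eq_thirteen ((KGraph.free_pathP_iff H).1 hF) (fun t ht => H.sized ht)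
        ((KGraph.contains_matchingM_iff H).1 hM) (Fintype.card_fin 13)
    · rw [KGraph.iso_two_complete_six_iff, KGraph.iso_comet_iff (by norm_num)] at hH
      rcases hH with hH | hH
      · exact KGraph.isTwoCliques_spec le_rfl hH
      · exact KGraph.isComet_spec (by norm_num) hH
  · refine KGraph.condEx_and_condExtremal (fun H hF hM => ?_) (fun H hH => ?_)
      (KGraph.exists_iso (KGraph.comet n) (by simp))
    · have := card_le_of_fourteen_le_card ((KGraph.free_pathP_iff H).1 hF) (fun t ht => H.sized ht)
        ((KGraph.contains_matchingM_iff H).1 hM) (by rwa [Fintype.card_fin])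
      rw [Fintype.card_fin] at this
      exact ⟨this.1, fun h => (KGraph.iso_comet_iff (by omega) H).2 (this.2 h)⟩
    · exact KGraph.isComet_spec (by omega) ((KGraph.iso_comet_iff (by omega) H).1 hH)
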